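/- **Setting.** Fix a nonempty finite set $E$ of edge types with converses $\bar a$ ($a\in E$, $\bar{\bar a}=a$), and for a string put $\overline{x_1\cdots x_n}=\bar x_n\cdots\bar x_1$. A *production pair* is $\{p,\bar p\}$ with $p=(a\to s)$, $\bar p=(\bar a\to\bar s)$, $a\in E$, $s\in(E\cup\bar E)^*$. An *$E$-system* is a finite set of rules $x\to s$, $x \in E\cup\bar E$, closed under $p\mapsto\bar p$; $\mathbf G(a)$ is the set of strings derivable from $a$. A *g-sequent* $\Gamma\vdash\Delta$ is a finite directed graph with edges labelled in $E$ (the set $\Gamma$ of edge atoms) and vertices labelled by sequents (the set $\Delta$ of prefixed sequents). An *abstract calculus* over $E$ is a finite set of rules, each of which is an initial rule $i(C,R)$ (no premise; $C$ is a finite tree whose edges carry labels $\mathbf G(b)$, and for each edge a path with string in $\mathbf G(b)$ must join the corresponding vertices), a local rule $l(R)$, an expansion rule $e(R)$ (the premise has one fresh vertex attached by one edge), a reachability rule $r(\mathcal C,R)$ (the $i$-th premise must have a path with string in $\mathbf G_i(b_i)$ between the two active vertices), or the Horn rule of a production pair $\{a\to s,\bar a\to\bar s\}$ (from $\Gamma,w\mathcal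 E_su,w\mathcal E_au\vdash\Delta$ infer $\Gamma,w\mathcal E_su\vdash\Delta$); $R$ is an arbitrary relation on the sequents involved and the set of remaining prefixed sequents. A *proof* is a finite tree of g-sequents built by rule applications, all of whose leaves are applications of initial rules. $\mathbf G(\mathfrak A)$ is the union of all $E$-systems occurring in labels of initial and reachability rules of $\mathfrak A$ and of the production pairs of its Horn rules. For an initial or reachability rule $\rho$, $\rho\oplus\mathbf G$ and $\rho\ominus\mathbf G$ replace every label $\mathbf G'(b)$ by $(\mathbf G'\cup\mathbf G)(b)$ and $(\mathbf G'\setminus\mathbf G)(b)$. $\mathfrak A$ is *implicit* if it has no Horn rule and $\rho\oplus\mathbf G(\mathfrak A)=\rho$ for all its initial and reachability rules $\rho$, and *explicit* if $\rho\ominus\mathbf G(\mathfrak A)=\rho$ for all of these. For a set $P$ of production pairs, $g(\mathfrak A,P)$ arises from $\mathfrak A$ by fracturing ($\ominus$) all initial and reachability rules by the rules in $P$ and adding the Horn rules of $P$. A pair $\{y\to t,\bar y\to\bar t\}$ *depends on* a different pair $\{x\to s,\bar x\to\bar s\}$ if $y$ occurs in $s$ or in $\bar s$; a set $P$ of production pairs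 of an $E$-system $\mathbf G$ is *fracturable* if there is no path of dependencies, within $\mathbf G$, from a pair in $P$ to a pair of $\mathbf G$ (depending on it) outside $P$. $P$ is *fracturable for $\mathfrak B$* if it is a fracturable set of production pairs of $\mathbf G(\mathfrak B\setminus \mathrm H(\mathfrak B))$, where $\mathrm H(\mathfrak B)$ is the set of Horn rules of $\mathfrak B$. The *downward space* $\mathbb D(\mathfrak A)=(\mathbf S,\leqslant)$: $\mathbf S$ is the least set that contains $\mathfrak A$ and with $\mathfrak B$ all $g(\mathfrak B,P)$, $P$ fracturable for $\mathfrak B$; and $\mathfrak C\leqslant\mathfrak B$ iff $\mathfrak B \in \mathbf S$ and $\mathfrak C=g(\mathfrak B,P)$ for some such $P$. The algorithm $\textsc{Explicate}(\mathfrak A)$ starts with $\mathbf S=\{\mathfrak A\}$, $(\leqslant)=\emptyset$ and, as long as this grows, adds for each $\leqslant$-minimal $\mathfrak B$ and each $P$ fracturable for $\mathfrak B$ the calculus $g(\mathfrak B,P)$ to $\mathbf S$ and the pair $g(\mathfrak B,P)\leqslant\mathfrak B$ to $(\leqslant)$; it returns $(\mathbf S,\leqslant)$. Two calculi $\mathfrak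 B,\mathfrak C$ over $E$ are *polynomially equivalent* if they prove the same g-sequents and there are polynomial-time functions that map every proof in $\mathfrak B$ to a proof in $\mathfrak C$ of the same g-sequent, and vice versa. **Theorem.** Let $\mathfrak A$ be an implicit calculus over $E$ with downward space $\mathbb D(\mathfrak A)=(\mathbf S,\leqslant)$. Then 1. $\textsc{Explicate}(\mathfrak A)$ terminates and returns $\mathbb D(\mathfrak A)$; 2. $\mathbb D(\mathfrak A)$ is computable from $\mathfrak A$ in $\mathrm{EXPTIME}$ (time $2^{p(n)}$ for a polynomial $p$, by one algorithm for all $E$ and $\mathfrak A$; sequent constraints $R$ are passed to the algorithm by name); 3. any two calculi in $\mathbf S$ are polynomially equivalent; 4. $(\mathbf S,\leqslant)$ has a unique bottom element $\bot$, and $\bot$ is computable from $\mathfrak A$ in $\mathrm{PTIME}$ (by one algorithm for all $E$ and $\mathfrak A$); 5. $\bot$ is explicit, and it is the only explicit calculus in $\mathbf S$. -/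

import Mathlib

namespace AbsCalc

/-! ### Strings, production rules, systems of production rules -/

/-- Vertices: the countably infinite universe. -/
abbrev Vertex := ℕ

/-- Sequents: a countably infinite set of atomic objects. -/
abbrev Sequent := ℕ

/-- The alphabet of edge types together with their converses: `(a, false)` is the edge type `a`,
`(a, true)` is its converse. -/
abbrev Letter (α : Type) := α × Bool

variable {α : Type}

/-- The converse of a letter. -/
def Letter.conv (x : Letter α) : Letter α := (x.1, !x.2)

/-- The converse of a string: reverse it and take the converse of every letter. -/
def convStr (s : List (Letter α)) : List (Letter α) := (s.map Letter.conv).reverse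

/-- Production rules `x ⟶ s` whose left-hand side is a single letter. -/
abbrev Production (α : Type) := Letter α × List (Letter α)

/-- The converse of a production rule. -/
def Production.conv (p : Production α) : Production α := (Letter.conv p.1, convStr p.2)

theorem Letter.conv_conv (x : Letter α) : Letter.conv (Letter.conv x) = x := by
  simp [Letter.conv]

theorem convStr_convStr (s : List (Letter α)) : convStr (convStr s) = s := by
  have h : (Letter.conv : Letter α → Letter α) ∘ Letter.conv = id :=
    funext Letter.conv_conv
  simp [convStr, h]

theorem Production.conv_conv (p : Production α) : Production.conv (Production.conv p) = p := by
  simp [Production.conv, Letter.conv_conv, convStr_convStr]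

/-- An `E`-system: a finite set of production rules with one-letter left-hand sides that is closed
under converses. -/
@[ext] structure ESystem (α : Type) where
  prods : Finset (Production α)
  closed : ∀ p ∈ prods, Production.conv p ∈ prods

/-- One rewriting step. -/
def ESystem.Step (G : ESystem α) (t t' : List (Letter α)) : Prop :=
  ∃ p ∈ G.prods, ∃ l r, t = l ++ [p.1] ++ r ∧ t' = l ++ p.2 ++ r

/-- The language of an edge type `a` relative to an `E`-system. -/
def ESystem.lang (G : ESystem α) (a : α) : Set (List (Letter α)) :=
  {t | Relation.ReflTransGen G.Step [(a, false)] t}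

/-- A production pair `{a ⟶ s, conv a ⟶ conv s}`. A production pair and the pair with the two
components exchanged are the same pair; it is given by its unique member whose left-hand side is
an unconverted edge type. -/
@[ext] structure ProdPair (α : Type) where
  lhs : α
  rhs : List (Letter α)

/-- The member `a ⟶ s` of a production pair. -/
def ProdPair.fwd (q : ProdPair α) : Production α := ((q.lhs, false), q.rhs)

/-- The set of all production pairs in an `E`-system. -/
def ESystem.pairs (G : ESystem α) : Set (ProdPair α) :=
  {q | q.fwd ∈ G.prods ∧ Production.conv q.fwd ∈ G.prods}

section Operations

variable [DecidableEq α]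

/-- The rules in a production pair. -/
def ProdPair.system (q : ProdPair α) : ESystem α where
  prods := {q.fwd, Production.conv q.fwd}
  closed := by
    intro p hp
    simp only [Finset.mem_insert, Finset.mem_singleton] at hp ⊢
    rcases hp with rfl | rfl
    · exact Or.inr rfl
    · exact Or.inl (Production.conv_conv _)

/-- The rules in a finite set of production pairs. -/
def ESystem.ofPairs (P : Finset (ProdPair α)) : ESystem α where
  prods := P.biUnion fun q => q.system.prods
  closed := by
    intro p hp
    obtain ⟨q, hq, hpq⟩ := Finset.mem_biUnion.1 hp
    exact Finset.mem_biUnion.2 ⟨q, hq, q.system.closed p hpq⟩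

/-- Union of two `E`-systems. -/
def ESystem.union (G G' : ESystem α) : ESystem α where
  prods := G.prods ∪ G'.prods
  closed := by
    intro p hp
    rcases Finset.mem_union.1 hp with h | h
    · exact Finset.mem_union_left _ (G.closed p h)
    · exact Finset.mem_union_right _ (G'.closed p h)

/-- Difference of two `E`-systems. -/
def ESystem.sdiff (G G' : ESystem α) : ESystem α where
  prods := G.prods \ G'.prods
  closed := by
    intro p hp
    obtain ⟨h, h'⟩ := Finset.mem_sdiff.1 hp
    refine Finset.mem_sdiff.2 ⟨G.closed p h, fun h2 => h' ?_⟩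
    have := G'.closed _ h2
    rwa [Production.conv_conv] at this

end Operations

/-! ### Generalized sequents -/

/-- A generalized sequent `Γ ⊢ Δ`: a finite set `Γ` of edge atoms `(w, a, u)` and a finite set `Δ`
of prefixed sequents `(w, S)`. The vertices are those prefixed in `Δ`; each has exactly one label,
and edges join vertices. -/
@[ext] structure GSeq (α : Type) where
  ant : Finset (Vertex × α × Vertex)
  suc : Finset (Vertex × Sequent)
  functional : ∀ w S S', (w, S) ∈ suc → (w, S') ∈ suc → S = S'
  source_mem : ∀ e ∈ ant, ∃ S, (e.1, S) ∈ suc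
  target_mem : ∀ e ∈ ant, ∃ S, (e.2.2, S) ∈ suc

/-- The set of vertices labelled by a set of prefixed sequents. -/
def vertsOf (D : Finset (Vertex × Sequent)) : Finset Vertex := D.image Prod.fst

/-- `w` and `u` are joined by an edge with letter `x` (backwards, if `x` is a converse). -/
def GSeq.Edge (G : GSeq α) (w : Vertex) (x : Letter α) (u : Vertex) : Prop :=
  if x.2 then (u, x.1, w) ∈ G.ant else (w, x.1, u) ∈ G.ant

/-- There is a path from `w` to `u` spelling the string `s`. -/
inductive GSeq.Path (G : GSeq α) : Vertex → List (Letter α) → Vertex → Prop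
  | nil {w} : w ∈ vertsOf G.suc → GSeq.Path G w [] w
  | cons {w v u x s} : G.Edge w x v → GSeq.Path G v s u → GSeq.Path G w (x :: s) u

/-! ### Structural constraints and sequent constraints -/

/-- The label `G(a)` of an edge of a structural constraint, as an expression. -/
@[ext] structure EdgeLabel (α : Type) where
  gram : ESystem α
  start : α

/-- There is a path from `w` to `u` spelling some word of the language `G(a)`. -/
def GSeq.Reaches (G : GSeq α) (w : Vertex) (L : EdgeLabel α) (u : Vertex) : Prop :=
  ∃ s ∈ L.gram.lang L.start, G.Path w s u

/-- A structural constraint: a finite tree with directed edges, every edge carrying a label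
`G(a)`. -/
structure Constraint (α : Type) where
  verts : Finset Vertex
  edges : Finset (Vertex × Vertex)
  label : edges → EdgeLabel α
  edges_sub : ∀ e ∈ edges, e.1 ∈ verts ∧ e.2 ∈ verts
  oriented : ∀ w u, (w, u) ∈ edges → (u, w) ∉ edges
  tree : (SimpleGraph.fromRel fun x y : verts => (x.1, y.1) ∈ edges).IsTree

/-- The g-sequent satisfies the constraint when the vertices of the constraint are instantiated by
the vertices given by `f`. -/
def GSeq.Satisfies (G : GSeq α) (C : Constraint α) (f : C.verts → Vertex) : Prop :=
  (∀ x, f x ∈ vertsOf G.suc) ∧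
    ∀ e : C.edges, G.Reaches (f ⟨e.1.1, (C.edges_sub e.1 e.2).1⟩) (C.label e)
      (f ⟨e.1.2, (C.edges_sub e.1 e.2).2⟩)

/-- Sequent constraints: relations between `n` sequents and a set of prefixed sequents. -/
abbrev SeqRel (n : ℕ) := Set ((Fin n → Sequent) × Set (Vertex × Sequent))

/-- A family of `n` sequents and a set of prefixed sequents satisfy a sequent constraint when some
arrangement of the family, together with the set, is in the relation. -/
def SeqRel.Sat {n : ℕ} {ι : Type} (R : SeqRel n) (S : ι → Sequent) (D : Set (Vertex × Sequent)) :
    Prop :=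
  ∃ e : Fin n ≃ ι, (S ∘ e, D) ∈ R

/-! ### Inference rules -/

/-- Inference rules.

* `initial C R`: initial rules.
* `locl n R`: local rules with `n` premises.
* `expansion D R`: expansion rules; `D` is the set of letters that the new edge may carry (a
  converse letter stands for an edge leaving the new vertex). `D = univ` means no restriction.
* `horn q`: the Horn rule of the production pair `q`.
* `reach n L R`: reachability rules with `n` premises. The two vertices of the `i`-th constraint
  are the two active vertices, hence the constraint is given by the label `L i` of its edge. -/
inductive Rule (α : Type)
  | initial (C : Constraint α) (R : SeqRel C.verts.card)
  | locl (n : ℕ) (R : SeqRel (n + 1))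
  | expansion (D : Finset (Letter α)) (R : SeqRel 3)
  | horn (q : ProdPair α)
  | reach (n : ℕ) (L : Fin n → EdgeLabel α) (R : SeqRel (2 * n + 2))

/-- The edge atom between `w` and `u` that a letter denotes: `w E_a u`, or `u E_a w` for the
converse of `a`. -/
def edgeAtom (w : Vertex) (x : Letter α) (u : Vertex) : Vertex × α × Vertex :=
  if x.2 then (u, x.1, w) else (w, x.1, u)

/-- The forward (`x` an edge type) or backward (`x` a converse) Horn rule of `x ⟶ s`: the
conclusion has an `s`-path from `w` to `u`, and the premise has the additional edge
`w E_x u`. -/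
def HornStep [DecidableEq α] (x : Letter α) (s : List (Letter α)) (prem concl : GSeq α) : Prop :=
  ∃ w u, concl.Path w s u ∧ prem.ant = insert (edgeAtom w x u) concl.ant ∧ prem.suc = concl.suc

/-- `App r n prems concl`: the g-sequent `concl` follows from the `n` premises by one application
of the rule `r`. -/
inductive Rule.App [DecidableEq α] :
    Rule α → (n : ℕ) → (Fin n → GSeq α) → GSeq α → Prop
  | initial (C : Constraint α) (R : SeqRel C.verts.card) (prems : Fin 0 → GSeq α) (G : GSeq α)
      (f : C.verts → Vertex) (S : C.verts → Sequent)
      (hC : G.Satisfies C f)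
      (hS : ∀ x, (f x, S x) ∈ G.suc)
      (hR : R.Sat S ((G.suc : Set (Vertex × Sequent)) \ Set.range fun x => (f x, S x))) :
      Rule.App (.initial C R) 0 prems G
  | locl (n : ℕ) (R : SeqRel (n + 1)) (prems : Fin n → GSeq α) (G : GSeq α)
      (D : Finset (Vertex × Sequent)) (w : Vertex) (S : Option (Fin n) → Sequent)
      (hw : w ∉ vertsOf D)
      (hP : ∀ i, (prems i).ant = G.ant ∧ (prems i).suc = insert (w, S (some i)) D)
      (hG : G.suc = insert (w, S none) D)
      (hR : R.Sat S D) :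
      Rule.App (.locl n R) n prems G
  | expansion (X : Finset (Letter α)) (R : SeqRel 3) (prems : Fin 1 → GSeq α) (G : GSeq α)
      (D : Finset (Vertex × Sequent)) (w u : Vertex) (x : Letter α) (S₁ S₂ S : Sequent)
      (hx : x ∈ X)
      (hw : w ∉ vertsOf D) (hu : u ∉ vertsOf G.suc)
      (hP : (prems 0).ant = insert (edgeAtom w x u) G.ant ∧
        (prems 0).suc = insert (w, S₁) (insert (u, S₂) D))
      (hG : G.suc = insert (w, S) D)
      (hR : R.Sat ![S₁, S₂, S] D) :
      Rule.App (.expansion X R) 1 prems G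
  | horn (q : ProdPair α) (prems : Fin 1 → GSeq α) (G : GSeq α)
      (h : HornStep (q.lhs, false) q.rhs (prems 0) G) :
      Rule.App (.horn q) 1 prems G
  | reach (n : ℕ) (L : Fin n → EdgeLabel α) (R : SeqRel (2 * n + 2)) (prems : Fin n → GSeq α)
      (G : GSeq α) (D : Finset (Vertex × Sequent)) (w u : Vertex)
      (S : Option (Fin n) × Bool → Sequent)
      (hw : w ∉ vertsOf D) (hu : u ∉ vertsOf D)
      (hP : ∀ i, (prems i).ant = G.ant ∧
        (prems i).suc = insert (w, S (some i, false)) (insert (u, S (some i, true)) D))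
      (hG : G.suc = insert (w, S (none, false)) (insert (u, S (none, true)) D))
      (hC : ∀ i, (prems i).Reaches w (L i) u)
      (hR : R.Sat S D) :
      Rule.App (.reach n L R) n prems G

theorem GSeq.edge_conv (G : GSeq α) {w u : Vertex} {x : Letter α} :
    G.Edge u (Letter.conv x) w ↔ G.Edge w x u := by
  rcases x with ⟨a, b⟩
  cases b <;> simp [GSeq.Edge, Letter.conv]

theorem GSeq.Edge.mem_left {G : GSeq α} {w u : Vertex} {x : Letter α} (h : G.Edge w x u) :
    w ∈ vertsOf G.suc := by
  rcases x with ⟨a, b⟩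
  cases b
  · obtain ⟨S, hS⟩ := G.source_mem (w, a, u) (by simpa [GSeq.Edge] using h)
    exact Finset.mem_image.2 ⟨_, hS, rfl⟩
  · obtain ⟨S, hS⟩ := G.target_mem (u, a, w) (by simpa [GSeq.Edge] using h)
    exact Finset.mem_image.2 ⟨_, hS, rfl⟩

theorem GSeq.Path.snoc {G : GSeq α} {w v u : Vertex} {s : List (Letter α)} {x : Letter α}
    (h : G.Path w s v) (e : G.Edge v x u) : G.Path w (s ++ [x]) u := by
  induction h with
  | nil _ => exact .cons e (.nil ((GSeq.edge_conv G).2 e).mem_left)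
  | cons e' _ ih => exact .cons e' (ih e)

theorem GSeq.Path.conv {G : GSeq α} {w u : Vertex} {s : List (Letter α)} (h : G.Path w s u) :
    G.Path u (convStr s) w := by
  induction h with
  | nil hw => exact .nil hw
  | cons e _ ih =>
    have := ih.snoc ((GSeq.edge_conv G).2 e)
    simpa [convStr] using this

/-- The Horn rules of `p` and of its converse are the same operation; in particular the backward
Horn rule of `conv a ⟶ s` is the forward Horn rule of `a ⟶ conv s`. This is why one constructor
`Rule.horn`, indexed by production pairs, covers forward and backward Horn rules. -/
theorem hornStep_conv [DecidableEq α] (x : Letter α) (s : List (Letter α)) (G G' : GSeq α) :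
    HornStep (Letter.conv x) (convStr s) G G' ↔ HornStep x s G G' := by
  have key : ∀ (x : Letter α) (s : List (Letter α)),
      HornStep x s G G' → HornStep (Letter.conv x) (convStr s) G G' := by
    rintro ⟨a, b⟩ s ⟨w, u, hp, ha, hs⟩
    refine ⟨u, w, hp.conv, ?_, hs⟩
    rw [ha]
    cases b <;> simp [edgeAtom, Letter.conv]
  refine ⟨fun h => ?_, key x s⟩
  have := key _ _ h
  rwa [Letter.conv_conv, convStr_convStr] at this

section Calculi

variable [DecidableEq α]

/-- The `E`-system of a rule. -/
def Rule.gram : Rule α → ESystem α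
  | .initial C _ =>
    { prods := C.edges.attach.biUnion fun e => (C.label e).gram.prods
      closed := by
        intro p hp
        obtain ⟨e, he, h⟩ := Finset.mem_biUnion.1 hp
        exact Finset.mem_biUnion.2 ⟨e, he, (C.label e).gram.closed p h⟩ }
  | .reach _ L _ =>
    { prods := Finset.univ.biUnion fun i => (L i).gram.prods
      closed := by
        intro p hp
        obtain ⟨e, he, h⟩ := Finset.mem_biUnion.1 hp
        exact Finset.mem_biUnion.2 ⟨e, he, (L e).gram.closed p h⟩ }
  | .horn q => q.system
  | .locl _ _ => ⟨∅, by simp⟩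
  | .expansion _ _ => ⟨∅, by simp⟩

/-- Absorption into a label. -/
def EdgeLabel.absorb (L : EdgeLabel α) (G : ESystem α) : EdgeLabel α := ⟨L.gram.union G, L.start⟩

/-- Fracturing of a label. -/
def EdgeLabel.fracture (L : EdgeLabel α) (G : ESystem α) : EdgeLabel α :=
  ⟨L.gram.sdiff G, L.start⟩

/-- Change the labels of a constraint. -/
def Constraint.mapLabel (C : Constraint α) (φ : EdgeLabel α → EdgeLabel α) : Constraint α :=
  { C with label := fun e => φ (C.label e) }

/-- Absorb an `E`-system into an initial or reachability rule; other rules are unaffected. -/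
def Rule.absorb (G : ESystem α) : Rule α → Rule α
  | .initial C R => .initial (C.mapLabel (·.absorb G)) R
  | .reach n L R => .reach n (fun i => (L i).absorb G) R
  | r => r

/-- Fracture an initial or reachability rule by an `E`-system; other rules are unaffected. -/
def Rule.fracture (G : ESystem α) : Rule α → Rule α
  | .initial C R => .initial (C.mapLabel (·.fracture G)) R
  | .reach n L R => .reach n (fun i => (L i).fracture G) R
  | r => r

/-- Initial rules. -/
def Rule.IsInitial : Rule α → Prop
  | .initial _ _ => True
  | _ => False

/-- Reachability rules. -/
def Rule.IsReach : Rule α → Prop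
  | .reach _ _ _ => True
  | _ => False

/-- Horn rules. -/
def Rule.IsHorn : Rule α → Prop
  | .horn _ => True
  | _ => False

/-- An abstract calculus over the set `α` of edge types: a finite set of rules. -/
@[ext] structure Calculus (α : Type) where
  rules : Set (Rule α)
  finite : rules.Finite

/-- The `E`-system of a calculus: the union of the `E`-systems of its rules. -/
noncomputable def Calculus.gram (A : Calculus α) : ESystem α where
  prods := (A.finite.biUnion fun r _ => r.gram.prods.finite_toSet).toFinset
  closed := by
    intro p hp
    simp only [Set.Finite.mem_toFinset, Set.mem_iUnion, Finset.mem_coe] at hp ⊢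
    obtain ⟨r, hr, h⟩ := hp
    exact ⟨r, hr, r.gram.closed p h⟩

/-- The Horn rules of a calculus. -/
def Calculus.hornRules (A : Calculus α) : Set (Rule α) := {r ∈ A.rules | r.IsHorn}

/-- Remove rules from a calculus. -/
def Calculus.diff (A : Calculus α) (X : Set (Rule α)) : Calculus α :=
  ⟨A.rules \ X, A.finite.sdiff⟩

/-- Fracture every initial and reachability rule of a calculus. -/
def Calculus.fracture (A : Calculus α) (G : ESystem α) : Calculus α :=
  ⟨Rule.fracture G '' A.rules, A.finite.image _⟩

/-- `g(A, P)`: fracture `A` by the rules of the production pairs in `P` and add the Horn rules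
of `P`. -/
def Calculus.g (A : Calculus α) (P : Finset (ProdPair α)) : Calculus α :=
  ⟨(A.fracture (ESystem.ofPairs P)).rules ∪ Rule.horn '' P,
    (A.fracture (ESystem.ofPairs P)).finite.union (P.finite_toSet.image _)⟩

/-- Explicit calculi. -/
def Calculus.IsExplicit (A : Calculus α) : Prop :=
  ∀ r ∈ A.rules, r.IsInitial ∨ r.IsReach → r.fracture A.gram = r

/-- Implicit calculi. -/
def Calculus.IsImplicit (A : Calculus α) : Prop :=
  (∀ r ∈ A.rules, ¬ r.IsHorn) ∧
    ∀ r ∈ A.rules, r.IsInitial ∨ r.IsReach → r.absorb A.gram = r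

/-! ### Dependency graphs and downward spaces -/

/-- `G.Dep q q'`: the production pair `q'` depends on the distinct production pair `q`, i.e. the
left-hand side of `q'` occurs in the right-hand side of `q` or in its converse. -/
def ESystem.Dep (G : ESystem α) (q q' : ProdPair α) : Prop :=
  q ∈ G.pairs ∧ q' ∈ G.pairs ∧ q ≠ q' ∧
    ((q'.lhs, false) ∈ q.rhs ∨ (q'.lhs, false) ∈ convStr q.rhs)

/-- Fracturable sets of production pairs: no edge of the dependency graph (the reflexive-transitive
closure of dependency) leaves the set. -/
def ESystem.Fracturable (G : ESystem α) (P : Finset (ProdPair α)) : Prop :=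
  (P : Set (ProdPair α)) ⊆ G.pairs ∧
    ∀ q ∈ P, ∀ q' ∈ G.pairs, q' ∉ P → ¬ Relation.ReflTransGen G.Dep q q'

/-- A set of production pairs that is fracturable for the calculus `B`, i.e. in the dependency
graph of the `E`-system of the rules of `B` that are not Horn rules. -/
def Calculus.Fracturable (B : Calculus α) (P : Finset (ProdPair α)) : Prop :=
  (B.diff B.hornRules).gram.Fracturable P

/-- A set of calculi with a binary relation on it; `(C, B) ∈ rel` means that `C` is below `B`. -/
@[ext] structure Space (α : Type) where
  carrier : Set (Calculus α)
  rel : Set (Calculus α × Calculus α)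

/-- The calculi in the downward space of `A`. -/
inductive InDown (A : Calculus α) : Calculus α → Prop
  | base : InDown A A
  | step (B : Calculus α) (P : Finset (ProdPair α)) :
      InDown A B → B.Fracturable P → InDown A (B.g P)

/-- The downward space of `A`. -/
def downSpace (A : Calculus α) : Space α where
  carrier := {B | InDown A B}
  rel := {q | InDown A q.2 ∧ ∃ P, q.2.Fracturable P ∧ q.1 = q.2.g P}

/-- Bottom elements of a space. -/
def Space.IsBot (X : Space α) (B : Calculus α) : Prop :=
  B ∈ X.carrier ∧ ∀ C ∈ X.carrier, (B, C) ∈ X.rel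

/-! ### The algorithm `Explicate` -/

/-- Minimal elements of a space. -/
def Space.IsMin (X : Space α) (B : Calculus α) : Prop :=
  B ∈ X.carrier ∧ ∀ C ∈ X.carrier, (C, B) ∈ X.rel → C = B

/-- One execution of the body of the while-loop: for each minimal `B` and each fracturable `P`
add `g(B, P)` and the pair `g(B, P) ≤ B`. -/
def Space.pass (X : Space α) : Space α where
  carrier := X.carrier ∪ {C | ∃ B P, X.IsMin B ∧ B.Fracturable P ∧ C = B.g P}
  rel := X.rel ∪ {q | ∃ P, X.IsMin q.2 ∧ q.2.Fracturable P ∧ q.1 = q.2.g P}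

/-- The while-loop: `ExplicateLoop X Y` says that the loop, started with `X`, terminates with
`Y`; it ends when the space does not grow any more. -/
inductive ExplicateLoop : Space α → Space α → Prop
  | done (X : Space α) : X.pass = X → ExplicateLoop X X
  | loop (X Y : Space α) : X.pass ≠ X → ExplicateLoop X.pass Y → ExplicateLoop X Y

/-- `Explicate` terminates on input `A` and returns `Y`. -/
def ExplicateReturns (A : Calculus α) (Y : Space α) : Prop := ExplicateLoop ⟨{A}, ∅⟩ Y

/-! ### Proofs -/

/-- Finite trees of g-sequents. -/
inductive Deriv (α : Type)
  | node (G : GSeq α) (n : ℕ) (prems : Fin n → Deriv α)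

/-- The g-sequent at the root. -/
def Deriv.concl : Deriv α → GSeq α
  | .node G _ _ => G

/-- Proofs in a calculus: every node is a rule application, and all leaves are applications of
initial rules. -/
inductive IsProof (A : Calculus α) : Deriv α → Prop
  | node (G : GSeq α) (n : ℕ) (prems : Fin n → Deriv α) (r : Rule α) :
      r ∈ A.rules → r.App n (fun i => (prems i).concl) G → (n = 0 → r.IsInitial) →
      (∀ i, IsProof A (prems i)) → IsProof A (.node G n prems)

end Calculi

/-! ### Computations and their cost

Programs of a first-order functional language over S-expressions. Every evaluation step is charged
at least one unit, and at least the size of any S-expression that it produces. -/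

/-- S-expressions over atoms. The atom `0` serves as the empty list and as `false`. -/
inductive Data
  | atom (n : ℕ)
  | pair (x y : Data)

/-- The number of nodes. -/
def Data.size : Data → ℕ
  | .atom _ => 1
  | .pair x y => x.size + y.size + 1

/-- First component. -/
def Data.hd : Data → Data
  | .atom _ => .atom 0
  | .pair x _ => x

/-- Second component. -/
def Data.tl : Data → Data
  | .atom _ => .atom 0
  | .pair _ y => y

/-- Expressions; `arg` is the argument of the function in whose body the expression occurs. -/
inductive Expr
  | arg
  | const (d : Data)
  | cons (e e' : Expr)
  | hd (e : Expr)
  | tl (e : Expr)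
  | isPair (e : Expr)
  | eq (e e' : Expr)
  | ite (c e e' : Expr)
  | call (i : ℕ) (e : Expr)

/-- A program: the list of the bodies of its functions, which may call each other recursively.
Function `0` is the main function. -/
abbrev Program := List Expr

/-- `Eval M x e v t`: with the argument `x`, the expression `e` has the value `v`, and its
evaluation costs `t`. -/
inductive Eval (M : Program) : Data → Expr → Data → ℕ → Prop
  | arg {x} : Eval M x .arg x x.size
  | const {x d} : Eval M x (.const d) d d.size
  | cons {x e e' u v m n} : Eval M x e u m → Eval M x e' v n →
      Eval M x (.cons e e') (.pair u v) (m + n + (Data.pair u v).size)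
  | hd {x e u m} : Eval M x e u m → Eval M x (.hd e) u.hd (m + u.hd.size)
  | tl {x e u m} : Eval M x e u m → Eval M x (.tl e) u.tl (m + u.tl.size)
  | isPair_pair {x e u v m} : Eval M x e (.pair u v) m → Eval M x (.isPair e) (.atom 1) (m + 1)
  | isPair_atom {x e k m} : Eval M x e (.atom k) m → Eval M x (.isPair e) (.atom 0) (m + 1)
  | eq_same {x e e' u m n} : Eval M x e u m → Eval M x e' u n →
      Eval M x (.eq e e') (.atom 1) (m + n + 1)
  | eq_diff {x e e' u v m n} : Eval M x e u m → Eval M x e' v n → u ≠ v →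
      Eval M x (.eq e e') (.atom 0) (m + n + 1)
  | ite_true {x c e e' b v m n} : Eval M x c b m → b ≠ .atom 0 → Eval M x e v n →
      Eval M x (.ite c e e') v (m + n + 1)
  | ite_false {x c e e' v m n} : Eval M x c (.atom 0) m → Eval M x e' v n →
      Eval M x (.ite c e e') v (m + n + 1)
  | call {x i e b u v m n} : Eval M x e u m → M[i]? = some b → Eval M u b v n →
      Eval M x (.call i e) v (m + n + 1)

/-- The program `M` halts on input `d` with output `d'` after `t` units of time. -/
def Runs (M : Program) (d d' : Data) (t : ℕ) : Prop := Eval M d (.call 0 .arg) d' t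

/-! ### Codes

Edge types are natural numbers here, i.e. the calculi are over a finite set `E` of natural numbers.
Vertices, sequents and edge types are coded by atoms, and so are sequent constraints, which are
arbitrary relations, through a naming `nm`. A finite set is coded by any list of codes of its
elements. -/

/-- Lists of S-expressions as S-expressions. -/
def Data.ofList : List Data → Data
  | [] => .atom 0
  | d :: l => .pair d (Data.ofList l)

/-- `d` is the list of codes of the elements of `s`, in some order, possibly with repetitions. -/
def CodesSet {β : Type} (c : β → Data → Prop) (s : Set β) (d : Data) : Prop :=
  ∃ l : List (β × Data), (∀ q ∈ l, c q.1 q.2) ∧ s = {x | ∃ q ∈ l, q.1 = x} ∧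
    d = Data.ofList (l.map Prod.snd)

/-- The code of a pair of codes of the components. -/
def CodesPair {β γ : Type} (c : β → Data → Prop) (c' : γ → Data → Prop) (q : β × γ) (d : Data) :
    Prop :=
  ∃ d₁ d₂, c q.1 d₁ ∧ c' q.2 d₂ ∧ d = .pair d₁ d₂

/-- Natural numbers as atoms. -/
def CodesNat (n : ℕ) (d : Data) : Prop := d = .atom n

section Codes

variable {E : Finset ℕ}

/-- The code of a letter. -/
def codeLetter (x : Letter E) : Data := .pair (.atom x.1) (.atom (if x.2 then 1 else 0))

/-- The code of a production rule. -/
def codeProduction (p : Production E) : Data :=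
  .pair (codeLetter p.1) (Data.ofList (p.2.map codeLetter))

/-- Codes of edge labels `G(a)`. -/
def CodesEdgeLabel (L : EdgeLabel E) (d : Data) : Prop :=
  ∃ d', CodesSet (fun p e => e = codeProduction p) (L.gram.prods : Set (Production E)) d' ∧
    d = .pair d' (.atom L.start)

/-- Codes of structural constraints. -/
def CodesConstraint (C : Constraint E) (d : Data) : Prop :=
  ∃ dv de, CodesSet CodesNat (C.verts : Set ℕ) dv ∧
    CodesSet (fun (e : C.edges) x => ∃ y, CodesEdgeLabel (C.label e) y ∧
      x = .pair (.pair (.atom e.1.1) (.atom e.1.2)) y) Set.univ de ∧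
    d = .pair dv de

/-- Namings of sequent constraints. -/
abbrev Naming := (Σ n, SeqRel n) → ℕ

/-- Codes of rules. -/
inductive CodesRule (nm : Naming) : Rule E → Data → Prop
  | initial {C R d} : CodesConstraint C d →
      CodesRule nm (.initial C R) (.pair (.atom 0) (.pair d (.atom (nm ⟨_, R⟩))))
  | locl {n R} : CodesRule nm (.locl n R)
      (.pair (.atom 1) (.pair (Data.ofList (List.replicate n (.atom 0))) (.atom (nm ⟨_, R⟩))))
  | expansion {D : Finset (Letter E)} {R d} : CodesSet (fun x e => e = codeLetter x) (D : Set (Letter E)) d →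
      CodesRule nm (.expansion D R) (.pair (.atom 2) (.pair d (.atom (nm ⟨_, R⟩))))
  | horn {q} : CodesRule nm (.horn q) (.pair (.atom 3) (codeProduction q.fwd))
  | reach {n L R ds} : (∀ i : Fin n, CodesEdgeLabel (L i) (ds i)) →
      CodesRule nm (.reach n L R)
        (.pair (.atom 4) (.pair (Data.ofList (List.ofFn ds)) (.atom (nm ⟨_, R⟩))))

/-- Codes of calculi: the set of edge types and the set of rules. -/
def CodesCalculus (nm : Naming) (A : Calculus E) (d : Data) : Prop :=
  ∃ d₁ d₂, CodesSet CodesNat (E : Set ℕ) d₁ ∧ CodesSet (CodesRule nm) A.rules d₂ ∧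
    d = .pair d₁ d₂

/-- Codes of spaces of calculi. -/
def CodesSpace (nm : Naming) (X : Space E) (d : Data) : Prop :=
  ∃ d₁ d₂, CodesSet (CodesCalculus nm) X.carrier d₁ ∧
    CodesSet (CodesPair (CodesCalculus nm) (CodesCalculus nm)) X.rel d₂ ∧ d = .pair d₁ d₂

/-- The sequent constraints that occur in a rule. -/
def Rule.seqRels : Rule E → Set (Σ n, SeqRel n)
  | .initial _ R => {⟨_, R⟩}
  | .locl _ R => {⟨_, R⟩}
  | .expansion _ R => {⟨_, R⟩}
  | .horn _ => ∅
  | .reach _ _ R => {⟨_, R⟩}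

/-- The naming gives different names to different sequent constraints of the calculus. -/
def Names (nm : Naming) (A : Calculus E) : Prop := Set.InjOn nm (⋃ r ∈ A.rules, r.seqRels)

/-- Codes of g-sequents. -/
def CodesGSeq (G : GSeq E) (d : Data) : Prop :=
  ∃ d₁ d₂, CodesSet (fun e x => x = .pair (.atom e.1) (.pair (.atom e.2.1) (.atom e.2.2)))
      (G.ant : Set (Vertex × E × Vertex)) d₁ ∧
    CodesSet (CodesPair CodesNat CodesNat) (G.suc : Set (Vertex × Sequent)) d₂ ∧ d = .pair d₁ d₂

/-- Codes of trees of g-sequents. -/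
inductive CodesDeriv : Deriv E → Data → Prop
  | node {G n prems d ds} : CodesGSeq G d → (∀ i : Fin n, CodesDeriv (prems i) (ds i)) →
      CodesDeriv (.node G n prems) (.pair d (Data.ofList (List.ofFn ds)))

/-- There is a polynomial-time function that maps every proof in `A` to a proof in `B` of the same
g-sequent. -/
def PTimeTranslatable (A B : Calculus E) : Prop :=
  ∃ (M : Program) (p : Polynomial ℕ), ∀ (π : Deriv E) (d : Data), IsProof A π → CodesDeriv π d →
    ∃ (π' : Deriv E) (d' : Data) (t : ℕ), IsProof B π' ∧ π'.concl = π.concl ∧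
      CodesDeriv π' d' ∧ Runs M d d' t ∧ t ≤ p.eval d.size

/-- Polynomial equivalence of calculi. -/
def PolyEquiv (A B : Calculus E) : Prop :=
  (∀ G : GSeq E, (∃ π, IsProof A π ∧ π.concl = G) ↔ ∃ π, IsProof B π ∧ π.concl = G) ∧
    PTimeTranslatable A B ∧ PTimeTranslatable B A

end Codes

end AbsCalc

open AbsCalc

/-! Structure of the downward space. Let `A` be implicit and let G be its `E`-system. Every label of
`A` has exactly the system G (`Calculus.IsImplicit.label_gram`). A set of production pairs is
fracturable iff it is closed under direct dependency (`ESystem.fracturable_iff`), and fracturing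
twice is fracturing by the union (`Calculus.g_g`). Hence the calculi in the downward space are
exactly the g(A, P) with P fracturable in G (`inDown_iff`). The set P can be read off from the Horn
rules (`Calculus.g_injective`), and the order is reverse inclusion of these sets
(`mem_downSpace_rel`). The bottom belongs to the set of all pairs. There all labels are empty, so it
is explicit; for any smaller P some label keeps a rule, and fracturing by the system of the calculus
would remove it (`isExplicit_g_iff`).

The algorithm. The first pass, from `A` alone, produces all g(A, P). Every one of them other than
`A` is then minimal, so the second pass produces the whole order, and nothing is added after that
(`explicate_returns`).

Polynomial equivalence. A proof in g(A, P) is turned into one in g(A, Q) by a traversal from the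
root (`translate_spec`). It carries a target g-sequent with the same prefixed sequents as the
source, such that every source edge `a` is matched by a target path spelling a string that G derives
from `a` (`GSeq.Covers`). A unary step that leaves the prefixed sequents unchanged, in particular
every Horn step, is skipped: the target still covers the premise. At any other step the target is
first closed under the Horn rules of Q, and then the Q-fractured form of the same rule is applied.
Its reachability conditions hold for two reasons. Paths for G \ P are paths for G and transfer along
the covering. Over a Q-closed g-sequent, paths for G yield paths for G \ Q
(`GSeq.Saturated.reaches`): since Q is closed under dependency, the right-hand side of a rule of Q
cannot be rewritten by G \ Q, so it survives as a segment of the path, and closure replaces that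
segment by one edge. A closure adds at most |V|·|E|·|V| edges, so the translation stays polynomial.

Complexity. Polynomial-time functions on S-expressions are closed under composition, bounded
recursion on lists and bounded recursion on trees (`PolyTime.foldr`, `polyTime_rose`). The bottom is
a polynomial-time function of the code of `A`. The whole space is a polynomial-time function of that
code together with the list of all sets of production pairs, which has exponential size
(`expTime_sublists`). -/

namespace AbsCalc

/-! ### Linking of programs -/

/-- Equality of data is decidable. -/
def Data.decEq : (x y : Data) → Decidable (x = y)
  | .atom m, .atom n => decidable_of_iff (m = n) (by simp)
  | .pair x y, .pair x' y' =>
    letI := Data.decEq x x'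
    letI := Data.decEq y y'
    decidable_of_iff (x = x' ∧ y = y') (by simp)
  | .atom _, .pair _ _ => .isFalse (by simp)
  | .pair _ _, .atom _ => .isFalse (by simp)

instance : DecidableEq Data := Data.decEq

/-- Shift the indices of all called functions. -/
def Expr.shift (k : ℕ) : Expr → Expr
  | .arg => .arg
  | .const d => .const d
  | .cons e e' => .cons (e.shift k) (e'.shift k)
  | .hd e => .hd (e.shift k)
  | .tl e => .tl (e.shift k)
  | .isPair e => .isPair (e.shift k)
  | .eq e e' => .eq (e.shift k) (e'.shift k)
  | .ite c e e' => .ite (c.shift k) (e.shift k) (e'.shift k)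
  | .call i e => .call (i + k) (e.shift k)

/-- Only `call` consults the program, and its cost does not depend on the index. A program can
therefore be placed inside a larger one without any change in cost. -/
theorem Eval.shift {M M' : Program} {k : ℕ}
    (h : ∀ i b, M[i]? = some b → M'[i + k]? = some (b.shift k)) {x v : Data} {e : Expr} {t : ℕ}
    (he : Eval M x e v t) : Eval M' x (e.shift k) v t := by
  induction he with
  | arg => exact .arg
  | const => exact .const
  | cons _ _ h₁ h₂ => exact .cons h₁ h₂
  | hd _ h => exact .hd h
  | tl _ h => exact .tl h
  | isPair_pair _ h => exact .isPair_pair h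
  | isPair_atom _ h => exact .isPair_atom h
  | eq_same _ _ h₁ h₂ => exact .eq_same h₁ h₂
  | eq_diff _ _ hne h₁ h₂ => exact .eq_diff h₁ h₂ hne
  | ite_true _ hb _ h₁ h₂ => exact .ite_true h₁ hb h₂
  | ite_false _ _ h₁ h₂ => exact .ite_false h₁ h₂
  | call _ hi _ h₁ h₂ => exact .call h₁ (h _ _ hi) h₂

@[simp] theorem Data.hd_pair (x y : Data) : (Data.pair x y).hd = x := rfl

@[simp] theorem Data.tl_pair (x y : Data) : (Data.pair x y).tl = y := rfl

theorem Data.size_pos (d : Data) : 0 < d.size := by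
  cases d <;> simp [Data.size]

/-- Each produced value is charged its own size. A time bound thus doubles as a bound on the output
size, which is what makes composition of polynomial-time functions polynomial. -/
theorem Eval.size_le {M : Program} {x v : Data} {e : Expr} {t : ℕ} (h : Eval M x e v t) :
    v.size ≤ t := by
  induction h with
  | isPair_pair | isPair_atom | eq_same | eq_diff => simp [Data.size]
  | arg | const => exact le_rfl
  | cons | hd | tl => omega
  | ite_true | ite_false | call => omega

/-- The function with index `i` of the program `M` computes `f` within time `T`. -/
def Computes (M : Program) (i : ℕ) (f : Data → Data) (T : Data → ℕ) : Prop :=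
  ∃ b, M[i]? = some b ∧ ∀ x, ∃ t, Eval M x b (f x) t ∧ t ≤ T x

theorem Computes.call {M : Program} {i : ℕ} {f : Data → Data} {T : Data → ℕ}
    (h : Computes M i f T) {x u : Data} {e : Expr} {m : ℕ} (he : Eval M x e u m) :
    ∃ t, Eval M x (.call i e) (f u) t ∧ t ≤ m + T u + 1 := by
  obtain ⟨b, hb, h⟩ := h
  obtain ⟨t, ht, hle⟩ := h u
  exact ⟨_, .call he hb ht, by omega⟩

/-- Monotonicity of polynomials with natural coefficients. -/
theorem eval_mono (p : Polynomial ℕ) : Monotone fun n => p.eval n := by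
  intro a b hab
  simp only [Polynomial.eval_eq_sum, Polynomial.sum]
  gcongr

theorem eval_le (p : Polynomial ℕ) {a b : ℕ} (h : a ≤ b) : p.eval a ≤ p.eval b := eval_mono p h

/-- Functions that are computable in polynomial time. -/
@[fun_prop] def PolyTime (f : Data → Data) : Prop :=
  ∃ (M : Program) (p : Polynomial ℕ), Computes M 0 f fun x => p.eval x.size

theorem PolyTime.runs {f : Data → Data} (h : PolyTime f) :
    ∃ (M : Program) (p : Polynomial ℕ), ∀ x, ∃ t, Runs M x (f x) t ∧ t ≤ p.eval x.size := by
  obtain ⟨M, p, h⟩ := h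
  refine ⟨M, p + Polynomial.X + 1, fun x => ?_⟩
  obtain ⟨t, ht, hle⟩ := h.call (Eval.arg (x := x))
  exact ⟨t, ht, by simp; omega⟩

theorem PolyTime.size_le {f : Data → Data} (h : PolyTime f) :
    ∃ p : Polynomial ℕ, ∀ x, (f x).size ≤ p.eval x.size := by
  obtain ⟨M, p, b, -, h⟩ := h
  refine ⟨p, fun x => ?_⟩
  obtain ⟨t, ht, hle⟩ := h x
  exact ht.size_le.trans hle

/-- Only the length of the front part `H` is fixed in advance: its bodies call the linked functions,
so they can be written only once the index `i` is known. -/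
theorem Computes.link {M : Program} {f : Data → Data} {T : Data → ℕ} (hf : Computes M 0 f T)
    (m : ℕ) : ∃ (N : Program) (i : ℕ), ∀ H R : Program, H.length = m →
      Computes (H ++ N ++ R) i f T := by
  obtain ⟨b, hb, h⟩ := hf
  refine ⟨M.map (Expr.shift m), m, fun H R hH => ⟨b.shift m, ?_, fun x => ?_⟩⟩
  · have h0 : 0 < M.length := (List.getElem?_eq_some_iff.1 hb).1
    rw [List.append_assoc, List.getElem?_append_right (by omega), List.getElem?_append_left
      (by simp; omega)]
    simp [hH, hb]
  · obtain ⟨t, ht, hle⟩ := h x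
    refine ⟨t, ht.shift fun i b hi => ?_, hle⟩
    have h0 : i < M.length := (List.getElem?_eq_some_iff.1 hi).1
    rw [List.append_assoc, List.getElem?_append_right (by omega), List.getElem?_append_left
      (by simp; omega)]
    simp [hH, hi]

/-- Three is the largest number of subprograms that a construction below needs (for `ite`);
constructions with fewer repeat one of them. -/
theorem Computes.link₃ {M₁ M₂ M₃ : Program} {f g h : Data → Data} {T₁ T₂ T₃ : Data → ℕ}
    (hf : Computes M₁ 0 f T₁) (hg : Computes M₂ 0 g T₂) (hh : Computes M₃ 0 h T₃) (m : ℕ) :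
    ∃ (N : Program) (i j k : ℕ), ∀ H : Program, H.length = m →
      Computes (H ++ N) i f T₁ ∧ Computes (H ++ N) j g T₂ ∧ Computes (H ++ N) k h T₃ := by
  obtain ⟨N₁, i, h₁⟩ := hf.link m
  obtain ⟨N₂, j, h₂⟩ := hg.link (m + N₁.length)
  obtain ⟨N₃, k, h₃⟩ := hh.link (m + N₁.length + N₂.length)
  refine ⟨N₁ ++ N₂ ++ N₃, i, j, k, fun H hH => ⟨?_, ?_, ?_⟩⟩
  · simpa only [List.append_assoc] using h₁ H (N₂ ++ N₃) hH
  · simpa only [List.append_assoc] using h₂ (H ++ N₁) N₃ (by simp [hH])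
  · simpa only [List.append_assoc, List.append_nil] using
      h₃ (H ++ N₁ ++ N₂) [] (by simp [hH, add_assoc])

theorem Computes.mono {M : Program} {i : ℕ} {f : Data → Data} {T T' : Data → ℕ}
    (h : Computes M i f T) (hT : ∀ x, T x ≤ T' x) : Computes M i f T' := by
  obtain ⟨b, hb, h⟩ := h
  refine ⟨b, hb, fun x => ?_⟩
  obtain ⟨t, ht, hle⟩ := h x
  exact ⟨t, ht, hle.trans (hT _)⟩

theorem PolyTime.link₃ (m : ℕ) {f g h : Data → Data} (hf : PolyTime f) (hg : PolyTime g)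
    (hh : PolyTime h) :
    ∃ (N : Program) (i j k : ℕ) (p : Polynomial ℕ), ∀ H : Program, H.length = m →
      (Computes (H ++ N) i f fun x => p.eval x.size) ∧
      (Computes (H ++ N) j g fun x => p.eval x.size) ∧
      (Computes (H ++ N) k h fun x => p.eval x.size) := by
  obtain ⟨M₁, p₁, h₁⟩ := hf
  obtain ⟨M₂, p₂, h₂⟩ := hg
  obtain ⟨M₃, p₃, h₃⟩ := hh
  obtain ⟨N, i, j, k, hN⟩ := h₁.link₃ h₂ h₃ m
  refine ⟨N, i, j, k, p₁ + p₂ + p₃, fun H hH => ⟨(hN H hH).1.mono fun x => ?_,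
    (hN H hH).2.1.mono fun x => ?_, (hN H hH).2.2.mono fun x => ?_⟩⟩ <;>
  simp only [Polynomial.eval_add] <;> omega

/-! ### Closure properties of polynomial time -/

namespace PolyTime

variable {f g h : Data → Data}

@[fun_prop] theorem id' : PolyTime fun x => x :=
  ⟨[.arg], Polynomial.X, .arg, rfl, fun _ => ⟨_, .arg, by simp⟩⟩

@[fun_prop] theorem const (d : Data) : PolyTime fun _ => d :=
  ⟨[.const d], Polynomial.C d.size, .const d, rfl, fun _ => ⟨_, .const, by simp⟩⟩

@[fun_prop] theorem comp (hg : PolyTime g) (hf : PolyTime f) : PolyTime fun x => g (f x) := by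
  obtain ⟨N, i, j, _, p, H⟩ := link₃ 1 hf hg hf
  let B : Program := [.call j (.call i .arg)]
  obtain ⟨hi, hj, -⟩ := H B rfl
  obtain ⟨q, hq⟩ := hf.size_le
  refine ⟨B ++ N, Polynomial.X + p + p.comp q + 2, _, rfl, fun x => ?_⟩
  obtain ⟨t, ht, hle⟩ := hi.call (Eval.arg (x := x))
  obtain ⟨t', ht', hle'⟩ := hj.call ht
  have := eval_le p (hq x)
  exact ⟨_, ht', by simp; omega⟩

@[fun_prop] theorem pair (hf : PolyTime f) (hg : PolyTime g) :
    PolyTime fun x => Data.pair (f x) (g x) := by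
  obtain ⟨N, i, j, _, p, H⟩ := link₃ 1 hf hg hf
  let B : Program := [.cons (.call i .arg) (.call j .arg)]
  obtain ⟨hi, hj, -⟩ := H B rfl
  obtain ⟨q, hq⟩ := hf.size_le
  obtain ⟨r, hr⟩ := hg.size_le
  refine ⟨B ++ N, 2 * Polynomial.X + 2 * p + q + r + 3, _, rfl, fun x => ?_⟩
  obtain ⟨t, ht, hle⟩ := hi.call (Eval.arg (x := x))
  obtain ⟨t', ht', hle'⟩ := hj.call (Eval.arg (x := x))
  have := hq x
  have := hr x
  exact ⟨_, .cons ht ht', by simp [Data.size]; omega⟩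

theorem _root_.AbsCalc.Data.hd_size_le (d : Data) : d.hd.size ≤ d.size := by
  cases d <;> simp [Data.hd, Data.size]; omega

theorem _root_.AbsCalc.Data.tl_size_le (d : Data) : d.tl.size ≤ d.size := by
  cases d <;> simp [Data.tl, Data.size]; omega

@[fun_prop] theorem hd' : PolyTime Data.hd :=
  ⟨[.hd .arg], 2 * Polynomial.X, _, rfl, fun x => ⟨_, .hd .arg, by
    have := x.hd_size_le
    simp; omega⟩⟩

@[fun_prop] theorem tl' : PolyTime Data.tl :=
  ⟨[.tl .arg], 2 * Polynomial.X, _, rfl, fun x => ⟨_, .tl .arg, by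
    have := x.tl_size_le
    simp; omega⟩⟩

@[fun_prop] theorem hd (hf : PolyTime f) : PolyTime fun x => (f x).hd := hd'.comp hf

@[fun_prop] theorem tl (hf : PolyTime f) : PolyTime fun x => (f x).tl := tl'.comp hf

/-- Truth values as data. -/
def _root_.AbsCalc.bit (b : Bool) : Data := .atom (if b then 1 else 0)

/-- Is the datum a pair? -/
def _root_.AbsCalc.Data.isPair : Data → Bool
  | .atom _ => false
  | .pair _ _ => true

@[fun_prop] theorem isPair (hf : PolyTime f) : PolyTime fun x => bit (f x).isPair := by
  have : PolyTime fun x : Data => bit x.isPair :=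
    ⟨[.isPair .arg], Polynomial.X + 1, _, rfl, fun x => by
      cases x with
      | atom n => exact ⟨_, .isPair_atom .arg, by simp⟩
      | pair x y => exact ⟨_, .isPair_pair .arg, by simp⟩⟩
  exact this.comp hf

@[fun_prop] theorem eq (hf : PolyTime f) (hg : PolyTime g) :
    PolyTime fun x => bit (decide (f x = g x)) := by
  have : PolyTime fun x : Data => bit (decide (x.hd = x.tl)) :=
    ⟨[.eq (.hd .arg) (.tl .arg)], 4 * Polynomial.X + 1, _, rfl, fun x => by
      have h1 := x.hd_size_le
      have h2 := x.tl_size_le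
      by_cases hx : x.hd = x.tl
      · have h : Eval [.eq (.hd .arg) (.tl .arg)] x (.tl .arg) x.hd (x.size + x.tl.size) :=
          by rw [hx]; exact .tl .arg
        exact ⟨_, by simpa [hx, bit] using Eval.eq_same (.hd .arg) h, by simp; omega⟩
      · simp only [hx, decide_false]
        refine ⟨_, .eq_diff (.hd .arg) (.tl .arg) hx, by simp; omega⟩⟩
  exact this.comp (hf.pair hg)

theorem ite {c : Data → Bool} (hc : PolyTime fun x => bit (c x)) (hf : PolyTime f)
    (hg : PolyTime g) : PolyTime fun x => if c x then f x else g x := by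
  obtain ⟨N, i, j, k, p, H⟩ := link₃ 1 hc hf hg
  let B : Program := [.ite (.call i .arg) (.call j .arg) (.call k .arg)]
  obtain ⟨hi, hj, hk⟩ := H B rfl
  refine ⟨B ++ N, 2 * Polynomial.X + 2 * p + 3, _, rfl, fun x => ?_⟩
  obtain ⟨t, ht, hle⟩ := hi.call (Eval.arg (x := x))
  obtain ⟨t', ht', hle'⟩ := hj.call (Eval.arg (x := x))
  obtain ⟨t'', ht'', hle''⟩ := hk.call (Eval.arg (x := x))
  cases hcx : c x
  · rw [hcx] at ht
    exact ⟨_, .ite_false ht (by simpa [hcx] using ht''), by simp; omega⟩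
  · rw [hcx] at ht
    exact ⟨_, .ite_true ht (by simp [bit]) (by simpa [hcx] using ht'), by simp; omega⟩

theorem bite {c a b : Data → Bool} (hc : PolyTime fun x => bit (c x))
    (ha : PolyTime fun x => bit (a x)) (hb : PolyTime fun x => bit (b x)) :
    PolyTime fun x => bit (if c x then a x else b x) := by
  simpa only [apply_ite bit] using ite hc ha hb

@[fun_prop] theorem and {a b : Data → Bool} (ha : PolyTime fun x => bit (a x))
    (hb : PolyTime fun x => bit (b x)) : PolyTime fun x => bit (a x && b x) := by
  have := bite ha hb (const (bit false))
  convert this using 3 with x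
  cases a x <;> rfl

@[fun_prop] theorem or {a b : Data → Bool} (ha : PolyTime fun x => bit (a x))
    (hb : PolyTime fun x => bit (b x)) : PolyTime fun x => bit (a x || b x) := by
  have := bite ha (const (bit true)) hb
  convert this using 3 with x
  cases a x <;> rfl

@[fun_prop] theorem not {a : Data → Bool} (ha : PolyTime fun x => bit (a x)) :
    PolyTime fun x => bit (!a x) := by
  have := bite ha (const (bit false)) (const (bit true))
  convert this using 3 with x
  cases a x <;> rfl

end PolyTime

/-! ### Recursion on lists -/

/-- Lists coded by data; every atom is a code of the empty list. -/
def Data.toList : Data → List Data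
  | .atom _ => []
  | .pair x y => x :: y.toList

@[simp] theorem Data.toList_ofList (l : List Data) : (Data.ofList l).toList = l := by
  induction l with
  | nil => rfl
  | cons x l ih => simp [Data.ofList, Data.toList, ih]

/-- Recursion on a list in the presence of a parameter. -/
theorem foldr_cost {b : Data → Data} {F : Data → Data → Data → Data} (hb : PolyTime b)
    (hF : PolyTime fun z => F z.hd z.tl.hd z.tl.tl) :
    ∃ (M : Program) (p : Polynomial ℕ) (e : Expr), M[0]? = some e ∧ ∀ (z : Data) (S : ℕ),
      (∀ l, l <:+ z.tl.toList → (l.foldr (F z.hd) (b z.hd)).size ≤ S) →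
      ∃ t, Eval M z e (z.tl.toList.foldr (F z.hd) (b z.hd)) t ∧ t ≤ p.eval (z.size + S) := by
  obtain ⟨N, i, j, _, p, H⟩ := PolyTime.link₃ 2 hb hF hb
  -- Function 1 is the recursion and expects a pair of the parameter and the remaining list.
  -- Function 0 rebuilds this pair because the input may be an atom.
  let B : Program := [.call 1 (.cons (.hd .arg) (.tl .arg)),
    .ite (.isPair (.tl .arg)) (.call j (.cons (.hd .arg) (.cons
    (.hd (.tl .arg)) (.call 1 (.cons (.hd .arg) (.tl (.tl .arg))))))) (.call i (.hd .arg))]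
  obtain ⟨hi, hj, -⟩ := H B rfl
  refine ⟨B ++ N, Polynomial.X * (p.comp (2 * Polynomial.X + 2) + 20 * Polynomial.X + 20) +
    10 * Polynomial.X + 10, _, rfl, fun z S hS => ?_⟩
  set d := z.hd with hd
  set l := z.tl with hl
  have hdz : d.size ≤ z.size := z.hd_size_le
  have hlz : l.size ≤ z.size := z.tl_size_le
  -- `W` bounds the work for one list cell: a call of `F` on data of size at most 2(z.size + S) + 2,
  -- and the overhead of assembling its argument.
  set W := p.eval (2 * (z.size + S) + 2) + 20 * (z.size + S) + 20 with hW
  suffices hs : ∀ l' : Data, l'.toList <:+ l.toList → l'.size ≤ l.size → ∃ t,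
      Eval (B ++ N) (.pair d l') _ (l'.toList.foldr (F d) (b d)) t ∧ t ≤ l'.size * W by
    obtain ⟨t, ht, hle⟩ := hs l List.suffix_rfl le_rfl
    refine ⟨_, .call (.cons (.hd .arg) (.tl .arg)) rfl ht, ?_⟩
    have : l.size * W ≤ (z.size + S) * W := Nat.mul_le_mul_right _ (by omega)
    simp only [Polynomial.eval_mul, Polynomial.eval_add, Polynomial.eval_comp, Polynomial.eval_X,
      Polynomial.eval_ofNat, ← hW, Data.size, ← hd, ← hl]
    omega
  intro l'
  induction l' with
  | atom n =>
    intro _ _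
    obtain ⟨t, ht, hle⟩ := hi.call (Eval.hd (Eval.arg (x := Data.pair d (.atom n))))
    refine ⟨_, .ite_false (.isPair_atom (.tl .arg)) ht, ?_⟩
    have : p.eval d.size ≤ p.eval (2 * (z.size + S) + 2) := eval_le p (by omega)
    have := l.size_pos
    simp [Data.size, Data.hd, Data.tl] at hle ⊢
    omega
  | pair x y _ ih =>
    intro hl' hsz
    simp only [Data.size] at hsz
    obtain ⟨t, ht, hle⟩ := ih ((List.suffix_cons _ _).trans hl') (by omega)
    set r := y.toList.foldr (F d) (b d) with hr
    have hrS : r.size ≤ S := hS _ ((List.suffix_cons _ _).trans hl')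
    have h0 : Eval (B ++ N) (.pair d (.pair x y)) _ r _ :=
      Eval.call (i := 1) (Eval.cons (.hd .arg) (.tl (.tl .arg))) rfl ht
    obtain ⟨t', ht', hle'⟩ := hj.call (Eval.cons (Eval.hd (Eval.arg (x := Data.pair d (.pair x y))))
      (Eval.cons (Eval.hd (.tl .arg)) h0))
    refine ⟨_, .ite_true (.isPair_pair (.tl .arg)) (by simp) ht', ?_⟩
    have : p.eval (Data.pair d (.pair x r)).size ≤ p.eval (2 * (z.size + S) + 2) :=
      eval_le p (by simp only [Data.size]; omega)
    simp only [Data.size, Data.hd, Data.tl, add_mul, one_mul] at hle hle' this ⊢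
    have hx := Nat.zero_le (x.size * W)
    omega

end AbsCalc

namespace AbsCalc

theorem foldr_size_le {F : Data → Data → Data} {b : Data} {l : List Data} {c k : ℕ}
    (h : ∀ x ∈ l, ∀ r, (F x r).size ≤ r.size + c) (hk : l.length ≤ k) :
    (l.foldr F b).size ≤ b.size + k * c := by
  refine le_trans ?_ (Nat.add_le_add_left (Nat.mul_le_mul_right c hk) _)
  clear hk
  induction l with
  | nil => simp
  | cons x l ih =>
    have h1 := h x (by simp) (l.foldr F b)
    have h2 := ih fun y hy => h y (by simp [hy])
    simp only [List.foldr_cons, List.length_cons, add_mul, one_mul]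
    omega

theorem Data.length_toList_le (d : Data) : d.toList.length ≤ d.size := by
  induction d with
  | atom => simp [Data.toList]
  | pair x y _ ih => simp [Data.toList, Data.size]; omega

theorem Data.size_le_of_mem {d x : Data} (h : x ∈ d.toList) : x.size ≤ d.size := by
  induction d with
  | atom => simp [Data.toList] at h
  | pair y z _ ih =>
    simp only [Data.toList, List.mem_cons] at h
    simp only [Data.size]
    rcases h with rfl | h
    · omega
    · have := ih h
      omega

theorem Data.size_ofList_toList_le (d : Data) : (Data.ofList d.toList).size ≤ d.size := by
  induction d with
  | atom => simp [Data.toList, Data.ofList, Data.size]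
  | pair x y _ ih => simpa [Data.toList, Data.ofList, Data.size] using ih

theorem Data.size_ofList_le_of_suffix {d : Data} {l : List Data} (h : l <:+ d.toList) :
    (Data.ofList l).size ≤ d.size := by
  induction d with
  | atom =>
    obtain rfl : l = [] := by simpa [Data.toList] using h
    simp [Data.ofList, Data.size]
  | pair x y _ ih =>
    rcases List.suffix_cons_iff.1 h with rfl | h
    · exact Data.size_ofList_toList_le (.pair x y)
    · have := ih h
      simp only [Data.size]
      omega

namespace PolyTime

variable {f g l b : Data → Data}

/-- For recursions whose step may add more than a function of parameter and list element, but whose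
accumulator is bounded for another reason, as in `saturate`. -/
theorem foldr_of_size_le {F : Data → Data → Data → Data} (hl : PolyTime l) (hb : PolyTime b)
    (hF : PolyTime fun z => F z.hd z.tl.hd z.tl.tl) (s : Polynomial ℕ)
    (hs : ∀ d (l : List Data), (l.foldr (F d) (b d)).size ≤ s.eval (d.size + (Data.ofList l).size)) :
    PolyTime fun d => (l d).toList.foldr (F d) (b d) := by
  obtain ⟨M, p, e, he, H⟩ := foldr_cost hb hF
  have key : PolyTime fun z => z.tl.toList.foldr (F z.hd) (b z.hd) := by
    refine ⟨M, p.comp (Polynomial.X + s.comp (2 * Polynomial.X)), e, he, fun z => ?_⟩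
    have h1 := z.hd_size_le
    have h2 := z.tl_size_le
    obtain ⟨t, ht, hle⟩ := H z (s.eval (2 * z.size)) fun l' hl' =>
      (hs _ _).trans (eval_le s (by have := Data.size_ofList_le_of_suffix hl'; omega))
    exact ⟨t, ht, by simpa using hle⟩
  exact key.comp (id'.pair hl)

/-- A step may enlarge the accumulator only by an amount that does not depend on the accumulator.
Otherwise iteration, for instance of doubling, could lead to exponential size. -/
theorem foldr {F : Data → Data → Data → Data} (hl : PolyTime l) (hb : PolyTime b)
    (hF : PolyTime fun z => F z.hd z.tl.hd z.tl.tl) (q : Polynomial ℕ)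
    (hq : ∀ d x r, (F d x r).size ≤ r.size + q.eval (d.size + x.size)) :
    PolyTime fun d => (l d).toList.foldr (F d) (b d) := by
  obtain ⟨s, hs⟩ := hb.size_le
  refine foldr_of_size_le hl hb hF (s + Polynomial.X * q) fun d l => ?_
  set n := d.size + (Data.ofList l).size with hn
  refine (foldr_size_le (c := q.eval n) (k := n) (fun x hx r => ?_) ?_).trans ?_
  · have := Data.size_le_of_mem (d := .ofList l) (by simpa using hx)
    exact (hq _ _ _).trans (Nat.add_le_add_left (eval_le q (by omega)) _)
  · have := (Data.ofList l).length_toList_le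
    rw [Data.toList_ofList] at this
    omega
  · have := (hs d).trans (eval_le s (show d.size ≤ n by omega))
    simpa using this

/-- Map a function over a coded list. -/
def _root_.AbsCalc.Data.map (F : Data → Data) (l : Data) : Data := .ofList (l.toList.map F)

/-- Filter a coded list. -/
def _root_.AbsCalc.Data.filter (F : Data → Bool) (l : Data) : Data := .ofList (l.toList.filter F)

/-- Concatenate coded lists. -/
def _root_.AbsCalc.Data.append (l l' : Data) : Data := .ofList (l.toList ++ l'.toList)

/-- Concatenate the values of a function on a coded list. -/
def _root_.AbsCalc.Data.flatMap (F : Data → Data) (l : Data) : Data :=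
  .ofList (l.toList.flatMap fun x => (F x).toList)

@[fun_prop] theorem cond {c : Data → Bool} (hc : PolyTime fun x => bit (c x)) (hf : PolyTime f)
    (hg : PolyTime g) : PolyTime fun x => cond (c x) (f x) (g x) := by
  simpa only [cond_eq_ite] using ite hc hf hg

@[fun_prop] theorem map {F : Data → Data → Data} (hl : PolyTime l)
    (hF : PolyTime fun z => F z.hd z.tl) : PolyTime fun d => (l d).map (F d) := by
  obtain ⟨p, hp⟩ := hF.size_le
  have := foldr (F := fun d x r => .pair (F d x) r) hl (const (.atom 0))
    (by have := hF.comp (hd'.pair (hd'.comp tl')); exact this.pair (by fun_prop))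
    (p.comp (Polynomial.X + 1) + 1) (by
    intro d x r
    have := hp (.pair d x)
    simp [Data.size, Data.hd, Data.tl] at this ⊢; omega)
  convert this using 2 with d
  unfold Data.map
  induction (l d).toList with
  | nil => rfl
  | cons x l ih => simp [Data.ofList, ih]

theorem ofList_toList {f : Data → Data} (hf : PolyTime f) :
    PolyTime fun d => Data.ofList (f d).toList := by
  have := map (F := fun _ x => x) hf (by fun_prop)
  simpa [Data.map] using this

@[fun_prop] theorem append (hf : PolyTime f) (hg : PolyTime g) :
    PolyTime fun d => (f d).append (g d) := by
  have := foldr (F := fun _ x r => .pair x r) hf hg.ofList_toList (by fun_prop)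
    (Polynomial.X + 1) (by intro d x r; simp [Data.size]; omega)
  convert this using 2 with d
  unfold Data.append
  induction (f d).toList with
  | nil => simp
  | cons x l ih => simp [Data.ofList, ih]

theorem _root_.AbsCalc.Data.size_append_le (d d' : Data) :
    (d.append d').size ≤ d.size + d'.size := by
  unfold Data.append
  induction d with
  | atom => simpa [Data.toList] using d'.size_ofList_toList_le.trans (by omega)
  | pair x y _ ih =>
    simp only [Data.toList, List.cons_append, Data.ofList, Data.size]
    omega

@[fun_prop] theorem flatMap {F : Data → Data → Data} (hl : PolyTime l)
    (hF : PolyTime fun z => F z.hd z.tl) : PolyTime fun d => (l d).flatMap (F d) := by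
  obtain ⟨p, hp⟩ := hF.size_le
  have := foldr (F := fun d x r => (F d x).append r) hl (const (.atom 0))
    (by have := hF.comp (hd'.pair (hd'.comp tl')); exact this.append (by fun_prop))
    (p.comp (Polynomial.X + 1)) (by
    intro d x r
    have := hp (.pair d x)
    have := (F d x).size_append_le r
    simp [Data.size, Data.hd, Data.tl] at *; omega)
  convert this using 2 with d
  unfold Data.flatMap
  induction (l d).toList with
  | nil => rfl
  | cons x l ih => rw [List.foldr_cons, ← ih]; simp [Data.append]

@[fun_prop] theorem filter {F : Data → Data → Bool} (hl : PolyTime l)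
    (hF : PolyTime fun z => bit (F z.hd z.tl)) : PolyTime fun d => (l d).filter (F d) := by
  have := foldr (F := fun d x r => if F d x then .pair x r else r) hl (const (.atom 0))
    (by
      have := hF.comp (hd'.pair (hd'.comp tl'))
      exact ite this (by fun_prop) (by fun_prop))
    (Polynomial.X + 1) (by
    intro d x r
    split
    · simp only [Data.size, Polynomial.eval_add, Polynomial.eval_X, Polynomial.eval_one]
      omega
    · simp)
  convert this using 2 with d
  unfold Data.filter
  induction (l d).toList with
  | nil => rfl
  | cons x l ih =>
    simp only [List.filter_cons, List.foldr_cons]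
    split <;> simp [Data.ofList, ih]

@[fun_prop] theorem any {F : Data → Data → Bool} (hl : PolyTime l)
    (hF : PolyTime fun z => bit (F z.hd z.tl)) :
    PolyTime fun d => bit ((l d).toList.any (F d)) := by
  have := foldr (F := fun d x r => if F d x then bit true else r) hl (const (bit false))
    (by
      have := hF.comp (hd'.pair (hd'.comp tl'))
      exact ite this (by fun_prop) (by fun_prop))
    1 (by
    intro d x r
    (split; all_goals simp [Data.size, bit]))
  convert this using 2 with d
  induction (l d).toList with
  | nil => rfl
  | cons x l ih =>
    simp only [List.any_cons, List.foldr_cons, ← ih]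
    cases F d x <;> simp

@[fun_prop] theorem all {F : Data → Data → Bool} (hl : PolyTime l)
    (hF : PolyTime fun z => bit (F z.hd z.tl)) :
    PolyTime fun d => bit ((l d).toList.all (F d)) := by
  have := (any (F := fun d x => !F d x) hl hF.not).not
  simpa [List.all_eq_not_any_not] using this

@[fun_prop] theorem mem (hf : PolyTime f) (hl : PolyTime l) :
    PolyTime fun d => bit (decide (f d ∈ (l d).toList)) := by
  have := any (F := fun d x => decide (x = f d)) hl (by fun_prop)
  convert this using 3 with d
  rw [Bool.eq_iff_iff]
  simp

end PolyTime

/-! ### Recursion on finitely branching trees -/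

/-- Recursion on trees (flag `true`) and lists of trees (flag `false`) in the presence of a context
that is updated on the way from the root to the leaves. -/
def rose (post ctx cctx : Data → Data) : Bool → Data → Data → Data
  | _, _, .atom _ => .atom 0
  | true, c, .pair g ds =>
    post (.pair c (.pair (.pair g ds) (rose post ctx cctx false (ctx (.pair c (.pair g ds))) ds)))
  | false, c, .pair d ds =>
    .pair (rose post ctx cctx true (cctx (.pair c d)) d) (rose post ctx cctx false c ds)

/-- The context may grow at each node by an amount that depends on the subtree only, and the result
of a node may exceed the results of its children only additively. Along a branch the first kind of
growth adds up to at most n·q(n), so all contexts are polynomial; then the second kind adds up to a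
polynomial over the whole tree. -/
theorem polyTime_rose {post ctx cctx : Data → Data} (hp : PolyTime post) (hc : PolyTime ctx)
    (hcc : PolyTime cctx) (q : Polynomial ℕ)
    (h₁ : ∀ c x, (ctx (.pair c x)).size ≤ c.size + q.eval x.size)
    (h₂ : ∀ c x, (cctx (.pair c x)).size ≤ c.size + q.eval x.size)
    (h₃ : ∀ c x r, (post (.pair c (.pair x r))).size ≤ r.size + q.eval (c.size + x.size)) :
    PolyTime fun z => rose post ctx cctx true z.hd z.tl := by
  obtain ⟨N, i, j, k, p, H⟩ := PolyTime.link₃ 3 hp hc hcc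
  let P : Program := [.call 1 (.cons (.hd .arg) (.tl .arg)),
    .ite (.isPair (.tl .arg)) (.call i (.cons (.hd .arg) (.cons (.tl .arg) (.call 2 (.cons
      (.call j (.cons (.hd .arg) (.tl .arg))) (.tl (.tl .arg))))))) (.const (.atom 0)),
    .ite (.isPair (.tl .arg)) (.cons (.call 1 (.cons (.call k (.cons (.hd .arg) (.hd (.tl .arg))))
      (.hd (.tl .arg)))) (.call 2 (.cons (.hd .arg) (.tl (.tl .arg))))) (.const (.atom 0))]
  obtain ⟨hi, hj, hk⟩ := H P rfl
  -- As functions of the input size: `bP` bounds the contexts, `kP` the output per node, `sP` all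
  -- data that occur, and `wP` the time per node.
  let bP : Polynomial ℕ := Polynomial.X + Polynomial.X * q
  let kP : Polynomial ℕ := q.comp (bP + Polynomial.X) + 1
  let sP : Polynomial ℕ := bP + Polynomial.X + Polynomial.X * kP
  let wP : Polynomial ℕ := 2 * p.comp (2 * sP + 5) + 40 * sP + 40
  refine ⟨P ++ N, Polynomial.X * wP + 10 * Polynomial.X + 10, _, rfl, fun z => ?_⟩
  set n := z.size with hn
  set Q := q.eval n with hQ
  set B := bP.eval n with hB
  set K := kP.eval n with hK
  set S := sP.eval n with hS
  set W := wP.eval n with hW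
  have hB' : B = n + n * Q := by simp [hB, bP, hQ]
  have hK' : K = q.eval (B + n) + 1 := by simp [hK, kP, hB]
  have hS' : S = B + n + n * K := by simp [hS, sP, hB, hK]
  have hW' : W = 2 * p.eval (2 * S + 5) + 40 * S + 40 := by simp [hW, wP, hS]
  clear_value Q B K S W
  -- The budget `c.size + x.size * Q ≤ B` is preserved on the way down: a context update costs at
  -- most `Q`, and passing to a proper part of the tree releases at least `Q`.
  suffices hs : ∀ (x : Data) (f : Bool) (c : Data), x.size ≤ n → c.size + x.size * Q ≤ B →
      (rose post ctx cctx f c x).size ≤ x.size * K ∧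
      ∃ e, (P ++ N)[if f then 1 else 2]? = some e ∧
      ∃ t, Eval (P ++ N) (.pair c x) e (rose post ctx cctx f c x) t ∧ t ≤ x.size * W by
    have h1 := z.hd_size_le
    have h2 := z.tl_size_le
    have h3 : z.tl.size * Q ≤ n * Q := Nat.mul_le_mul_right _ h2
    have h4 : z.tl.size * W ≤ n * W := Nat.mul_le_mul_right _ h2
    obtain ⟨-, e, he, t, ht, hle⟩ := hs z.tl true z.hd h2 (by omega)
    refine ⟨_, .call (.cons (.hd .arg) (.tl .arg)) he ht, ?_⟩
    simp only [Polynomial.eval_mul, Polynomial.eval_add, Polynomial.eval_X,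
      Polynomial.eval_ofNat, ← hn, ← hW, Data.size]
    omega
  intro x
  induction x with
  | atom a =>
    intro f c hx hcB
    refine ⟨by simp [AbsCalc.rose, Data.size, hK'], ?_⟩
    simp only [Data.size] at *
    cases f
    · refine ⟨_, rfl, _, .ite_false (.isPair_atom (.tl .arg)) .const, ?_⟩
      simp only [Data.size, Data.tl]
      omega
    · refine ⟨_, rfl, _, .ite_false (.isPair_atom (.tl .arg)) .const, ?_⟩
      simp only [Data.size, Data.tl]
      omega
  | pair y ys ihy ihs =>
    intro f c hx hcB
    have hys := ys.size_pos
    have hy := y.size_pos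
    have eK : (Data.pair y ys).size * K = y.size * K + ys.size * K + K := by
      simp only [Data.size]; ring
    have eW : (Data.pair y ys).size * W = y.size * W + ys.size * W + W := by
      simp only [Data.size]; ring
    have eQ : (Data.pair y ys).size * Q = y.size * Q + ys.size * Q + Q := by
      simp only [Data.size]; ring
    have nK : (Data.pair y ys).size * K ≤ n * K := Nat.mul_le_mul_right _ hx
    rw [eK] at nK ⊢
    rw [eW]
    rw [eQ] at hcB
    have hx' := hx
    simp only [Data.size] at hx'
    cases f
    · have hcc' : (cctx (.pair c y)).size ≤ c.size + Q :=
        (h₂ c y).trans (Nat.add_le_add_left (hQ ▸ eval_le q (by omega)) _)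
      obtain ⟨s1, e1, he1, t1, ht1, hle1⟩ := ihy true (cctx (.pair c y)) (by omega) (by omega)
      obtain ⟨s2, e2, he2, t2, ht2, hle2⟩ := ihs false c (by omega) (by omega)
      have hsz : (AbsCalc.rose post ctx cctx false c (.pair y ys)).size ≤
          y.size * K + ys.size * K + K := by
        simp only [AbsCalc.rose, Data.size]
        omega
      refine ⟨hsz, _, rfl, ?_⟩
      obtain ⟨t, ht, hle⟩ := hk.call (Eval.cons (Eval.hd (Eval.arg (x := Data.pair c (.pair y ys))))
        (Eval.hd (.tl .arg)))
      refine ⟨_, .ite_true (.isPair_pair (.tl .arg)) (by simp) (.cons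
        (.call (.cons ht (Eval.hd (.tl .arg))) he1 ht1)
        (.call (.cons (.hd .arg) (.tl (.tl .arg))) he2 ht2)), ?_⟩
      have : p.eval (Data.pair c y).size ≤ p.eval (2 * S + 5) :=
        eval_le p (by simp only [Data.size]; omega)
      simp only [Data.size, Data.hd, Data.tl] at hle this ⊢
      omega
    · have hcc' : (ctx (.pair c (.pair y ys))).size ≤ c.size + Q :=
        (h₁ c _).trans (Nat.add_le_add_left (hQ ▸ eval_le q (by omega)) _)
      obtain ⟨s2, e2, he2, t2, ht2, hle2⟩ := ihs false (ctx (.pair c (.pair y ys))) (by omega)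
        (by omega)
      have hsz : (AbsCalc.rose post ctx cctx true c (.pair y ys)).size ≤
          y.size * K + ys.size * K + K := by
        simp only [AbsCalc.rose]
        have := (h₃ c (.pair y ys) (AbsCalc.rose post ctx cctx false (ctx (.pair c (.pair y ys))) ys))
        have h5 : q.eval (c.size + (Data.pair y ys).size) ≤ q.eval (B + n) :=
          eval_le q (by omega)
        omega
      refine ⟨hsz, _, rfl, ?_⟩
      obtain ⟨t, ht, hle⟩ := hj.call (Eval.cons (Eval.hd (Eval.arg (x := Data.pair c (.pair y ys))))
        (.tl .arg))
      obtain ⟨t', ht', hle'⟩ := hi.call (Eval.cons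
        (Eval.hd (Eval.arg (x := Data.pair c (.pair y ys)))) (.cons (.tl .arg)
        (.call (.cons ht (.tl (.tl .arg))) he2 ht2)))
      refine ⟨_, .ite_true (.isPair_pair (.tl .arg)) (by simp) ht', ?_⟩
      have h5 : p.eval (Data.pair c (.pair y ys)).size ≤ p.eval (2 * S + 5) :=
        eval_le p (by simp only [Data.size]; omega)
      have h6 : p.eval (Data.pair c (.pair (.pair y ys)
          (AbsCalc.rose post ctx cctx false (ctx (.pair c (.pair y ys))) ys))).size ≤
          p.eval (2 * S + 5) :=
        eval_le p (by simp only [Data.size]; omega)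
      simp only [Data.size, Data.hd, Data.tl] at hle hle' h5 h6 ⊢
      omega

end AbsCalc

namespace AbsCalc

/-! ### Production pairs and fracturable sets -/

section Fracturing

variable {α : Type}

theorem ProdPair.fwd_injective : Function.Injective (ProdPair.fwd : ProdPair α → Production α) := by
  rintro ⟨a, s⟩ ⟨b, t⟩ h
  simpa [ProdPair.fwd] using h

theorem ProdPair.fwd_ne_conv (q q' : ProdPair α) : q.fwd ≠ Production.conv q'.fwd := by
  simp [ProdPair.fwd, Production.conv, Letter.conv]

theorem ESystem.mem_pairs {G : ESystem α} {q : ProdPair α} : q ∈ G.pairs ↔ q.fwd ∈ G.prods :=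
  ⟨fun h => h.1, fun h => ⟨h, G.closed _ h⟩⟩

theorem ESystem.conv_mem {G : ESystem α} {p : Production α} :
    Production.conv p ∈ G.prods ↔ p ∈ G.prods :=
  ⟨fun h => by simpa [Production.conv_conv] using G.closed _ h, G.closed p⟩

theorem Production.eq_fwd_or (p : Production α) :
    ∃ q : ProdPair α, p = q.fwd ∨ p = Production.conv q.fwd := by
  obtain ⟨⟨a, b⟩, s⟩ := p
  cases b
  · exact ⟨⟨a, s⟩, .inl rfl⟩
  · exact ⟨⟨a, convStr s⟩, .inr (by simp [ProdPair.fwd, Production.conv, Letter.conv,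
      convStr_convStr])⟩

theorem ESystem.pairs_finite (G : ESystem α) : G.pairs.Finite :=
  (G.prods.finite_toSet.preimage ProdPair.fwd_injective.injOn).subset fun _ h => mem_pairs.1 h

/-- Fracturable sets are the sets that are closed under dependency. -/
theorem ESystem.fracturable_iff {G : ESystem α} {P : Finset (ProdPair α)} :
    G.Fracturable P ↔ (P : Set (ProdPair α)) ⊆ G.pairs ∧
      ∀ q ∈ P, ∀ q', G.Dep q q' → q' ∈ P := by
  refine and_congr_right fun _ => ⟨fun h q hq q' hd => ?_, fun h q hq q' _ hq' hd => hq' ?_⟩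
  · by_contra hq'
    exact h q hq q' hd.2.1 hq' (.single hd)
  · clear hq'
    induction hd with
    | refl => exact hq
    | tail _ h' ih => exact h _ (ih (by have := h'.1; assumption)) _ h'

theorem Constraint.mapLabel_eq_self {C : Constraint α} {φ : EdgeLabel α → EdgeLabel α} :
    C.mapLabel φ = C ↔ ∀ e, φ (C.label e) = C.label e := by
  obtain ⟨v, e, l, h₁, h₂, h₃⟩ := C
  simp [Constraint.mapLabel, funext_iff]

theorem ESystem.fracturable_empty (G : ESystem α) : G.Fracturable ∅ := by
  simp [Fracturable]

/-- The set of all production pairs of an `E`-system. -/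
noncomputable def ESystem.allPairs (G : ESystem α) : Finset (ProdPair α) := G.pairs_finite.toFinset

theorem ESystem.mem_allPairs {G : ESystem α} {q : ProdPair α} :
    q ∈ G.allPairs ↔ q.fwd ∈ G.prods := by
  simp [allPairs, mem_pairs]

theorem ESystem.fracturable_allPairs (G : ESystem α) : G.Fracturable G.allPairs := by
  rw [fracturable_iff]
  refine ⟨fun q hq => by simpa [allPairs] using hq, fun q _ q' h => ?_⟩
  simpa [allPairs] using h.2.1

theorem ESystem.Fracturable.subset_allPairs {G : ESystem α} {P : Finset (ProdPair α)}
    (h : G.Fracturable P) : P ⊆ G.allPairs := fun q hq => by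
  simpa [allPairs] using h.1 hq

variable [DecidableEq α]

theorem ESystem.mem_ofPairs {P : Finset (ProdPair α)} {p : Production α} :
    p ∈ (ofPairs P).prods ↔ ∃ q ∈ P, p = q.fwd ∨ p = Production.conv q.fwd := by
  simp [ofPairs, ProdPair.system]

theorem ESystem.fwd_mem_ofPairs {P : Finset (ProdPair α)} {q : ProdPair α} :
    q.fwd ∈ (ofPairs P).prods ↔ q ∈ P := by
  rw [mem_ofPairs]
  constructor
  · rintro ⟨q', hq', h | h⟩
    · exact ProdPair.fwd_injective h ▸ hq'
    · exact absurd h (ProdPair.fwd_ne_conv _ _)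
  · exact fun h => ⟨q, h, .inl rfl⟩

theorem ESystem.mem_sdiff {G G' : ESystem α} {p : Production α} :
    p ∈ (G.sdiff G').prods ↔ p ∈ G.prods ∧ p ∉ G'.prods := Finset.mem_sdiff

theorem ESystem.mem_pairs_sdiff {G : ESystem α} {P : Finset (ProdPair α)} {q : ProdPair α} :
    q ∈ (G.sdiff (ofPairs P)).pairs ↔ q ∈ G.pairs ∧ q ∉ P := by
  rw [mem_pairs, mem_pairs, mem_sdiff, fwd_mem_ofPairs]

theorem ESystem.ofPairs_empty_prods : (ofPairs (∅ : Finset (ProdPair α))).prods = ∅ := rfl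

-- A dependency that starts in P' either leads into P or is still present after P has been removed,
-- and then P' is closed under it.
open Classical in
theorem ESystem.Fracturable.union {G : ESystem α} {P P' : Finset (ProdPair α)}
    (h : G.Fracturable P) (h' : (G.sdiff (ofPairs P)).Fracturable P') :
    G.Fracturable (P ∪ P') := by
  rw [fracturable_iff] at *
  refine ⟨fun q hq => ?_, fun q hq q' hd => ?_⟩
  · rcases Finset.mem_union.1 hq with hq | hq
    · exact h.1 hq
    · exact (mem_pairs_sdiff.1 (h'.1 hq)).1
  · rw [Finset.mem_union] at *
    rcases hq with hq | hq
    · exact .inl (h.2 q hq q' hd)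
    · by_cases hq' : q' ∈ P
      · exact .inl hq'
      · exact .inr (h'.2 q hq q' ⟨h'.1 hq, mem_pairs_sdiff.2 ⟨hd.2.1, hq'⟩, hd.2.2⟩)

-- Every dependency of the smaller system is one of G, and its target is not in P because the pairs
-- of P are gone.
open Classical in
theorem ESystem.Fracturable.sdiff {G : ESystem α} {P P' : Finset (ProdPair α)}
    (h' : G.Fracturable P') : (G.sdiff (ofPairs P)).Fracturable (P' \ P) := by
  rw [fracturable_iff] at *
  refine ⟨fun q hq => ?_, fun q hq q' hd => ?_⟩
  · have := Finset.mem_sdiff.1 hq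
    exact mem_pairs_sdiff.2 ⟨h'.1 this.1, this.2⟩
  · rw [Finset.mem_sdiff] at *
    have h1 := mem_pairs_sdiff.1 hd.1
    have h2 := mem_pairs_sdiff.1 hd.2.1
    exact ⟨h'.2 q hq.1 q' ⟨h1.1, h2.1, hd.2.2⟩, h2.2⟩

/-! ### Fracturing rules -/

/-- The labels of a rule. -/
def Rule.labels : Rule α → Set (EdgeLabel α)
  | .initial C _ => Set.range C.label
  | .reach _ L _ => Set.range L
  | _ => ∅

theorem Rule.mem_gram {r : Rule α} (hr : ¬ r.IsHorn) {p : Production α} :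
    p ∈ r.gram.prods ↔ ∃ L ∈ r.labels, p ∈ L.gram.prods := by
  cases r <;> simp_all [Rule.gram, Rule.labels, IsHorn]

theorem Rule.labels_fracture (G : ESystem α) (r : Rule α) :
    (r.fracture G).labels = (fun L => L.fracture G) '' r.labels := by
  cases r <;> simp [Rule.fracture, Rule.labels, Constraint.mapLabel, ← Set.range_comp,
    Function.comp_def]

theorem Rule.fracture_eq_self {G : ESystem α} {r : Rule α} :
    r.fracture G = r ↔ ∀ L ∈ r.labels, L.fracture G = L := by
  cases r with
  | initial C R =>
    simp only [Rule.fracture, Rule.labels, Set.forall_mem_range]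
    rw [← Constraint.mapLabel_eq_self (φ := fun L => L.fracture G)]
    constructor
    · intro h
      injection h
    · obtain ⟨v, e, l, h₁, h₂, h₃⟩ := C
      intro h
      have hl : (fun e => (l e).fracture G) = l := funext (Constraint.mapLabel_eq_self.1 h)
      -- The type of `R` depends on the constraint, so equality of constraints cannot be rewritten
      -- directly. Only the label function varies, and `R` does not depend on it.
      have key : ∀ l', l' = l →
          Rule.initial ⟨v, e, l', h₁, h₂, h₃⟩ R = Rule.initial ⟨v, e, l, h₁, h₂, h₃⟩ R := by
        rintro _ rfl
        rfl
      exact key _ hl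
  | reach n L R => simp [Rule.fracture, Rule.labels, funext_iff]
  | _ => simp [Rule.fracture, Rule.labels]

theorem Rule.labels_of_absorb {G : ESystem α} {r : Rule α} (h : r.absorb G = r) :
    ∀ L ∈ r.labels, L.absorb G = L := by
  cases r with
  | initial C R =>
    simp only [Rule.absorb, Rule.labels, Set.forall_mem_range] at h ⊢
    rw [← Constraint.mapLabel_eq_self (φ := fun L => L.absorb G)]
    injection h
  | reach n L R => simpa [Rule.absorb, Rule.labels, funext_iff] using h
  | _ => simp [Rule.labels]

theorem Rule.isHorn_fracture {G : ESystem α} {r : Rule α} : (r.fracture G).IsHorn ↔ r.IsHorn := by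
  cases r <;> simp [Rule.fracture, Rule.IsHorn]

theorem Rule.fracture_fracture (G G' : ESystem α) (r : Rule α) :
    (r.fracture G).fracture G' = r.fracture (G.union G') := by
  have h : ∀ L : EdgeLabel α, (L.fracture G).fracture G' = L.fracture (G.union G') := fun L => by
    simp [EdgeLabel.fracture, ESystem.sdiff, ESystem.union, Finset.sdiff_sdiff_left']
    ext p
    simp
    grind
  cases r <;> simp [Rule.fracture, Constraint.mapLabel, h]

theorem Calculus.mem_gram {A : Calculus α} {p : Production α} :
    p ∈ A.gram.prods ↔ ∃ r ∈ A.rules, p ∈ r.gram.prods := by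
  simp [Calculus.gram]

/-- Invariance under absorption gives one inclusion; the other holds because the `E`-system of the
calculus is the union over its rules. This uniformity is the only use made of implicitness beyond
the absence of Horn rules. -/
theorem Calculus.IsImplicit.label_gram {A : Calculus α} (hA : A.IsImplicit) {r : Rule α}
    (hr : r ∈ A.rules) {L : EdgeLabel α} (hL : L ∈ r.labels) : L.gram = A.gram := by
  have hi : r.IsInitial ∨ r.IsReach := by
    cases r <;> simp_all [Rule.labels, Rule.IsInitial, Rule.IsReach]
  have h := Rule.labels_of_absorb (hA.2 r hr hi) L hL
  ext p
  constructor
  · intro hp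
    exact Calculus.mem_gram.2 ⟨r, hr, (Rule.mem_gram (hA.1 r hr)).2 ⟨L, hL, hp⟩⟩
  · intro hp
    rw [← h]
    exact Finset.mem_union_right _ hp

/-- The `E`-system of the rules of `g(A, P)` that are not Horn rules. -/
theorem Calculus.gram_g {A : Calculus α} (hA : ∀ r ∈ A.rules, ¬ r.IsHorn)
    (P : Finset (ProdPair α)) :
    ((A.g P).diff (A.g P).hornRules).gram = A.gram.sdiff (ESystem.ofPairs P) := by
  ext p
  rw [ESystem.mem_sdiff, mem_gram, mem_gram]
  simp only [Calculus.diff, Calculus.hornRules, Calculus.g, Calculus.fracture, Set.mem_sdiff,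
    Set.mem_union, Set.mem_image, Set.mem_ofPred_eq]
  constructor
  · rintro ⟨r, ⟨⟨r, hr, rfl⟩ | ⟨q, hq, rfl⟩, h⟩, hp⟩
    · rw [Rule.mem_gram (by rw [Rule.isHorn_fracture]; exact hA r hr), Rule.labels_fracture] at hp
      obtain ⟨_, ⟨L, hL, rfl⟩, hp⟩ := hp
      obtain ⟨h1, h2⟩ := ESystem.mem_sdiff.1 hp
      exact ⟨⟨r, hr, (Rule.mem_gram (hA r hr)).2 ⟨L, hL, h1⟩⟩, h2⟩
    · exact absurd ⟨.inr ⟨q, hq, rfl⟩, trivial⟩ h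
  · rintro ⟨⟨r, hr, hp⟩, hp'⟩
    have hn : ¬ (r.fracture (ESystem.ofPairs P)).IsHorn := by
      rw [Rule.isHorn_fracture]; exact hA r hr
    refine ⟨_, ⟨.inl ⟨r, hr, rfl⟩, fun h => hn h.2⟩, ?_⟩
    rw [Rule.mem_gram hn, Rule.labels_fracture]
    obtain ⟨L, hL, hp⟩ := (Rule.mem_gram (hA r hr)).1 hp
    exact ⟨_, ⟨L, hL, rfl⟩, ESystem.mem_sdiff.2 ⟨hp, hp'⟩⟩

theorem Calculus.fracturable_g {A : Calculus α} (hA : ∀ r ∈ A.rules, ¬ r.IsHorn)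
    {P P' : Finset (ProdPair α)} :
    (A.g P).Fracturable P' ↔ (A.gram.sdiff (ESystem.ofPairs P)).Fracturable P' := by
  rw [Calculus.Fracturable, gram_g hA]

theorem Calculus.g_empty (A : Calculus α) : A.g ∅ = A := by
  have : ∀ r : Rule α, r.fracture (ESystem.ofPairs ∅) = r := fun r =>
    Rule.fracture_eq_self.2 fun L _ => by
      simp [EdgeLabel.fracture, ESystem.sdiff, ESystem.ofPairs_empty_prods]
  ext r
  simp [Calculus.g, Calculus.fracture, this]

-- Successive differences are a difference by the union, and the Horn rules that the first step has
-- added are not affected by the second.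
open Classical in
theorem Calculus.g_g (A : Calculus α) (P P' : Finset (ProdPair α)) :
    (A.g P).g P' = A.g (P ∪ P') := by
  have hU : (ESystem.ofPairs P).union (ESystem.ofPairs P') = ESystem.ofPairs (P ∪ P') := by
    ext p
    simp only [ESystem.union, Finset.mem_union, ESystem.mem_ofPairs]
    grind
  have hH : ∀ q : ProdPair α, (Rule.horn q).fracture (ESystem.ofPairs P') = .horn q := fun _ => rfl
  ext r
  simp only [Calculus.g, Calculus.fracture, Set.image_union, Set.image_image,
    Rule.fracture_fracture, hU, Finset.coe_union, hH, Set.union_assoc]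

theorem Calculus.horn_mem_g {A : Calculus α} (hA : ∀ r ∈ A.rules, ¬ r.IsHorn)
    {P : Finset (ProdPair α)} {q : ProdPair α} : Rule.horn q ∈ (A.g P).rules ↔ q ∈ P := by
  simp only [Calculus.g, Calculus.fracture, Set.mem_union, Set.mem_image, Finset.mem_coe,
    Rule.horn.injEq, exists_eq_right, or_iff_right_iff_imp]
  rintro ⟨r, hr, h⟩
  have : (r.fracture (ESystem.ofPairs P)).IsHorn := by rw [h]; trivial
  exact absurd (Rule.isHorn_fracture.1 this) (hA r hr)

/-- The Horn rules of g(A, P) are those of P and no others, since `A` has none. -/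
theorem Calculus.g_injective {A : Calculus α} (hA : ∀ r ∈ A.rules, ¬ r.IsHorn) :
    Function.Injective A.g := fun P P' h => by
  ext q
  rw [← horn_mem_g hA, h, horn_mem_g hA]

/-! ### The downward space of a calculus without Horn rules -/

/-- One step below `A` suffices: two consecutive fracturings merge into one by the union of the two
sets, and this union is fracturable for `A`. -/
theorem inDown_iff {A : Calculus α} (hA : ∀ r ∈ A.rules, ¬ r.IsHorn) {B : Calculus α} :
    InDown A B ↔ ∃ P, A.gram.Fracturable P ∧ B = A.g P := by
  classical
  constructor
  · intro h
    induction h with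
    | base => exact ⟨∅, ESystem.fracturable_empty _, A.g_empty.symm⟩
    | step B P' _ h ih =>
      obtain ⟨P, hP, rfl⟩ := ih
      rw [Calculus.fracturable_g hA] at h
      exact ⟨P ∪ P', hP.union h, Calculus.g_g _ _ _⟩
  · rintro ⟨P, hP, rfl⟩
    refine .step A P .base ?_
    have := (Calculus.fracturable_g hA (P := ∅) (P' := P)).2 (by
      simpa [ESystem.sdiff, ESystem.ofPairs_empty_prods] using hP)
    rwa [Calculus.g_empty] at this

/-- This identifies the order with reverse inclusion of fracturable sets, from which the bottom
element and the program for the space are obtained. -/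
theorem mem_downSpace_rel {A : Calculus α} (hA : ∀ r ∈ A.rules, ¬ r.IsHorn) {C B : Calculus α} :
    (C, B) ∈ (downSpace A).rel ↔ ∃ P P', A.gram.Fracturable P ∧ A.gram.Fracturable P' ∧ P ⊆ P' ∧
      C = A.g P' ∧ B = A.g P := by
  classical
  simp only [downSpace, Set.mem_ofPred_eq, inDown_iff hA]
  constructor
  · rintro ⟨⟨P, hP, rfl⟩, P', hP', rfl⟩
    exact ⟨P, P ∪ P', hP, hP.union ((Calculus.fracturable_g hA).1 hP'),
      Finset.subset_union_left, Calculus.g_g _ _ _, rfl⟩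
  · rintro ⟨P, P', hP, hP', hs, rfl, rfl⟩
    -- What remains to be fractured on the way from g(A, P) down to g(A, P') is the difference of
    -- the two sets.
    refine ⟨⟨P, hP, rfl⟩, P' \ P, (Calculus.fracturable_g hA).2 hP'.sdiff, ?_⟩
    rw [Calculus.g_g, Finset.union_sdiff_of_subset hs]

theorem isBot_iff {A : Calculus α} (hA : ∀ r ∈ A.rules, ¬ r.IsHorn) {B : Calculus α} :
    (downSpace A).IsBot B ↔ B = A.g A.gram.allPairs := by
  constructor
  · rintro ⟨-, h⟩
    obtain ⟨P, P', hP, hP', hs, rfl, h2⟩ := (mem_downSpace_rel hA).1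
      (h (A.g A.gram.allPairs) ((inDown_iff hA).2 ⟨_, A.gram.fracturable_allPairs, rfl⟩))
    rw [hP'.subset_allPairs.antisymm (Calculus.g_injective hA h2 ▸ hs)]
  · rintro rfl
    refine ⟨(inDown_iff hA).2 ⟨_, A.gram.fracturable_allPairs, rfl⟩, fun C hC => ?_⟩
    obtain ⟨P, hP, rfl⟩ := (inDown_iff hA).1 hC
    exact (mem_downSpace_rel hA).2 ⟨P, _, hP, A.gram.fracturable_allPairs, hP.subset_allPairs,
      rfl, rfl⟩

/-- A pair outside P still occurs in a label of g(A, P), hence in the `E`-system of that calculus,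
so fracturing by this system would change the label. If P contains all pairs, every label is empty
and there is nothing left to remove. -/
theorem isExplicit_g_iff {A : Calculus α} (hA : A.IsImplicit) {P : Finset (ProdPair α)}
    (hP : A.gram.Fracturable P) : (A.g P).IsExplicit ↔ A.g P = A.g A.gram.allPairs := by
  constructor
  · intro h
    congr 1
    refine hP.subset_allPairs.antisymm fun q hq => ?_
    by_contra hqP
    obtain ⟨r, hr, hp⟩ := Calculus.mem_gram.1 (ESystem.mem_allPairs.1 hq)
    obtain ⟨L, hL, hp⟩ := (Rule.mem_gram (hA.1 r hr)).1 hp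
    have hr' : r.fracture (ESystem.ofPairs P) ∈ (A.g P).rules := .inl ⟨r, hr, rfl⟩
    have hL' : L.fracture (ESystem.ofPairs P) ∈ (r.fracture (ESystem.ofPairs P)).labels := by
      rw [Rule.labels_fracture]
      exact ⟨L, hL, rfl⟩
    have hi : (r.fracture (ESystem.ofPairs P)).IsInitial ∨
        (r.fracture (ESystem.ofPairs P)).IsReach := by
      cases r <;> simp_all [Rule.labels, Rule.IsInitial, Rule.IsReach, Rule.fracture]
    have hq' : q.fwd ∈ (L.fracture (ESystem.ofPairs P)).gram.prods :=
      ESystem.mem_sdiff.2 ⟨hp, fun h => hqP (ESystem.fwd_mem_ofPairs.1 h)⟩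
    have hf := Rule.fracture_eq_self.1 (h _ hr' hi) _ hL'
    rw [← hf] at hq'
    refine (ESystem.mem_sdiff.1 hq').2 (Calculus.mem_gram.2 ⟨_, hr', ?_⟩)
    rw [Rule.mem_gram (by rw [Rule.isHorn_fracture]; exact hA.1 r hr)]
    exact ⟨_, hL', (ESystem.mem_sdiff.1 hq').1⟩
  · intro h
    rw [h]
    rintro r (⟨r, hr, rfl⟩ | ⟨q, hq, rfl⟩) hi
    · rw [Rule.fracture_eq_self, Rule.labels_fracture]
      rintro _ ⟨L, hL, rfl⟩
      have hempty : (L.fracture (ESystem.ofPairs A.gram.allPairs)).gram.prods = ∅ := by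
        refine Finset.eq_empty_of_forall_notMem fun p hp => ?_
        obtain ⟨h1, h2⟩ := ESystem.mem_sdiff.1 hp
        rw [hA.label_gram hr hL] at h1
        obtain ⟨q, rfl | rfl⟩ := p.eq_fwd_or
        · exact h2 (ESystem.mem_ofPairs.2 ⟨q, ESystem.mem_allPairs.2 h1, .inl rfl⟩)
        · exact h2 (ESystem.mem_ofPairs.2 ⟨q, ESystem.mem_allPairs.2 (ESystem.conv_mem.1 h1),
            .inr rfl⟩)
      ext p
      · show p ∈ _ \ _ ↔ _
        rw [hempty]
        simp
      · rfl
    · simp [Rule.IsInitial, Rule.IsReach] at hi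

/-! ### The algorithm -/

/-- Passes can be counted without deciding whether each of them makes the space grow. -/
theorem ExplicateLoop.of_pass {X Y : Space α} (h : ExplicateLoop X.pass Y) : ExplicateLoop X Y := by
  by_cases hX : X.pass = X
  · rwa [hX] at h
  · exact .loop X Y hX h

theorem pass_subset_downSpace {A : Calculus α} {X : Space α}
    (h₁ : X.carrier ⊆ (downSpace A).carrier) (h₂ : X.rel ⊆ (downSpace A).rel) :
    X.pass.carrier ⊆ (downSpace A).carrier ∧ X.pass.rel ⊆ (downSpace A).rel := by
  refine ⟨Set.union_subset h₁ ?_, Set.union_subset h₂ ?_⟩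
  · rintro _ ⟨B, P, hB, hP, rfl⟩
    exact InDown.step B P (h₁ hB.1) hP
  · rintro ⟨C, B⟩ ⟨P, hB, hP, h⟩
    exact ⟨h₁ hB.1, P, hP, h⟩

/-- No pass leaves the downward space. Two passes exhaust it: the first yields all calculi, the
second all of the order. -/
theorem explicate_returns {A : Calculus α} (hA : ∀ r ∈ A.rules, ¬ r.IsHorn) :
    ExplicateReturns A (downSpace A) := by
  set X : Space α := ⟨{A}, ∅⟩ with hX
  have hmin : ∀ B, X.IsMin B ↔ B = A := fun B => by simp [Space.IsMin, hX]
  have hfr : ∀ P, A.Fracturable P ↔ A.gram.Fracturable P := fun P => by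
    have := Calculus.fracturable_g hA (P := ∅) (P' := P)
    rw [Calculus.g_empty] at this
    simpa [ESystem.sdiff, ESystem.ofPairs_empty_prods] using this
  have h1 := pass_subset_downSpace (A := A) (X := X)
    (fun B (hB : B = A) => (hB ▸ InDown.base : InDown A B)) (by rintro _ ⟨⟩)
  have h2 := pass_subset_downSpace h1.1 h1.2
  have hD := pass_subset_downSpace (A := A) subset_rfl subset_rfl
  have hcar : (downSpace A).carrier ⊆ X.pass.carrier := by
    intro B hB
    obtain ⟨P, hP, rfl⟩ := (inDown_iff hA).1 hB
    exact .inr ⟨A, P, (hmin A).2 rfl, (hfr P).2 hP, rfl⟩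
  have hrel : (downSpace A).rel ⊆ X.pass.pass.rel := by
    rintro ⟨C, B⟩ ⟨hB, P', hP', h⟩
    dsimp only at hB hP' h
    -- After the first pass only `A` has calculi below it, and these pairs are already recorded.
    -- Every other calculus has nothing below it yet, so it is minimal and is treated in the second
    -- pass.
    by_cases hBA : B = A
    · exact .inl (.inr ⟨P', (hmin B).2 hBA, hP', h⟩)
    · refine .inr ⟨P', ⟨hcar hB, fun C' _ hC' => ?_⟩, hP', h⟩
      rcases hC' with hC' | ⟨P, hm, -⟩
      · exact absurd hC' (by simp [hX])
      · exact absurd ((hmin B).1 hm) hBA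
  have e2 : X.pass.pass = downSpace A :=
    Space.ext (h2.1.antisymm (hcar.trans Set.subset_union_left)) (h2.2.antisymm hrel)
  refine .of_pass (.of_pass ?_)
  rw [e2]
  exact .done _ (Space.ext (hD.1.antisymm Set.subset_union_left)
    (hD.2.antisymm Set.subset_union_left))

end Fracturing
end AbsCalc

namespace AbsCalc

/-! ### Codes of finite sets -/

section CodesSet

variable {β γ : Type} {c : β → Data → Prop} {c' : γ → Data → Prop} {s s' : Set β} {d d' : Data}

theorem CodesSet.map (h : CodesSet c s d) (F : β → γ) (f : Data → Data)
    (hf : ∀ b ∈ s, ∀ x, c b x → c' (F b) (f x)) : CodesSet c' (F '' s) (d.map f) := by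
  obtain ⟨l, hl, rfl, rfl⟩ := h
  refine ⟨l.map fun q => (F q.1, f q.2), ?_, ?_, ?_⟩
  · simp only [List.mem_map, forall_exists_index, and_imp, forall_apply_eq_imp_iff₂]
    exact fun q hq => hf _ ⟨q, hq, rfl⟩ _ (hl q hq)
  · ext y
    simp
  · simp [Data.map, Function.comp_def]

theorem CodesSet.image (h : CodesSet c s d) (F : β → γ) (hf : ∀ b ∈ s, ∀ x, c b x → c' (F b) x) :
    CodesSet c' (F '' s) d := by
  have := h.map F id hf
  obtain ⟨l, -, -, rfl⟩ := h
  simpa [Data.map] using this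

theorem CodesSet.append (h : CodesSet c s d) (h' : CodesSet c s' d') :
    CodesSet c (s ∪ s') (d.append d') := by
  obtain ⟨l, hl, rfl, rfl⟩ := h
  obtain ⟨l', hl', rfl, rfl⟩ := h'
  refine ⟨l ++ l', ?_, ?_, ?_⟩
  · intro q hq
    rcases List.mem_append.1 hq with hq | hq
    · exact hl q hq
    · exact hl' q hq
  · ext y
    simp [or_and_right, exists_or]
  · simp [Data.append]

theorem CodesSet.filter (h : CodesSet c s d) (Φ : β → Prop) (φ : Data → Bool)
    (hφ : ∀ b ∈ s, ∀ x, c b x → (φ x = true ↔ Φ b)) :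
    CodesSet c {b ∈ s | Φ b} (d.filter φ) := by
  obtain ⟨l, hl, rfl, rfl⟩ := h
  refine ⟨l.filter fun q => φ q.2, ?_, ?_, ?_⟩
  · exact fun q hq => hl q (List.mem_filter.1 hq).1
  · ext y
    simp only [Set.mem_ofPred_eq, List.mem_filter]
    constructor
    · rintro ⟨⟨q, hq, rfl⟩, hy⟩
      exact ⟨q, ⟨hq, (hφ _ ⟨q, hq, rfl⟩ _ (hl q hq)).2 hy⟩, rfl⟩
    · rintro ⟨q, ⟨hq, hy⟩, rfl⟩
      exact ⟨⟨q, hq, rfl⟩, (hφ _ ⟨q, hq, rfl⟩ _ (hl q hq)).1 hy⟩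
  · simp [Data.filter, List.filter_map, Function.comp_def]

theorem codesSet_empty : CodesSet c ∅ (.atom 0) := ⟨[], by simp, by simp, rfl⟩

theorem CodesSet.flatMap (h : CodesSet c s d) (F : β → Set γ) (f : Data → Data)
    (hf : ∀ b ∈ s, ∀ x, c b x → CodesSet c' (F b) (f x)) :
    CodesSet c' (⋃ b ∈ s, F b) (d.flatMap f) := by
  obtain ⟨l, hl, rfl, rfl⟩ := h
  induction l with
  | nil => simpa [Data.flatMap, Data.ofList, Data.toList] using codesSet_empty
  | cons q l ih =>
    have h1 := hf q.1 ⟨q, by simp, rfl⟩ _ (hl q (by simp))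
    have h2 := ih (fun q hq => hl q (by simp [hq])) fun b ⟨q, hq, e⟩ => hf b ⟨q, by simp [hq], e⟩
    convert h1.append h2 using 1
    · ext y
      simp
    · simp [Data.flatMap, Data.append]

theorem CodesSet.mem_toList {code : β → Data} (h : CodesSet (fun b x => x = code b) s d) {x : Data} :
    x ∈ d.toList ↔ ∃ b ∈ s, x = code b := by
  obtain ⟨l, hl, rfl, rfl⟩ := h
  simp only [Data.toList_ofList, List.mem_map, Set.mem_ofPred_eq]
  constructor
  · rintro ⟨q, hq, rfl⟩
    exact ⟨q.1, ⟨q, hq, rfl⟩, hl q hq⟩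
  · rintro ⟨_, ⟨q, hq, rfl⟩, rfl⟩
    exact ⟨q, hq, hl q hq⟩

theorem codesSet_code {code : β → Data} {s : Set β} {d : Data} :
    CodesSet (fun b x => x = code b) s d ↔
      ∃ l : List β, s = {b | b ∈ l} ∧ d = .ofList (l.map code) := by
  constructor
  · rintro ⟨l, hl, rfl, rfl⟩
    refine ⟨l.map Prod.fst, by ext; simp, ?_⟩
    rw [List.map_map]
    congr 1
    exact List.map_congr_left hl
  · rintro ⟨l, rfl, rfl⟩
    exact ⟨l.map fun b => (b, code b), by simp, by ext; simp, by simp [Function.comp_def]⟩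

/-- The list of all sublists of a coded list. -/
def Data.sublists (l : Data) : Data :=
  l.toList.foldr (fun x r => r.append (r.map fun s => .pair x s)) (.pair (.atom 0) (.atom 0))

/-- The recursion matches that of `List.sublists'`; its start value codes the list whose only member
is the empty list. -/
theorem Data.sublists_ofList (l : List Data) :
    (Data.ofList l).sublists = .ofList (l.sublists'.map Data.ofList) := by
  unfold Data.sublists
  rw [Data.toList_ofList]
  induction l with
  | nil => rfl
  | cons x l ih =>
    rw [List.foldr_cons, ih]
    simp [Data.append, Data.map, Function.comp_def, Data.ofList]

theorem CodesSet.sublists {code : β → Data} {S : Finset β} {d : Data}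
    (h : CodesSet (fun b x => x = code b) (S : Set β) d) :
    CodesSet (fun (P : Finset β) x => CodesSet (fun b x => x = code b) (P : Set β) x) {P | P ⊆ S}
      d.sublists := by
  classical
  obtain ⟨l, hl, rfl⟩ := codesSet_code.1 h
  refine ⟨l.sublists'.map fun s => (s.toFinset, .ofList (s.map code)), ?_, ?_, ?_⟩
  · simp only [List.mem_map, forall_exists_index, and_imp, forall_apply_eq_imp_iff₂]
    exact fun s _ => codesSet_code.2 ⟨s, by ext; simp, rfl⟩
  · ext P
    simp only [Set.mem_ofPred_eq, List.mem_map, List.mem_sublists']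
    have hS : ∀ b, b ∈ S ↔ b ∈ l := fun b => by simpa using Set.ext_iff.1 hl b
    constructor
    · intro hP
      -- The list `l` may have repetitions. Filtering it by membership in P gives a sublist whose
      -- set of elements is P.
      refine ⟨_, ⟨l.filter (· ∈ P), List.filter_sublist, rfl⟩, ?_⟩
      ext b
      have := @hP b
      simp [← hS]
      tauto
    · rintro ⟨_, ⟨s, hs, rfl⟩, rfl⟩ b hb
      exact (hS b).2 (hs.subset (List.mem_toFinset.1 hb))
  · rw [Data.sublists_ofList, List.sublists'_map]
    simp [Function.comp_def]

end CodesSet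

/-! ### Exponential time -/

/-- The exponent on the right is linear in `a`, so a polynomial of an exponential bound is again an
exponential bound. The summand 1 leaves room for the coefficients. -/
theorem eval_two_pow_le (p : Polynomial ℕ) : ∃ c, ∀ a, p.eval (2 ^ a) ≤ 2 ^ (c * (a + 1)) := by
  induction p using Polynomial.induction_on' with
  | add p q hp hq =>
    obtain ⟨b, hb⟩ := hp
    obtain ⟨c, hc⟩ := hq
    refine ⟨b + c + 1, fun a => ?_⟩
    rw [Polynomial.eval_add]
    have h1 : 2 ^ (b * (a + 1)) ≤ 2 ^ ((b + c) * (a + 1)) :=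
      Nat.pow_le_pow_right (by omega) (by gcongr; omega)
    have h2 : 2 ^ (c * (a + 1)) ≤ 2 ^ ((b + c) * (a + 1)) :=
      Nat.pow_le_pow_right (by omega) (by gcongr; omega)
    have h3 : 2 ^ ((b + c) * (a + 1) + 1) ≤ 2 ^ ((b + c + 1) * (a + 1)) :=
      Nat.pow_le_pow_right (by omega) (by rw [add_mul (b + c) 1]; omega)
    rw [pow_succ] at h3
    have := hb a
    have := hc a
    omega
  | monomial k n =>
    refine ⟨n + k, fun a => ?_⟩
    rw [Polynomial.eval_monomial, ← pow_mul]
    calc n * 2 ^ (a * k) ≤ 2 ^ n * 2 ^ (a * k) := by gcongr; exact Nat.lt_two_pow_self.le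
      _ = 2 ^ (n + a * k) := by rw [pow_add]
      _ ≤ _ := Nat.pow_le_pow_right (by omega) (by nlinarith [Nat.zero_le (n * a)])

theorem Data.size_map_pair_le (x r : Data) :
    (r.map fun s => .pair x s).size ≤ r.size * (x.size + 2) := by
  have := x.size_pos
  unfold Data.map
  induction r with
  | atom => simp [Data.toList, Data.ofList, Data.size]
  | pair y ys _ ih =>
    simp only [Data.toList, List.map_cons, Data.ofList, Data.size]
    nlinarith [y.size_pos]

/-- An additional element `x` multiplies the size by at most `x.size + 3`, which is at most `4 ^
(x.size + 1)`, and the exponents add up to the size of the list. -/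
theorem Data.size_sublists_le (l : List Data) :
    (Data.ofList l).sublists.size ≤ 4 ^ (Data.ofList l).size := by
  unfold Data.sublists
  rw [Data.toList_ofList]
  induction l with
  | nil => simp [Data.ofList, Data.size]
  | cons x l ih =>
    rw [List.foldr_cons]
    set r := l.foldr (fun x (r : Data) => r.append (r.map fun s => .pair x s))
      (.pair (.atom 0) (.atom 0))
    have h1 := r.size_append_le (r.map fun s => .pair x s)
    have h2 := Data.size_map_pair_le x r
    have h3 : x.size + 3 ≤ 4 ^ (x.size + 1) := by
      generalize x.size = k
      induction k with
      | zero => norm_num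
      | succ k ih => rw [pow_succ]; omega
    calc _ ≤ r.size * (x.size + 3) := by
            rw [mul_add] at h2 ⊢
            omega
      _ ≤ 4 ^ (Data.ofList l).size * 4 ^ (x.size + 1) := Nat.mul_le_mul ih h3
      _ = _ := by
        rw [← pow_add, Data.ofList, Data.size]
        congr 1
        omega

/-- The bound on the accumulator in `foldr_cost` is arbitrary, so that result also covers a
recursion with exponentially large values. -/
theorem sublists_computes : ∃ (M : Program) (p : Polynomial ℕ),
    Computes M 0 (fun z => z.tl.sublists) fun z => p.eval (z.size + 4 ^ z.size) := by
  obtain ⟨M, p, e, he, H⟩ := foldr_cost (b := fun _ => .pair (.atom 0) (.atom 0))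
    (F := fun _ x r => r.append (r.map fun s => .pair x s)) (by fun_prop) (by fun_prop)
  refine ⟨M, p, e, he, fun z => H z _ fun l hl => ?_⟩
  have := Data.size_sublists_le l
  unfold Data.sublists at this
  rw [Data.toList_ofList] at this
  refine this.trans (Nat.pow_le_pow_right (by omega) ?_)
  exact (Data.size_ofList_le_of_suffix hl).trans z.tl_size_le

/-- A polynomial-time function of the input and of the list of all sublists of a list that is
computable in polynomial time from the input can be computed in exponential time. -/
theorem expTime_sublists {f g : Data → Data} (hf : PolyTime f) (hg : PolyTime g) :
    ∃ (M : Program) (p : Polynomial ℕ), ∀ x, ∃ t,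
      Runs M x (g (.pair x (f x).sublists)) t ∧ t ≤ 2 ^ p.eval x.size := by
  obtain ⟨M₁, p₁, h₁⟩ := hf
  obtain ⟨M₂, p₂, h₂⟩ := hg
  obtain ⟨M₃, p₃, h₃⟩ := sublists_computes
  obtain ⟨N, i, j, k, H⟩ := h₁.link₃ h₂ h₃ 1
  let B : Program := [.call j (.cons .arg (.call k (.cons (.const (.atom 0)) (.call i .arg))))]
  obtain ⟨hi, hj, hk⟩ := H B rfl
  let u : Polynomial ℕ := 2 * p₁ + 2 * Polynomial.X + 10
  obtain ⟨c, hc⟩ := eval_two_pow_le (p₂.comp (2 * p₃ + 3 * Polynomial.X + 10) + 10 * p₃ +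
    10 * Polynomial.X + 10)
  refine ⟨B ++ N, Polynomial.C c * (3 * u + 1), fun x => ?_⟩
  obtain ⟨t, ht, hle⟩ := hi.call (Eval.arg (x := x))
  obtain ⟨t', ht', hle'⟩ := hk.call (.cons .const ht)
  obtain ⟨t'', ht'', hle''⟩ := hj.call (.cons .arg ht')
  refine ⟨_, .call .arg rfl ht'', ?_⟩
  obtain ⟨s, hs⟩ : ∃ s, s = u.eval x.size := ⟨_, rfl⟩
  have hu : s = 2 * p₁.eval x.size + 2 * x.size + 10 := by simp [hs, u]
  have hfx : (f x).size ≤ t := ht.size_le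
  have hsub := ht'.size_le
  -- The value is `4 ^ s * 2 ^ s`, which dominates r + 4 ^ r for the size r ≤ s of the argument of
  -- the sublist program.
  set m := 2 ^ (3 * s) with hm
  have hm1 : (Data.pair (.atom 0) (f x)).size + 4 ^ (Data.pair (.atom 0) (f x)).size ≤ m := by
    have h1 : (Data.pair (.atom 0) (f x)).size ≤ s := by
      simp only [Data.size]
      omega
    have h2 : 4 ^ (Data.pair (.atom 0) (f x)).size ≤ 4 ^ s := Nat.pow_le_pow_right (by omega) h1
    have h3 : s < 2 ^ s := Nat.lt_two_pow_self
    have h4 : m = 4 ^ s * 2 ^ s := by rw [hm, pow_mul, ← mul_pow]; norm_num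
    have h5 : 2 ≤ 2 ^ s := by
      calc 2 = 2 ^ 1 := rfl
        _ ≤ _ := Nat.pow_le_pow_right (by omega) (by omega)
    have h6 : 2 ^ s ≤ 4 ^ s := Nat.pow_le_pow_left (by omega) s
    nlinarith
  have hp3 := eval_le p₃ hm1
  have hxm : (Data.pair (.atom 0) (f x)).size ≤ m :=
    le_trans (Nat.le_add_right _ _) hm1
  have h0 : (Data.atom 0).size = 1 := rfl
  have hsm : s ≤ m := by
    have : 3 * s < m := Nat.lt_two_pow_self
    omega
  have ht'm : t' ≤ p₃.eval m + 2 * m := by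
    omega
  have hp2 := eval_le p₂ (a := (Data.pair x (Data.pair (.atom 0) (f x)).tl.sublists).size)
    (b := 2 * p₃.eval m + 3 * m + 10) (by
      rw [Data.size]
      omega)
  have := hc (3 * s)
  rw [← hm] at this
  simp only [Polynomial.eval_add, Polynomial.eval_mul, Polynomial.eval_comp, Polynomial.eval_X,
    Polynomial.eval_ofNat, Polynomial.eval_C, Polynomial.eval_one, ← hs] at this ⊢
  refine le_trans ?_ this
  have h1 : (Data.pair x (Data.pair (.atom 0) (f x)).tl.sublists).size =
    x.size + (Data.pair (.atom 0) (f x)).tl.sublists.size + 1 := rfl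
  omega

end AbsCalc

namespace AbsCalc

/-! ### Programs that handle codes of calculi -/

/-- The code of the converse of a letter. -/
def Data.convLetter (x : Data) : Data :=
  .pair x.hd (cond (decide (x.tl = .atom 0)) (.atom 1) (.atom 0))

/-- Reverse a coded list. -/
def Data.reverse (l : Data) : Data := .ofList l.toList.reverse

/-- The code of the converse of a production rule. -/
def Data.convProduction (p : Data) : Data :=
  .pair p.hd.convLetter (p.tl.map Data.convLetter).reverse

/-- Fracture a coded label by a coded set of production pairs. -/
def Data.fractureLabel (P y : Data) : Data :=
  .pair (y.hd.filter fun p => !(decide (p ∈ P.toList) || decide (p.convProduction ∈ P.toList))) y.tl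

/-- Fracture a coded rule by a coded set of production pairs. -/
def Data.fractureRule (P r : Data) : Data :=
  cond (decide (r.hd = .atom 0))
    (.pair r.hd (.pair (.pair r.tl.hd.hd
      (r.tl.hd.tl.map fun e => .pair e.hd (Data.fractureLabel P e.tl))) r.tl.tl))
    (cond (decide (r.hd = .atom 4))
      (.pair r.hd (.pair (r.tl.hd.map (Data.fractureLabel P)) r.tl.tl)) r)

/-- The code of `g(A, P)`. -/
def Data.g (A P : Data) : Data :=
  .pair A.hd ((A.tl.map (Data.fractureRule P)).append (P.map (Data.pair (.atom 3))))

/-- The list of the labels of a coded rule. -/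
def Data.labels (r : Data) : Data :=
  cond (decide (r.hd = .atom 0)) (r.tl.hd.tl.map Data.tl)
    (cond (decide (r.hd = .atom 4)) r.tl.hd (.atom 0))

/-- The list of the production pairs of a coded calculus. -/
def Data.allPairs (A : Data) : Data :=
  (A.tl.flatMap fun r => r.labels.flatMap Data.hd).filter fun p => decide (p.hd.tl = .atom 0)

/-- Is the coded set `P` of production pairs closed under dependency among the pairs in `l`? -/
def Data.fracturable (l P : Data) : Bool :=
  P.toList.all fun q => l.toList.all fun q' =>
    decide (q' ∈ P.toList) || !q.tl.toList.any fun x => decide (x.hd = q'.hd.hd)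

/-- The code of the downward space of a coded calculus, given the list of all sets of production
pairs. -/
def Data.downSpace (A l : Data) : Data :=
  (fun F : Data => .pair (F.map (Data.g A)) (F.flatMap fun P =>
    (F.filter fun P' => P.toList.all fun q => decide (q ∈ P'.toList)).map fun P' =>
      .pair (Data.g A P') (Data.g A P))) (l.filter (Data.fracturable A.allPairs))

namespace PolyTime

variable {f h : Data → Data}

@[fun_prop] theorem convLetter (hf : PolyTime f) : PolyTime fun x => (f x).convLetter := by
  unfold Data.convLetter
  fun_prop

@[fun_prop] theorem reverse (hf : PolyTime f) : PolyTime fun x => (f x).reverse := by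
  have := foldr (F := fun _ x r => r.append (.pair x (.atom 0))) hf (const (.atom 0))
    (by fun_prop) (Polynomial.X + 2) (by
    intro d x r
    have := r.size_append_le (.pair x (.atom 0))
    simp [Data.size] at *
    omega)
  convert this using 2 with d
  unfold Data.reverse
  induction (f d).toList with
  | nil => rfl
  | cons x l ih => rw [List.foldr_cons, ← ih]; simp [Data.append, Data.toList]

@[fun_prop] theorem convProduction (hf : PolyTime f) : PolyTime fun x => (f x).convProduction := by
  unfold Data.convProduction
  fun_prop

@[fun_prop] theorem fractureLabel (hf : PolyTime f) (hh : PolyTime h) :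
    PolyTime fun x => Data.fractureLabel (f x) (h x) := by
  unfold Data.fractureLabel
  fun_prop

@[fun_prop] theorem fractureRule (hf : PolyTime f) (hh : PolyTime h) :
    PolyTime fun x => Data.fractureRule (f x) (h x) := by
  unfold Data.fractureRule
  fun_prop

@[fun_prop] theorem g (hf : PolyTime f) (hh : PolyTime h) :
    PolyTime fun x => Data.g (f x) (h x) := by
  unfold Data.g
  fun_prop

@[fun_prop] theorem labels (hf : PolyTime f) : PolyTime fun x => (f x).labels := by
  unfold Data.labels
  fun_prop

@[fun_prop] theorem allPairs (hf : PolyTime f) : PolyTime fun x => (f x).allPairs := by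
  unfold Data.allPairs
  fun_prop

@[fun_prop] theorem fracturable (hf : PolyTime f) (hh : PolyTime h) :
    PolyTime fun x => bit (Data.fracturable (f x) (h x)) := by
  unfold Data.fracturable
  fun_prop

@[fun_prop] theorem downSpace (hf : PolyTime f) (hh : PolyTime h) :
    PolyTime fun x => Data.downSpace (f x) (h x) := by
  have key : PolyTime fun z => .pair (z.tl.map (Data.g z.hd)) (z.tl.flatMap fun P =>
    (z.tl.filter fun P' => P.toList.all fun q => decide (q ∈ P'.toList)).map fun P' =>
      .pair (Data.g z.hd P') (Data.g z.hd P)) := by fun_prop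
  exact key.comp (f := fun x => .pair (f x) ((h x).filter (Data.fracturable (f x).allPairs)))
    (by fun_prop)

end PolyTime

/-! ### Correctness of the programs on codes of calculi -/

variable {E : Finset ℕ}

theorem codeLetter_injective : Function.Injective (codeLetter : Letter E → Data) := by
  rintro ⟨⟨a, ha⟩, x⟩ ⟨⟨b, hb⟩, y⟩ h
  cases x <;> cases y <;> simp_all [codeLetter]

theorem ofList_injective : Function.Injective Data.ofList := fun l l' h => by
  rw [← Data.toList_ofList l, h, Data.toList_ofList]

theorem codeProduction_injective : Function.Injective (codeProduction : Production E → Data) := by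
  rintro ⟨x, s⟩ ⟨y, t⟩ h
  simp only [codeProduction, Data.pair.injEq] at h
  rw [codeLetter_injective h.1, List.map_injective_iff.2 codeLetter_injective
    (ofList_injective h.2)]

theorem convLetter_code (x : Letter E) : (codeLetter x).convLetter = codeLetter x.conv := by
  obtain ⟨a, b⟩ := x
  cases b <;> simp [codeLetter, Data.convLetter, Letter.conv, Data.hd, Data.tl]

theorem convProduction_code (p : Production E) :
    (codeProduction p).convProduction = codeProduction p.conv := by
  simp [codeProduction, Data.convProduction, Production.conv, Data.hd, Data.tl, convLetter_code,
    Data.map, Data.reverse, convStr, Function.comp_def]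

/-- Codes of finite sets of production pairs. -/
def CodesPairs (P : Finset (ProdPair E)) (d : Data) : Prop :=
  CodesSet (fun q x => x = codeProduction q.fwd) (P : Set (ProdPair E)) d

theorem CodesPairs.mem {P : Finset (ProdPair E)} {d : Data} (h : CodesPairs P d)
    {p : Production E} : codeProduction p ∈ d.toList ↔ ∃ q ∈ P, p = q.fwd := by
  rw [CodesSet.mem_toList h]
  simp [codeProduction_injective.eq_iff]

/-- A pair is coded by its member with an unconverted left-hand side only, so a rule has to be
looked up together with its converse. -/
theorem CodesPairs.mem_ofPairs {P : Finset (ProdPair E)} {d : Data} (h : CodesPairs P d)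
    {p : Production E} : p ∈ (ESystem.ofPairs P).prods ↔
      codeProduction p ∈ d.toList ∨ (codeProduction p).convProduction ∈ d.toList := by
  rw [convProduction_code, h.mem, h.mem, ESystem.mem_ofPairs, ← exists_or]
  refine exists_congr fun q => ?_
  rw [← and_or_left]
  refine and_congr_right fun _ => or_congr_right ⟨?_, ?_⟩
  · rintro rfl
    rw [Production.conv_conv]
  · intro h
    rw [← h, Production.conv_conv]

theorem CodesEdgeLabel.fracture {P : Finset (ProdPair E)} {dP : Data} (hP : CodesPairs P dP)
    {L : EdgeLabel E} {y : Data} (h : CodesEdgeLabel L y) :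
    CodesEdgeLabel (L.fracture (ESystem.ofPairs P)) (Data.fractureLabel dP y) := by
  obtain ⟨d, hd, rfl⟩ := h
  refine ⟨_, ?_, rfl⟩
  have := hd.filter (fun p => p ∉ (ESystem.ofPairs P).prods)
    (fun p => !(decide (p ∈ dP.toList) || decide (p.convProduction ∈ dP.toList))) (by
      rintro p - _ rfl
      simp [hP.mem_ofPairs])
  refine Eq.mp ?_ this
  congr 1
  ext p
  simp [EdgeLabel.fracture, ESystem.sdiff]

theorem CodesRule.fracture {nm : Naming} {P : Finset (ProdPair E)} {dP : Data}
    (hP : CodesPairs P dP) {r : Rule E} {d : Data} (h : CodesRule nm r d) :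
    CodesRule nm (r.fracture (ESystem.ofPairs P)) (Data.fractureRule dP d) := by
  cases h with
  | @initial C R d hC =>
    obtain ⟨dv, de, hv, he, rfl⟩ := hC
    refine .initial (C := C.mapLabel fun L => L.fracture (ESystem.ofPairs P)) (R := R)
      ⟨dv, _, hv, ?_, rfl⟩
    have := he.map (c' := fun (e : C.edges) x => ∃ y,
      CodesEdgeLabel ((C.label e).fracture (ESystem.ofPairs P)) y ∧
        x = .pair (.pair (.atom e.1.1) (.atom e.1.2)) y) id
      (fun e => .pair e.hd (Data.fractureLabel dP e.tl)) (by
        rintro e - _ ⟨y, hy, rfl⟩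
        exact ⟨_, hy.fracture hP, rfl⟩)
    rw [Set.image_id] at this
    exact this
  | locl => exact .locl
  | expansion h => exact .expansion h
  | horn => exact .horn
  | @reach n L R ds hL =>
    have := CodesRule.reach (nm := nm) (R := R) fun i => (hL i).fracture hP
    simp only [Data.fractureRule, Data.hd, Data.tl, Data.map, List.map_ofFn, Function.comp_def,
      Data.toList_ofList]
    exact this

theorem CodesCalculus.g {nm : Naming} {A : Calculus E} {d : Data} (hA : CodesCalculus nm A d)
    {P : Finset (ProdPair E)} {dP : Data} (hP : CodesPairs P dP) :
    CodesCalculus nm (A.g P) (Data.g d dP) := by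
  obtain ⟨d₁, d₂, h₁, h₂, rfl⟩ := hA
  refine ⟨d₁, _, h₁, ?_, rfl⟩
  refine CodesSet.append (CodesSet.map h₂ _ _ fun r _ x h => h.fracture hP)
    (CodesSet.map hP _ _ ?_)
  rintro q - _ rfl
  exact .horn

theorem CodesRule.labels {nm : Naming} {r : Rule E} {d : Data} (h : CodesRule nm r d) :
    CodesSet CodesEdgeLabel r.labels d.labels := by
  cases h with
  | @initial C R d hC =>
    obtain ⟨dv, de, hv, he, rfl⟩ := hC
    have := he.map (c' := CodesEdgeLabel) C.label Data.tl (by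
      rintro e - _ ⟨y, hy, rfl⟩
      exact hy)
    rw [Set.image_univ] at this
    exact this
  | @reach n L R ds hL =>
    refine ⟨List.ofFn fun i => (L i, ds i), ?_, ?_, ?_⟩
    · simpa [List.mem_ofFn] using hL
    · ext x
      simp [Rule.labels, List.mem_ofFn]
    · simp [Data.labels, Data.hd, Data.tl, List.map_ofFn, Function.comp_def]
  | _ => exact codesSet_empty

/-- Labels are closed under converses. Keeping the rules with an unconverted left-hand side
therefore selects one representative of each pair. -/
theorem CodesCalculus.allPairs {nm : Naming} {A : Calculus E} (hA : ∀ r ∈ A.rules, ¬ r.IsHorn)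
    {d : Data} (h : CodesCalculus nm A d) : CodesPairs A.gram.allPairs d.allPairs := by
  obtain ⟨d₁, d₂, h₁, h₂, rfl⟩ := h
  have h3 := h₂.flatMap (c' := fun p x => x = codeProduction p) (fun r => ⋃ L ∈ r.labels,
    (L.gram.prods : Set (Production E)))
    (fun r => r.labels.flatMap Data.hd) (by
      intro r _ x hx
      exact hx.labels.flatMap _ _ (by rintro L - _ ⟨d, hd, rfl⟩; exact hd))
  have h4 := h3.filter (fun p => p.1.2 = false) (fun p => decide (p.hd.tl = .atom 0)) (by
    rintro ⟨⟨a, b⟩, s⟩ - _ rfl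
    cases b <;> simp [codeProduction, codeLetter, Data.hd, Data.tl])
  have h5 := h4.image (c' := fun (q : ProdPair E) x => x = codeProduction q.fwd)
    (fun p => ⟨p.1.1, p.2⟩) (by
    rintro ⟨⟨a, b⟩, s⟩ ⟨-, hb⟩ _ rfl
    dsimp only at hb
    rw [hb]
    rfl)
  refine Eq.mp ?_ h5
  unfold CodesPairs
  congr 1
  symm
  ext q
  simp only [Finset.mem_coe, ESystem.mem_allPairs, Calculus.mem_gram, Set.mem_image,
    Set.mem_ofPred_eq, Set.mem_iUnion]
  constructor
  · rintro ⟨r, hr, h⟩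
    obtain ⟨L, hL, h⟩ := (Rule.mem_gram (hA r hr)).1 h
    exact ⟨q.fwd, ⟨⟨r, hr, L, hL, h⟩, rfl⟩, rfl⟩
  · rintro ⟨⟨⟨a, b⟩, s⟩, ⟨⟨r, hr, L, hL, h⟩, hb⟩, rfl⟩
    dsimp only at hb
    subst hb
    exact ⟨r, hr, (Rule.mem_gram (hA r hr)).2 ⟨L, hL, h⟩⟩

/-- Fracturability is closure under single dependencies, so a double loop over pairs decides it and
no transitive closure has to be computed. -/
theorem CodesPairs.fracturable {G : ESystem E} {P : Finset (ProdPair E)} {d dP : Data}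
    (hd : CodesPairs G.allPairs d) (hP : CodesPairs P dP) (hs : P ⊆ G.allPairs) :
    Data.fracturable d dP = true ↔ G.Fracturable P := by
  -- A letter occurs in a string or in its converse iff its edge type occurs with either
  -- orientation, so the program compares edge types and ignores the orientation bit.
  have hocc : ∀ q q' : ProdPair E, (∃ x ∈ (codeProduction q.fwd).tl.toList,
      x.hd = (codeProduction q'.fwd).hd.hd) ↔
      ((q'.lhs, false) ∈ q.rhs ∨ (q'.lhs, false) ∈ convStr q.rhs) := by
    intro q q'
    have h1 : (∃ x ∈ (codeProduction q.fwd).tl.toList, x.hd = (codeProduction q'.fwd).hd.hd) ↔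
        ∃ b, (q'.lhs, b) ∈ q.rhs := by
      simp only [codeProduction, ProdPair.fwd, codeLetter, Data.hd, Data.tl, Data.toList_ofList,
        List.mem_map, exists_exists_and_eq_and, Data.atom.injEq]
      constructor
      · rintro ⟨⟨a, b⟩, h, e⟩
        exact ⟨b, (Subtype.ext e : a = q'.lhs) ▸ h⟩
      · rintro ⟨b, h⟩
        exact ⟨_, h, rfl⟩
    have h2 : (q'.lhs, false) ∈ convStr q.rhs ↔ (q'.lhs, true) ∈ q.rhs := by
      simp [convStr, Letter.conv]
    rw [h1, h2, Bool.exists_bool]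
  rw [ESystem.fracturable_iff]
  simp only [Data.fracturable, List.all_eq_true, Bool.or_eq_true, decide_eq_true_eq,
    Bool.not_eq_true', List.any_eq_false]
  constructor
  · intro h
    refine ⟨fun q hq => ESystem.mem_pairs.2 (ESystem.mem_allPairs.1 (hs hq)), fun q hq q' hd' => ?_⟩
    rcases h _ (hP.mem.2 ⟨q, hq, rfl⟩) _
      (hd.mem.2 ⟨q', ESystem.mem_allPairs.2 (ESystem.mem_pairs.1 hd'.2.1), rfl⟩) with h | h
    · obtain ⟨q'', h, e⟩ := hP.mem.1 h
      rwa [ProdPair.fwd_injective e]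
    · obtain ⟨x, hx, e⟩ := (hocc q q').2 hd'.2.2.2
      exact absurd e (h x hx)
  · rintro ⟨-, h⟩ x hx y hy
    obtain ⟨q, hq, rfl⟩ := (CodesSet.mem_toList hP).1 hx
    obtain ⟨q', hq', rfl⟩ := (CodesSet.mem_toList hd).1 hy
    rw [or_iff_not_imp_left]
    intro hn z hz e
    have hq'P : q' ∉ P := fun h => hn (hP.mem.2 ⟨q', h, rfl⟩)
    refine hq'P (h q hq q' ⟨ESystem.mem_pairs.2 (ESystem.mem_allPairs.1 (hs hq)),
      ESystem.mem_pairs.2 (ESystem.mem_allPairs.1 hq'), ?_, (hocc q q').1 ⟨z, hz, e⟩⟩)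
    -- The program does not test that the two pairs are distinct. This is harmless, because a pair
    -- of P that depends on itself does not lead out of P.
    rintro rfl
    exact hq'P hq

theorem CodesCalculus.downSpace {nm : Naming} {A : Calculus E} (hA : ∀ r ∈ A.rules, ¬ r.IsHorn)
    {d : Data} (h : CodesCalculus nm A d) :
    CodesSpace nm (downSpace A) (Data.downSpace d d.allPairs.sublists) := by
  have hp := h.allPairs hA
  have hF : CodesSet CodesPairs {P | A.gram.Fracturable P}
      (d.allPairs.sublists.filter (Data.fracturable d.allPairs)) := by
    have hs : {P | A.gram.Fracturable P} =
        {P ∈ {P | P ⊆ A.gram.allPairs} | A.gram.Fracturable P} := by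
      ext P
      exact ⟨fun h => ⟨ESystem.Fracturable.subset_allPairs h, h⟩, fun h => h.2⟩
    rw [hs]
    exact (CodesSet.sublists hp).filter (fun P => A.gram.Fracturable P)
      (Data.fracturable d.allPairs) fun P hP x hx => hp.fracturable hx hP
  refine ⟨_, _, ?_, ?_, rfl⟩
  · have := hF.map (c' := CodesCalculus nm) A.g (Data.g d) fun P _ x hx => h.g hx
    convert this using 1
    ext B
    simp only [AbsCalc.downSpace, Set.mem_ofPred_eq, inDown_iff hA, Set.mem_image]
    exact exists_congr fun P => and_congr_right fun _ => eq_comm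
  · have := hF.flatMap (c' := CodesPair (CodesCalculus nm) (CodesCalculus nm))
      (fun P => (fun P' => (A.g P', A.g P)) '' {P' ∈ {P' | A.gram.Fracturable P'} | P ⊆ P'}) _
      (fun P hP x hx => (hF.filter (fun P' => P ⊆ P')
        (fun x' => x.toList.all fun q => decide (q ∈ x'.toList)) (by
          intro P' _ x' hx'
          simp only [List.all_eq_true, decide_eq_true_eq]
          constructor
          · intro hs q hq
            obtain ⟨q', hq', e⟩ := hx'.mem.1 (hs _ (hx.mem.2 ⟨q, hq, rfl⟩))
            rwa [ProdPair.fwd_injective e]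
          · intro hs y hy
            obtain ⟨q, hq, rfl⟩ := (CodesSet.mem_toList hx).1 hy
            exact hx'.mem.2 ⟨q, hs hq, rfl⟩)).map _ (fun x' => .pair (Data.g d x') (Data.g d x))
        fun P' _ x' hx' => ⟨_, _, h.g hx', h.g hx, rfl⟩)
    convert this using 1
    ext ⟨C, B⟩
    simp only [mem_downSpace_rel hA, Set.mem_iUnion, Set.mem_image, Set.mem_ofPred_eq,
      Prod.mk.injEq]
    constructor
    · rintro ⟨P, P', hP, hP', hs, rfl, rfl⟩
      exact ⟨P, hP, P', ⟨hP', hs⟩, rfl, rfl⟩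
    · rintro ⟨P, hP, P', ⟨hP', hs⟩, rfl, rfl⟩
      exact ⟨P, P', hP, hP', hs, rfl, rfl⟩

end AbsCalc

namespace AbsCalc

/-! ### Derivations of strings -/

section Strings

variable {α : Type}

open Relation (ReflTransGen)

theorem ESystem.Step.append_left {G : ESystem α} {s t : List (Letter α)} (h : G.Step s t)
    (l : List (Letter α)) : G.Step (l ++ s) (l ++ t) := by
  obtain ⟨p, hp, a, b, rfl, rfl⟩ := h
  exact ⟨p, hp, l ++ a, b, by simp, by simp⟩

theorem ESystem.Step.append_right {G : ESystem α} {s t : List (Letter α)} (h : G.Step s t)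
    (l : List (Letter α)) : G.Step (s ++ l) (t ++ l) := by
  obtain ⟨p, hp, a, b, rfl, rfl⟩ := h
  exact ⟨p, hp, a, b ++ l, by simp, by simp⟩

theorem ESystem.derives_append {G : ESystem α} {s s' t t' : List (Letter α)}
    (hs : ReflTransGen G.Step s s') (ht : ReflTransGen G.Step t t') :
    ReflTransGen G.Step (s ++ t) (s' ++ t') :=
  (hs.lift (· ++ t) fun _ _ h => h.append_right t).trans
    (ht.lift (s' ++ ·) fun _ _ h => h.append_left s')

theorem ESystem.Step.of_append {G : ESystem α} {s t u : List (Letter α)} (h : G.Step (s ++ t) u) :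
    (∃ s', G.Step s s' ∧ u = s' ++ t) ∨ ∃ t', G.Step t t' ∧ u = s ++ t' := by
  obtain ⟨p, hp, a, b, h, rfl⟩ := h
  rw [List.append_assoc, List.append_eq_append_iff] at h
  rcases h with ⟨c, rfl, rfl⟩ | ⟨c, rfl, h⟩
  · exact .inr ⟨c ++ p.2 ++ b, ⟨p, hp, c, b, by simp, rfl⟩, by simp⟩
  -- If `c` is empty, the cut lies immediately before the rewritten letter, and the step belongs to
  -- the right part after all.
  · rcases c with _ | ⟨x, c⟩
    · simp only [List.nil_append] at h
      subst h
      exact .inr ⟨p.2 ++ b, ⟨p, hp, [], b, by simp, by simp⟩, by simp⟩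
    · simp only [List.cons_append, List.nil_append, List.cons.injEq] at h
      obtain ⟨rfl, rfl⟩ := h
      exact .inl ⟨a ++ p.2 ++ c, ⟨p, hp, a, c, by simp, rfl⟩, by simp⟩

/-- Left-hand sides are single letters, so no rewriting step straddles the cut. -/
theorem ESystem.derives_of_append {G : ESystem α} {s t u : List (Letter α)}
    (h : ReflTransGen G.Step (s ++ t) u) :
    ∃ s' t', ReflTransGen G.Step s s' ∧ ReflTransGen G.Step t t' ∧ u = s' ++ t' := by
  induction h with
  | refl => exact ⟨s, t, .refl, .refl, rfl⟩
  | tail _ h ih =>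
    obtain ⟨s', t', hs, ht, rfl⟩ := ih
    rcases ESystem.Step.of_append h with ⟨s'', h', rfl⟩ | ⟨t'', h', rfl⟩
    · exact ⟨s'', t', hs.tail h', ht, rfl⟩
    · exact ⟨s', t'', hs, ht.tail h', rfl⟩

theorem ESystem.derives_eq_of_stuck {G : ESystem α} {s t : List (Letter α)}
    (hs : ∀ p ∈ G.prods, p.1 ∉ s) (h : ReflTransGen G.Step s t) : t = s := by
  induction h with
  | refl => rfl
  | tail _ h ih =>
    subst ih
    obtain ⟨p, hp, a, b, rfl, rfl⟩ := h
    exact absurd (by simp) (hs p hp)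

theorem ESystem.derives_conv {G : ESystem α} {s t : List (Letter α)}
    (h : ReflTransGen G.Step s t) : ReflTransGen G.Step (convStr s) (convStr t) := by
  refine h.lift convStr ?_
  rintro _ _ ⟨p, hp, a, b, rfl, rfl⟩
  refine ⟨Production.conv p, G.closed p hp, convStr b, convStr a, ?_, ?_⟩
  · simp [convStr, Production.conv]
  · simp [convStr, Production.conv]

/-! ### Paths -/

theorem GSeq.Path.mem_left {Γ : GSeq α} {w u : Vertex} {s : List (Letter α)} (h : Γ.Path w s u) :
    w ∈ vertsOf Γ.suc := by
  cases h with
  | nil h => exact h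
  | cons h _ => exact h.mem_left

theorem GSeq.Path.mem_right {Γ : GSeq α} {w u : Vertex} {s : List (Letter α)} (h : Γ.Path w s u) :
    u ∈ vertsOf Γ.suc := h.conv.mem_left

theorem GSeq.Path.append {Γ : GSeq α} {w v u : Vertex} {s t : List (Letter α)}
    (h : Γ.Path w s v) (h' : Γ.Path v t u) : Γ.Path w (s ++ t) u := by
  induction h with
  | nil _ => exact h'
  | cons e _ ih => exact .cons e (ih h')

theorem GSeq.Path.of_append {Γ : GSeq α} {w u : Vertex} {s t : List (Letter α)}
    (h : Γ.Path w (s ++ t) u) : ∃ v, Γ.Path w s v ∧ Γ.Path v t u := by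
  induction s generalizing w with
  | nil => exact ⟨w, .nil h.mem_left, h⟩
  | cons x s ih =>
    cases h with
    | cons e h =>
      obtain ⟨v, h₁, h₂⟩ := ih h
      exact ⟨v, .cons e h₁, h₂⟩

theorem GSeq.Edge.mono {Γ Γ' : GSeq α} (h : Γ.ant ⊆ Γ'.ant) {w u : Vertex} {x : Letter α}
    (e : Γ.Edge w x u) : Γ'.Edge w x u := by
  obtain ⟨a, b⟩ := x
  cases b
  · exact h e
  · exact h e

theorem GSeq.Path.mono {Γ Γ' : GSeq α} (h : Γ.ant ⊆ Γ'.ant)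
    (hv : vertsOf Γ.suc ⊆ vertsOf Γ'.suc) {w u : Vertex} {s : List (Letter α)}
    (p : Γ.Path w s u) : Γ'.Path w s u := by
  induction p with
  | nil hw => exact .nil (hv hw)
  | cons e _ ih => exact .cons (e.mono h) ih

theorem GSeq.path_singleton {Γ : GSeq α} {w u : Vertex} {x : Letter α} (e : Γ.Edge w x u) :
    Γ.Path w [x] u :=
  .cons e (.nil ((GSeq.edge_conv Γ).2 e).mem_left)

/-- Every edge of `Γ` is derivable from a path of `Γ'`. -/
def GSeq.Covers (G : ESystem α) (Γ Γ' : GSeq α) : Prop :=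
  vertsOf Γ.suc ⊆ vertsOf Γ'.suc ∧ ∀ e ∈ Γ.ant, ∃ s, ReflTransGen G.Step [(e.2.1, false)] s ∧
    Γ'.Path e.1 s e.2.2

theorem GSeq.Covers.edge {G : ESystem α} {Γ Γ' : GSeq α} (h : Γ.Covers G Γ') {w u : Vertex}
    {x : Letter α} (e : Γ.Edge w x u) : ∃ s, ReflTransGen G.Step [x] s ∧ Γ'.Path w s u := by
  obtain ⟨a, b⟩ := x
  cases b
  · exact h.2 _ e
  · obtain ⟨s, hs, hp⟩ := h.2 (u, a, w) e
    exact ⟨convStr s, ESystem.derives_conv hs, hp.conv⟩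

/-- Each edge is replaced by a path of `Γ'`. Closure of the `E`-system under converses takes care of
the edges that are traversed backwards. -/
theorem GSeq.Covers.path {G : ESystem α} {Γ Γ' : GSeq α} (h : Γ.Covers G Γ') {w u : Vertex}
    {s : List (Letter α)} (p : Γ.Path w s u) :
    ∃ t, ReflTransGen G.Step s t ∧ Γ'.Path w t u := by
  induction p with
  | nil hw => exact ⟨[], .refl, .nil (h.1 hw)⟩
  | cons e _ ih =>
    obtain ⟨t₁, h₁, p₁⟩ := h.edge e
    obtain ⟨t₂, h₂, p₂⟩ := ih
    exact ⟨_, ESystem.derives_append h₁ h₂, p₁.append p₂⟩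

theorem GSeq.covers_of_subset {G : ESystem α} {Γ Γ' : GSeq α} (h : Γ.ant ⊆ Γ'.ant)
    (hv : vertsOf Γ.suc ⊆ vertsOf Γ'.suc) : Γ.Covers G Γ' :=
  ⟨hv, fun _ he => ⟨_, .refl, GSeq.path_singleton (h he)⟩⟩

theorem GSeq.Covers.trans_subset {G : ESystem α} {Γ Γ' Γ'' : GSeq α} (h : Γ.Covers G Γ')
    (h' : Γ'.ant ⊆ Γ''.ant) (hv : vertsOf Γ'.suc ⊆ vertsOf Γ''.suc) : Γ.Covers G Γ'' :=
  ⟨h.1.trans hv, fun e he => by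
    obtain ⟨s, hs, hp⟩ := h.2 e he
    exact ⟨s, hs, hp.mono h' hv⟩⟩

theorem GSeq.Covers.reaches {G : ESystem α} {Γ Γ' : GSeq α} (h : Γ.Covers G Γ') {w u : Vertex}
    {a : α} (p : Γ.Reaches w ⟨G, a⟩ u) : Γ'.Reaches w ⟨G, a⟩ u := by
  obtain ⟨s, hs, hp⟩ := p
  obtain ⟨t, ht, hp'⟩ := h.path hp
  exact ⟨t, ReflTransGen.trans hs ht, hp'⟩

theorem GSeq.Reaches.mono_gram {Γ : GSeq α} {G G' : ESystem α} (h : G.prods ⊆ G'.prods)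
    {w u : Vertex} {a : α} (p : Γ.Reaches w ⟨G, a⟩ u) : Γ.Reaches w ⟨G', a⟩ u := by
  obtain ⟨s, hs, hp⟩ := p
  refine ⟨s, ReflTransGen.mono ?_ _ _ hs, hp⟩
  rintro _ _ ⟨p, hp, h'⟩
  exact ⟨p, h hp, h'⟩

/-- The g-sequent is closed under the Horn rules of the production pairs in `Q`. -/
def GSeq.Saturated (Γ : GSeq α) (Q : Finset (ProdPair α)) : Prop :=
  ∀ q ∈ Q, ∀ w u, Γ.Path w q.rhs u → (w, q.lhs, u) ∈ Γ.ant

variable [DecidableEq α]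

theorem GSeq.Saturated.edge {Γ : GSeq α} {Q : Finset (ProdPair α)} (h : Γ.Saturated Q)
    {p : Production α} (hp : p ∈ (ESystem.ofPairs Q).prods) {w u : Vertex}
    (hw : Γ.Path w p.2 u) : Γ.Edge w p.1 u := by
  obtain ⟨q, hq, rfl | rfl⟩ := ESystem.mem_ofPairs.1 hp
  · exact h q hq w u hw
  · refine h q hq u w ?_
    have := hw.conv
    rwa [Production.conv, convStr_convStr] at this

/-- If a rule outside Q could rewrite a letter in the right-hand side of a rule of Q, its pair would
depend on a pair of Q and so would belong to Q. This is the point where fracturability enters the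
translation. -/
theorem ESystem.Fracturable.stuck {G : ESystem α} {Q : Finset (ProdPair α)}
    (hQ : G.Fracturable Q) {p : Production α} (hp : p ∈ (ofPairs Q).prods) :
    ∀ p' ∈ (G.sdiff (ofPairs Q)).prods, p'.1 ∉ p.2 := by
  intro p' hp' hmem
  obtain ⟨hpG, hpQ⟩ := mem_sdiff.1 hp'
  rw [fracturable_iff] at hQ
  obtain ⟨q, hq, hqp⟩ := mem_ofPairs.1 hp
  obtain ⟨q', hq'⟩ := p'.eq_fwd_or
  have hq'G : q' ∈ G.pairs := by
    rw [mem_pairs]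
    rcases hq' with rfl | rfl
    · exact hpG
    · exact conv_mem.1 hpG
  have hq'Q : q' ∉ Q := fun h => hpQ (mem_ofPairs.2 ⟨q', h, hq'⟩)
  have hc : ∀ a b, (a, b) ∈ convStr q.rhs ↔ (a, !b) ∈ q.rhs := fun a b => by
    cases b <;> simp [convStr, Letter.conv]
  refine hq'Q (hQ.2 q hq q' ⟨hQ.1 hq, hq'G, fun h => hq'Q (h ▸ hq), ?_⟩)
  rcases hqp with rfl | rfl <;> rcases hq' with rfl | rfl <;>
    simp_all [ProdPair.fwd, Production.conv, Letter.conv]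

/-- Over a saturated g-sequent the productions of a fracturable set are not needed. -/
theorem GSeq.Saturated.reaches {Γ : GSeq α} {G : ESystem α} {Q : Finset (ProdPair α)}
    (hQ : G.Fracturable Q) (h : Γ.Saturated Q) {w u : Vertex} {a : α}
    (p : Γ.Reaches w ⟨G, a⟩ u) : Γ.Reaches w ⟨G.sdiff (ESystem.ofPairs Q), a⟩ u := by
  obtain ⟨s, hs, hp⟩ := p
  replace hs : ReflTransGen G.Step [(a, false)] s := hs
  show ∃ t, ReflTransGen (G.sdiff (ESystem.ofPairs Q)).Step [(a, false)] t ∧ Γ.Path w t u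
  -- The induction removes productions of Q from the front of the derivation, so the start must be
  -- an arbitrary string. The end of the derivation changes as well: the path found may be shorter.
  generalize [(a, false)] = l at hs ⊢
  induction hs using ReflTransGen.head_induction_on with
  | refl => exact ⟨s, .refl, hp⟩
  | head hst _ ih =>
    obtain ⟨t, ht, hp⟩ := ih
    obtain ⟨p, hpG, l, r, rfl, rfl⟩ := hst
    by_cases hpQ : p ∈ (ESystem.ofPairs Q).prods
    -- The step used a rule of Q. The remaining derivation avoids Q, so it leaves the right-hand
    -- side `p.2` unchanged, and the path has a segment that spells it. By saturation there is an
    -- edge `p.1` across this segment; taking it makes the step superfluous.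
    · obtain ⟨t₁₂, t₃, h₁₂, h₃, rfl⟩ := ESystem.derives_of_append ht
      obtain ⟨t₁, t₂, h₁, h₂, rfl⟩ := ESystem.derives_of_append h₁₂
      obtain rfl := ESystem.derives_eq_of_stuck (hQ.stuck hpQ) h₂
      obtain ⟨v₂, hp, hp₃⟩ := hp.of_append
      obtain ⟨v₁, hp₁, hp₂⟩ := hp.of_append
      exact ⟨t₁ ++ [p.1] ++ t₃, ESystem.derives_append (ESystem.derives_append h₁ .refl) h₃,
        (hp₁.append (GSeq.path_singleton (h.edge hpQ hp₂))).append hp₃⟩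
    · exact ⟨t, .head ⟨p, ESystem.mem_sdiff.2 ⟨hpG, hpQ⟩, l, r, rfl, rfl⟩ ht, hp⟩

/-! ### Rule applications -/

theorem Rule.App.mono {r : Rule α} {n : ℕ} {prems : Fin n → GSeq α} {Γ : GSeq α}
    (h : r.App n prems Γ) (i : Fin n) :
    Γ.ant ⊆ (prems i).ant ∧ vertsOf Γ.suc ⊆ vertsOf (prems i).suc := by
  cases h with
  | initial => exact i.elim0
  | locl _ _ _ _ D w S hw hP hG hR =>
    rw [(hP i).1, (hP i).2, hG]
    simp [vertsOf]
  | expansion _ _ _ _ D w u x S₁ S₂ S hx hw hu hP hG hR =>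
    obtain rfl : i = 0 := Subsingleton.elim _ _
    rw [hP.1, hP.2, hG]
    refine ⟨Finset.subset_insert _ _, ?_⟩
    simp only [vertsOf, Finset.image_insert]
    grind
  | horn q _ _ h =>
    obtain rfl : i = 0 := Subsingleton.elim _ _
    obtain ⟨w, u, -, h₁, h₂⟩ := h
    rw [h₁, h₂]
    exact ⟨Finset.subset_insert _ _, subset_rfl⟩
  | reach _ _ _ _ _ D w u S hw hu hP hG hC hR =>
    rw [(hP i).1, (hP i).2, hG]
    simp [vertsOf]

/-- An application of a rule that leaves the set of prefixed sequents of the only premise unchanged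
only adds derivable edges. -/
theorem Rule.App.covers {r : Rule α} {prems : Fin 1 → GSeq α} {Γ Γ' : GSeq α} {G : ESystem α}
    (h : r.App 1 prems Γ) (hs : (prems 0).suc = Γ.suc) (hr : ∀ q, r = .horn q → q.fwd ∈ G.prods)
    (hc : Γ.Covers G Γ') : (prems 0).Covers G Γ' := by
  cases h with
  | locl _ _ _ _ D w S hw hP hG hR => exact ⟨hs ▸ hc.1, (hP 0).1 ▸ hc.2⟩
  | expansion _ _ _ _ D w u x S₁ S₂ S hx hw hu hP hG hR =>
    -- An expansion adds a fresh vertex to the prefixed sequents, so it cannot leave them unchanged.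
    refine absurd ?_ hu
    rw [← hs, hP.2]
    simp [vertsOf]
  | horn q _ _ h =>
    obtain ⟨w, u, hp, h₁, h₂⟩ := h
    refine ⟨hs ▸ hc.1, fun e he => ?_⟩
    rw [h₁, Finset.mem_insert] at he
    rcases he with rfl | he
    · obtain ⟨t, ht, hp'⟩ := hc.path hp
      -- The new edge is derivable by the production of the Horn rule, followed by the derivations
      -- that lift its right-hand side to a path of `Γ'`.
      exact ⟨t, .head ⟨_, hr q rfl, [], [], rfl, by simp [ProdPair.fwd]⟩ ht, hp'⟩
    · exact hc.2 e he
  | reach _ _ _ _ _ D w u S hw hu hP hG hC hR => exact ⟨hs ▸ hc.1, (hP 0).1 ▸ hc.2⟩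

/-- Transfer of a rule application to other edges and other labels. -/
theorem Rule.App.transfer {r : Rule α} {G₁ G₂ : ESystem α} {n : ℕ} {prems prems' : Fin n → GSeq α}
    {Γ Γ' : GSeq α} (hr : ¬ r.IsHorn) (h : (r.fracture G₁).App n prems Γ) (hs : Γ'.suc = Γ.suc)
    (hps : ∀ i, (prems' i).suc = (prems i).suc)
    (hpa : ∀ i, (prems' i).ant = Γ'.ant ∪ ((prems i).ant \ Γ.ant))
    (hL : ∀ L ∈ r.labels, ∀ w u, Γ.Reaches w (L.fracture G₁) u → Γ'.Reaches w (L.fracture G₂) u) :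
    (r.fracture G₂).App n prems' Γ' := by
  cases r with
  | initial C R =>
    cases h with
    | initial _ _ _ _ f S hC hS hR =>
      refine .initial (C.mapLabel fun L => L.fracture G₂) R prems' Γ' f S ⟨?_, fun e => ?_⟩ ?_ ?_
      · rw [hs]
        exact hC.1
      · exact hL _ ⟨e, rfl⟩ _ _ (hC.2 e)
      · rw [hs]
        exact hS
      · rw [hs]
        exact hR
  | locl m R =>
    cases h with
    | locl _ _ _ _ D w S hw hP hG hR =>
      refine .locl _ R prems' Γ' D w S hw (fun i => ⟨?_, ?_⟩) (hs.trans hG) hR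
      · rw [hpa, (hP i).1]
        simp
      · rw [hps, (hP i).2]
  | expansion X R =>
    cases h with
    | expansion _ _ _ _ D w u x S₁ S₂ S hx hw hu hP hG hR =>
      refine .expansion X R prems' Γ' D w u x S₁ S₂ S hx hw (hs ▸ hu) ⟨?_, ?_⟩ (hs.trans hG) hR
      · rw [hpa, hP.1]
        -- The edge to the fresh vertex is not in the source conclusion, so it is contained in the
        -- difference that the target premise inherits.
        have : edgeAtom w x u ∉ Γ.ant := by
          intro he
          obtain ⟨a, b⟩ := x
          cases b
          · obtain ⟨T, hT⟩ := Γ.target_mem _ he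
            exact hu (Finset.mem_image.2 ⟨_, hT, rfl⟩)
          · obtain ⟨T, hT⟩ := Γ.source_mem _ he
            exact hu (Finset.mem_image.2 ⟨_, hT, rfl⟩)
        ext e
        simp only [Finset.mem_union, Finset.mem_sdiff, Finset.mem_insert]
        grind
      · rw [hps, hP.2]
  | horn q => exact absurd trivial hr
  | reach m L R =>
    cases h with
    | reach _ _ _ _ _ D w u S hw hu hP hG hC hR =>
      refine .reach _ _ R prems' Γ' D w u S hw hu (fun i => ⟨?_, ?_⟩) (hs.trans hG) (fun i => ?_) hR
      · rw [hpa, (hP i).1]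
        simp
      · rw [hps, (hP i).2]
      · have hv : vertsOf (prems i).suc = vertsOf Γ.suc := by
          rw [(hP i).2, hG]
          simp [vertsOf]
        obtain ⟨s, hs', hp⟩ := hC i
        obtain ⟨t, ht, hp'⟩ := hL _ ⟨i, rfl⟩ w u ⟨s, hs', hp.mono (hP i).1.subset hv.subset⟩
        refine ⟨t, ht, hp'.mono ?_ ?_⟩
        · rw [hpa]
          exact Finset.subset_union_left
        · rw [hps, hv, hs]

end Strings
end AbsCalc

namespace AbsCalc

/-! ### A program that translates proofs -/

section Translation

variable {E : Finset ℕ}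

/-- The code of an edge atom, given the codes of the vertices. -/
def Data.edge (w : Data) (x : Letter E) (v : Data) : Data :=
  if x.2 then .pair v (.pair (.atom x.1) w) else .pair w (.pair (.atom x.1) v)

/-- The vertices that are reachable from `W` in the graph with the vertices `V` and the edges `Γ` by
a path that spells `s`. -/
def Data.ends (V Γ : Data) : List (Letter E) → Data → Data
  | [], W => W
  | x :: s, W =>
    Data.ends V Γ s (V.filter fun v => W.toList.any fun w => decide (Data.edge w x v ∈ Γ.toList))

/-- Is the edge `e` derivable by a Horn rule of `Q`? -/
def Data.derivable (Q : List (ProdPair E)) (V Γ e : Data) : Bool :=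
  Q.any fun q => decide (e.tl.hd = .atom q.lhs) &&
    decide (e.tl.tl ∈ (Data.ends V Γ q.rhs (.pair e.hd (.atom 0))).toList)

/-- All possible edges between the vertices of a coded g-sequent. -/
noncomputable def Data.candidates (E : Finset ℕ) (g : Data) : Data :=
  (g.tl.map Data.hd).flatMap fun w =>
    (Data.ofList ((Finset.univ : Finset E).toList.map fun a : E => .atom (a : ℕ))).flatMap fun a =>
      (g.tl.map Data.hd).map fun u => .pair w (.pair a u)

/-- The derivable edges that are missing from `Γ`. -/
noncomputable def Data.newEdges (Q : List (ProdPair E)) (g Γ : Data) : Data :=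
  (Data.candidates E g).filter fun e =>
    !decide (e ∈ Γ.toList) && Data.derivable Q (g.tl.map Data.hd) Γ e

/-- Extend a list of sets of edges by a set that has one more derivable edge, if possible. -/
noncomputable def Data.satStep (Q : List (ProdPair E)) (g r : Data) : Data :=
  cond (Data.newEdges Q g r.hd).isPair (.pair (.pair (Data.newEdges Q g r.hd).hd r.hd) r) r

/-- The sets of edges between `Γ` and its closure under the Horn rules of `Q`, in reverse order. -/
noncomputable def Data.saturate (Q : List (ProdPair E)) (g Γ : Data) : Data :=
  (Data.candidates E g).toList.foldr (fun _ r => Data.satStep Q g r) (.pair Γ (.atom 0))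

/-- Does the root of the tree `x` have exactly one premise, with the same prefixed sequents? -/
def Data.skips (x : Data) : Bool :=
  x.tl.isPair && (!x.tl.tl.isPair && ((x.hd.tl.toList.all fun y => decide (y ∈ x.tl.hd.hd.tl.toList))
    && x.tl.hd.hd.tl.toList.all fun y => decide (y ∈ x.hd.tl.toList)))

/-- Derive a g-sequent with the first set of edges in the reverse of `l` from the root of `D`. -/
def Data.chain (suc l D : Data) : Data :=
  l.reverse.toList.foldr (fun Γ D => .pair (.pair Γ suc) (.pair D (.atom 0))) D

/-- The context for the premises of a tree. -/
noncomputable def Data.transCtx (Q : List (ProdPair E)) (z : Data) : Data :=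
  cond z.tl.skips (.pair z.hd.hd z.tl.tl.hd.hd.hd)
    (.pair (Data.saturate Q z.tl.hd z.hd.hd).hd z.tl.hd.hd)

/-- The context for a premise, given the context for all premises. -/
def Data.premCtx (z : Data) : Data :=
  .pair (z.hd.hd.append (z.tl.hd.hd.filter fun e => !decide (e ∈ z.hd.tl.toList))) (.atom 0)

/-- The translation of a tree, given the translations of its premises. -/
noncomputable def Data.transNode (Q : List (ProdPair E)) (z : Data) : Data :=
  cond z.tl.hd.skips z.tl.tl.hd
    (Data.chain z.tl.hd.hd.tl (Data.saturate Q z.tl.hd.hd z.hd.hd).tl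
      (.pair (.pair (Data.saturate Q z.tl.hd.hd z.hd.hd).hd z.tl.hd.hd.tl) z.tl.tl))

/-- The translation of a tree. -/
noncomputable def Data.translate (Q : List (ProdPair E)) (d : Data) : Data :=
  rose (Data.transNode Q) (Data.transCtx Q) Data.premCtx true (.pair d.hd.hd (.atom 0)) d

namespace PolyTime

variable {f h k l : Data → Data}

@[fun_prop] theorem edge (hf : PolyTime f) (hh : PolyTime h) (x : Letter E) :
    PolyTime fun d => Data.edge (f d) x (h d) := by
  unfold Data.edge
  split <;> fun_prop

@[fun_prop] theorem ends (hf : PolyTime f) (hh : PolyTime h) (s : List (Letter E))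
    (hk : PolyTime k) : PolyTime fun d => Data.ends (f d) (h d) s (k d) := by
  induction s generalizing k with
  | nil => exact hk
  | cons x s ih =>
    simp only [Data.ends]
    apply ih
    fun_prop

@[fun_prop] theorem derivable (Q : List (ProdPair E)) (hf : PolyTime f) (hh : PolyTime h)
    (hk : PolyTime k) : PolyTime fun d => bit (Data.derivable Q (f d) (h d) (k d)) := by
  unfold Data.derivable
  induction Q with
  | nil => exact const (bit false)
  | cons q Q ih =>
    simp only [List.any_cons]
    fun_prop

@[fun_prop] theorem candidates (hf : PolyTime f) : PolyTime fun d => Data.candidates E (f d) := by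
  unfold Data.candidates
  fun_prop

@[fun_prop] theorem newEdges (Q : List (ProdPair E)) (hf : PolyTime f) (hh : PolyTime h) :
    PolyTime fun d => Data.newEdges Q (f d) (h d) := by
  unfold Data.newEdges
  fun_prop

@[fun_prop] theorem satStep (Q : List (ProdPair E)) (hf : PolyTime f) (hh : PolyTime h) :
    PolyTime fun d => Data.satStep Q (f d) (h d) := by
  unfold Data.satStep
  fun_prop

theorem _root_.AbsCalc.Data.size_filter_le (F : Data → Bool) (d : Data) :
    (d.filter F).size ≤ d.size := by
  unfold Data.filter
  induction d with
  | atom => simp [Data.toList, Data.ofList, Data.size]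
  | pair x y _ ih =>
    simp only [Data.toList, List.filter_cons, Data.size]
    split
    · simp only [Data.ofList, Data.size]
      omega
    · omega

/-- Each step adds at most one edge to the newest set and stores one more set. The newest set grows
linearly in the number of steps, and the list of all sets quadratically. -/
theorem _root_.AbsCalc.Data.size_satStep_iterate (Q : List (ProdPair E)) (g Γ : Data) (l : List Data)
    {K : ℕ} (hK : (Data.candidates E g).size ≤ K) :
    (l.foldr (fun _ r => Data.satStep Q g r) (.pair Γ (.atom 0))).hd.size ≤
      Γ.size + l.length * (K + 1) ∧
    (l.foldr (fun _ r => Data.satStep Q g r) (.pair Γ (.atom 0))).size ≤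
      (l.length + 1) * (Γ.size + l.length * (K + 1) + 2) := by
  induction l with
  | nil => simp [Data.hd, Data.size]
  | cons x l ih =>
    obtain ⟨ih₁, ih₂⟩ := ih
    rw [List.foldr_cons]
    set r := l.foldr (fun _ r => Data.satStep Q g r) (.pair Γ (.atom 0))
    have hmul : (l.length + 1) * (K + 1) = l.length * (K + 1) + (K + 1) := by ring
    have hle : (l.length + 1) * (Γ.size + l.length * (K + 1) + 2) ≤
        (l.length + 1) * (Γ.size + (l.length + 1) * (K + 1) + 2) := by gcongr; omega
    rw [List.length_cons, add_mul (l.length + 1) 1 (Γ.size + (l.length + 1) * (K + 1) + 2), one_mul]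
    unfold Data.satStep
    cases (Data.newEdges Q g r.hd).isPair
    · simp only [cond_false]
      omega
    · have h1 := (Data.newEdges Q g r.hd).hd_size_le
      have h2 := Data.size_filter_le (fun e => !decide (e ∈ r.hd.toList) &&
        Data.derivable Q (g.tl.map Data.hd) r.hd e) (Data.candidates E g)
      change (Data.newEdges Q g r.hd).size ≤ _ at h2
      simp only [cond_true, Data.hd_pair, Data.size]
      omega

@[fun_prop] theorem saturate (Q : List (ProdPair E)) (hf : PolyTime f) (hh : PolyTime h) :
    PolyTime fun d => Data.saturate Q (f d) (h d) := by
  obtain ⟨p, hp⟩ := (candidates (E := E) id').size_le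
  have key : PolyTime fun z => Data.saturate Q z.hd z.tl := by
    unfold Data.saturate
    refine foldr_of_size_le (l := fun z => Data.candidates E z.hd)
      (F := fun z _ r => Data.satStep Q z.hd r) (by fun_prop) (by fun_prop) (by fun_prop)
      ((Polynomial.X + 1) * (Polynomial.X + Polynomial.X * (p + 1) + 2)) fun z l => ?_
    set n := z.size + (Data.ofList l).size with hn
    have h1 := z.hd_size_le
    have h2 := z.tl_size_le
    have h3 := (Data.ofList l).length_toList_le
    rw [Data.toList_ofList] at h3
    refine (Data.size_satStep_iterate Q z.hd z.tl l ((hp z.hd).trans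
      (eval_le p (show z.hd.size ≤ n by omega)))).2.trans ?_
    simp only [Polynomial.eval_mul, Polynomial.eval_add, Polynomial.eval_X, Polynomial.eval_one,
      Polynomial.eval_ofNat]
    gcongr <;> omega
  have := key.comp (hf.pair hh)
  simpa only [Data.hd_pair, Data.tl_pair] using this

@[fun_prop] theorem skips (hf : PolyTime f) : PolyTime fun d => bit (f d).skips := by
  unfold Data.skips
  fun_prop

@[fun_prop] theorem chain (hf : PolyTime f) (hh : PolyTime h) (hk : PolyTime k) :
    PolyTime fun d => Data.chain (f d) (h d) (k d) := by
  obtain ⟨p, hp⟩ := hf.size_le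
  exact foldr (F := fun d Γ D => .pair (.pair Γ (f d)) (.pair D (.atom 0))) hh.reverse hk
    (by have := hf.comp hd'; fun_prop) (Polynomial.X + p.comp Polynomial.X + 5) (by
      intro d x r
      have := (hp d).trans (eval_le p (show d.size ≤ d.size + x.size by omega))
      simp [Data.size]
      omega)

@[fun_prop] theorem transCtx (Q : List (ProdPair E)) : PolyTime (Data.transCtx Q) := by
  unfold Data.transCtx
  fun_prop

@[fun_prop] theorem premCtx : PolyTime Data.premCtx := by
  unfold Data.premCtx
  fun_prop

@[fun_prop] theorem transNode (Q : List (ProdPair E)) : PolyTime (Data.transNode Q) := by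
  unfold Data.transNode
  fun_prop

theorem translate (Q : List (ProdPair E)) : PolyTime (Data.translate Q) := by
  obtain ⟨p, hp⟩ := (candidates (E := E) id').size_le
  obtain ⟨s, hs⟩ := (saturate Q hd' tl').size_le
  have key : PolyTime fun z =>
      rose (Data.transNode Q) (Data.transCtx Q) Data.premCtx true z.hd z.tl := by
    -- The summands `p * (p + 1)`, `X` and 2 bound the growth of the context: saturation adds at
    -- most as many edges as there are candidates, independently of the context. The remaining
    -- summands pay for the node and the chain of Horn inferences below it.
    refine polyTime_rose (transNode Q) (transCtx Q) premCtx
      (p * (p + 1) + Polynomial.X + 2 + (3 * s.comp (Polynomial.X + 1) + 2 * Polynomial.X + 10 +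
        s.comp (Polynomial.X + 1) * (s.comp (Polynomial.X + 1) + Polynomial.X + 5)))
      (fun c x => ?_) (fun c x => ?_) (fun c x r => ?_)
    · simp only [Polynomial.eval_add, Polynomial.eval_mul, Polynomial.eval_X, Polynomial.eval_one,
        Polynomial.eval_ofNat]
      have h1 := c.hd_size_le
      have h2 := x.hd_size_le
      have h3 := x.hd.hd_size_le
      have h4 := x.tl_size_le
      have h5 := x.tl.hd_size_le
      have h6 := x.tl.hd.hd_size_le
      have h7 := x.tl.hd.hd.hd_size_le
      have h8 : (Data.candidates E x.hd).size ≤ p.eval x.size := (hp _).trans (eval_le p h2)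
      have h9 := (Data.candidates E x.hd).length_toList_le
      have h10 := (Data.size_satStep_iterate Q x.hd c.hd (Data.candidates E x.hd).toList h8).1
      have h11 : (Data.candidates E x.hd).toList.length * (p.eval x.size + 1) ≤
        p.eval x.size * (p.eval x.size + 1) := Nat.mul_le_mul_right _ (h9.trans h8)
      unfold Data.transCtx
      cases hsk : (Data.pair c x).tl.skips
      · simp only [cond_false, Data.size, Data.saturate, Data.hd_pair, Data.tl_pair]
        omega
      · simp only [cond_true, Data.size, Data.hd_pair, Data.tl_pair]
        omega
    · simp only [Polynomial.eval_add, Polynomial.eval_mul, Polynomial.eval_X, Polynomial.eval_one,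
        Polynomial.eval_ofNat]
      have h1 := c.hd_size_le
      have h2 := x.hd_size_le
      have h3 := x.hd.hd_size_le
      have h4 := Data.size_filter_le (fun e => !decide (e ∈ c.tl.toList)) x.hd.hd
      have h5 := c.hd.size_append_le (x.hd.hd.filter fun e => !decide (e ∈ c.tl.toList))
      have h6 : (Data.premCtx (.pair c x)).size =
        (c.hd.append (x.hd.hd.filter fun e => !decide (e ∈ c.tl.toList))).size + 1 + 1 := rfl
      omega
    · set n := c.size + x.size with hn
      have h1 := c.hd_size_le
      have h2 := x.hd_size_le
      have h3 := r.hd_size_le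
      have h4 := x.hd.tl_size_le
      have h5 := (hs (.pair x.hd c.hd)).trans (eval_le s (show _ ≤ n + 1 by
        simp only [Data.size]; omega))
      simp only [Data.hd_pair, Data.tl_pair] at h5
      have h6 := (Data.saturate Q x.hd c.hd).hd_size_le
      have h7 := (Data.saturate Q x.hd c.hd).tl_size_le
      simp only [Polynomial.eval_add, Polynomial.eval_mul, Polynomial.eval_X, Polynomial.eval_one,
        Polynomial.eval_ofNat, Polynomial.eval_comp]
      set S := s.eval (n + 1)
      unfold Data.transNode
      cases hsk : (Data.pair c (.pair x r)).tl.hd.skips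
      · simp only [cond_false, Data.hd_pair, Data.tl_pair, Data.chain]
        refine (foldr_size_le (c := S + n + 5) (k := S) (fun y hy D => ?_) ?_).trans ?_
        · have h8 : y ∈ (Data.saturate Q x.hd c.hd).tl.toList := by simpa [Data.reverse] using hy
          have := Data.size_le_of_mem h8
          simp only [Data.size]
          omega
        · have := (Data.saturate Q x.hd c.hd).tl.length_toList_le
          simp only [Data.reverse, Data.toList_ofList, List.length_reverse]
          omega
        · simp only [Data.size]
          omega
      · simp only [cond_true, Data.hd_pair, Data.tl_pair]
        omega
  have := key.comp (f := fun d => .pair (.pair d.hd.hd (.atom 0)) d) (by fun_prop)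
  exact this

end PolyTime

end Translation
end AbsCalc

namespace AbsCalc

/-! ### Correctness of the translation -/

section Correctness

variable {E : Finset ℕ}

/-- The code of an edge atom. -/
def codeEdge (e : Vertex × E × Vertex) : Data :=
  .pair (.atom e.1) (.pair (.atom e.2.1) (.atom e.2.2))

theorem codeEdge_injective : Function.Injective (codeEdge : Vertex × E × Vertex → Data) := by
  rintro ⟨w, ⟨a, ha⟩, u⟩ ⟨w', ⟨a', ha'⟩, u'⟩ h
  simpa [codeEdge] using h

/-- Codes of finite sets of edge atoms. -/
def CodesEdges (F : Finset (Vertex × E × Vertex)) (d : Data) : Prop :=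
  CodesSet (fun e x => x = codeEdge e) (F : Set (Vertex × E × Vertex)) d

/-- Codes of finite sets of prefixed sequents. -/
def CodesSuc (D : Finset (Vertex × Sequent)) (d : Data) : Prop :=
  CodesSet (CodesPair CodesNat CodesNat) (D : Set (Vertex × Sequent)) d

theorem codesGSeq_iff {G : GSeq E} {d : Data} :
    CodesGSeq G d ↔ ∃ d₁ d₂, CodesEdges G.ant d₁ ∧ CodesSuc G.suc d₂ ∧ d = .pair d₁ d₂ := Iff.rfl

theorem CodesEdges.mem {F : Finset (Vertex × E × Vertex)} {d : Data} (h : CodesEdges F d)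
    {e : Vertex × E × Vertex} : codeEdge e ∈ d.toList ↔ e ∈ F := by
  rw [CodesSet.mem_toList h]
  simp [codeEdge_injective.eq_iff]

theorem codesPair_nat {q : ℕ × ℕ} {d : Data} :
    CodesPair CodesNat CodesNat q d ↔ d = .pair (.atom q.1) (.atom q.2) := by
  simp [CodesPair, CodesNat]

theorem CodesSuc.mem_toList {D : Finset (Vertex × Sequent)} {d : Data} (h : CodesSuc D d)
    {x : Data} : x ∈ d.toList ↔ ∃ q ∈ D, x = .pair (.atom q.1) (.atom q.2) :=
  CodesSet.mem_toList (code := fun q : ℕ × ℕ => .pair (.atom q.1) (.atom q.2)) (by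
    have := CodesSet.image (c' := fun (q : ℕ × ℕ) x => x = .pair (.atom q.1) (.atom q.2)) h id
      fun _ _ _ h => codesPair_nat.1 h
    rwa [Set.image_id] at this)

theorem CodesSuc.eq_iff {D D' : Finset (Vertex × Sequent)} {d d' : Data} (h : CodesSuc D d)
    (h' : CodesSuc D' d') : D = D' ↔ (∀ x ∈ d.toList, x ∈ d'.toList) ∧
      ∀ x ∈ d'.toList, x ∈ d.toList := by
  have key : ∀ {D D' : Finset (Vertex × Sequent)} {d d' : Data}, CodesSuc D d → CodesSuc D' d' →
      (∀ x ∈ d.toList, x ∈ d'.toList) → D ⊆ D' := by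
    intro D D' d d' h h' hs q hq
    obtain ⟨q', hq', e⟩ := h'.mem_toList.1 (hs _ (h.mem_toList.2 ⟨q, hq, rfl⟩))
    simp only [Data.pair.injEq, Data.atom.injEq] at e
    rwa [Prod.ext e.1 e.2]
  constructor
  · rintro rfl
    exact ⟨fun x hx => h'.mem_toList.2 (h.mem_toList.1 hx),
      fun x hx => h.mem_toList.2 (h'.mem_toList.1 hx)⟩
  · exact fun hs => (key h h' hs.1).antisymm (key h' h hs.2)

theorem CodesSuc.verts {D : Finset (Vertex × Sequent)} {d : Data} (h : CodesSuc D d) :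
    CodesSet CodesNat (vertsOf D : Set Vertex) (d.map Data.hd) := by
  have := CodesSet.map (c' := CodesNat) h Prod.fst Data.hd (by
    rintro q - x hx
    rw [codesPair_nat.1 hx]
    rfl)
  simpa [vertsOf] using this

theorem edge_mem {Γ : GSeq E} {d : Data} (h : CodesEdges Γ.ant d) {w u : Vertex} {x : Letter E} :
    Data.edge (.atom w) x (.atom u) ∈ d.toList ↔ Γ.Edge w x u := by
  obtain ⟨a, b⟩ := x
  cases b
  · exact h.mem (e := (w, a, u))
  · exact h.mem (e := (u, a, w))

theorem codes_ends {Γ : GSeq E} {V d : Data} (h : CodesEdges Γ.ant d)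
    (hV : CodesSet CodesNat (vertsOf Γ.suc : Set Vertex) V) (s : List (Letter E)) {S : Set Vertex}
    {W : Data} (hW : CodesSet CodesNat S W) (hS : S ⊆ vertsOf Γ.suc) :
    CodesSet CodesNat {u | ∃ w ∈ S, Γ.Path w s u} (Data.ends V d s W) := by
  induction s generalizing S W with
  | nil =>
    have : {u | ∃ w ∈ S, Γ.Path w [] u} = S := by
      ext u
      constructor
      · rintro ⟨w, hw, hp⟩
        cases hp
        exact hw
      · exact fun hu => ⟨u, hu, .nil (hS hu)⟩
    rw [this]
    exact hW
  | cons x s ih =>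
    have h1 := hV.filter (fun v => ∃ w ∈ S, Γ.Edge w x v)
      (fun v => W.toList.any fun w => decide (Data.edge w x v ∈ d.toList)) (by
        rintro v - _ rfl
        simp only [List.any_eq_true, decide_eq_true_eq]
        constructor
        · rintro ⟨y, hy, he⟩
          obtain ⟨w, hw, rfl⟩ := (CodesSet.mem_toList (code := Data.atom) hW).1 hy
          exact ⟨w, hw, (edge_mem h).1 he⟩
        · rintro ⟨w, hw, he⟩
          exact ⟨_, (CodesSet.mem_toList (code := Data.atom) hW).2 ⟨w, hw, rfl⟩, (edge_mem h).2 he⟩)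
    have : {u | ∃ w ∈ S, Γ.Path w (x :: s) u} =
        {u | ∃ v ∈ {v ∈ (vertsOf Γ.suc : Set Vertex) | ∃ w ∈ S, Γ.Edge w x v}, Γ.Path v s u} := by
      ext u
      constructor
      · rintro ⟨w, hw, hp⟩
        cases hp with
        | cons e hp => exact ⟨_, ⟨((GSeq.edge_conv Γ).2 e).mem_left, w, hw, e⟩, hp⟩
      · rintro ⟨v, ⟨-, w, hw, e⟩, hp⟩
        exact ⟨w, hw, .cons e hp⟩
    rw [this]
    exact ih h1 fun v hv => hv.1

theorem derivable_iff {Q : List (ProdPair E)} {Γ : GSeq E} {V d : Data} (h : CodesEdges Γ.ant d)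
    (hV : CodesSet CodesNat (vertsOf Γ.suc : Set Vertex) V) {e : Vertex × E × Vertex}
    (he : e.1 ∈ vertsOf Γ.suc) : Data.derivable Q V d (codeEdge e) = true ↔
      ∃ q ∈ Q, q.lhs = e.2.1 ∧ Γ.Path e.1 q.rhs e.2.2 := by
  simp only [Data.derivable, List.any_eq_true, Bool.and_eq_true, decide_eq_true_eq]
  refine exists_congr fun q => and_congr_right fun _ => and_congr ?_ ?_
  · simp only [codeEdge, Data.hd_pair, Data.tl_pair, Data.atom.injEq]
    exact ⟨fun h => Subtype.ext h.symm, fun h => h ▸ rfl⟩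
  · have hW : CodesSet CodesNat {e.1} (.pair (codeEdge e).hd (.atom 0)) :=
      codesSet_code.2 ⟨[e.1], by simp, rfl⟩
    rw [CodesSet.mem_toList (code := Data.atom) (codes_ends h hV q.rhs hW (by simpa using he))]
    simp [codeEdge]

theorem codes_candidates {D : Finset (Vertex × Sequent)} {g : Data} (h : CodesSuc D g.tl) :
    CodesSet (fun (e : Vertex × E × Vertex) x => x = codeEdge e)
      {e | e.1 ∈ vertsOf D ∧ e.2.2 ∈ vertsOf D} (Data.candidates E g) := by
  have h1 := h.verts
  have h2 : CodesSet (fun (a : E) x => x = Data.atom a) Set.univ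
      (Data.ofList ((Finset.univ : Finset E).toList.map fun a : E => .atom (a : ℕ))) :=
    codesSet_code.2 ⟨Finset.univ.toList, by ext; simp, rfl⟩
  have := h1.flatMap (c' := fun (e : Vertex × E × Vertex) x => x = codeEdge e)
    (fun w => ⋃ a ∈ Set.univ, (fun u => (w, a, u)) '' (vertsOf D : Set Vertex))
    (fun w => (Data.ofList ((Finset.univ : Finset E).toList.map
      fun a : E => .atom (a : ℕ))).flatMap fun a =>
        (g.tl.map Data.hd).map fun u => .pair w (.pair a u)) (by
      rintro w - _ rfl
      refine h2.flatMap _ _ ?_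
      rintro a - _ rfl
      refine h1.map _ _ ?_
      rintro u - _ rfl
      rfl)
  convert this using 1
  · ext ⟨w, a, u⟩
    simp [and_comm]
  · rfl

theorem mem_newEdges {Q : List (ProdPair E)} {Γ : GSeq E} {g d : Data} (h : CodesEdges Γ.ant d)
    (hg : CodesSuc Γ.suc g.tl) {x : Data} : x ∈ (Data.newEdges Q g d).toList ↔
      ∃ e : Vertex × E × Vertex, x = codeEdge e ∧ e.2.2 ∈ vertsOf Γ.suc ∧ e ∉ Γ.ant ∧
        ∃ q ∈ Q, q.lhs = e.2.1 ∧ Γ.Path e.1 q.rhs e.2.2 := by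
  simp only [Data.newEdges, Data.filter, Data.toList_ofList, List.mem_filter,
    CodesSet.mem_toList (codes_candidates (E := E) hg), Bool.and_eq_true, Bool.not_eq_true',
    decide_eq_false_iff_not]
  constructor
  · rintro ⟨⟨e, he, rfl⟩, hn, hd⟩
    rw [h.mem] at hn
    exact ⟨e, rfl, he.2, hn, (derivable_iff h hg.verts he.1).1 hd⟩
  · rintro ⟨e, rfl, he, hn, hq⟩
    have he1 : e.1 ∈ vertsOf Γ.suc := by
      obtain ⟨q, -, -, hp⟩ := hq
      exact hp.mem_left
    rw [h.mem]
    exact ⟨⟨e, ⟨he1, he⟩, rfl⟩, hn, (derivable_iff h hg.verts he1).2 hq⟩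

theorem GSeq.exists_ant (Γ : GSeq E) (F : Finset (Vertex × E × Vertex))
    (hF : ∀ e ∈ F, e.1 ∈ vertsOf Γ.suc ∧ e.2.2 ∈ vertsOf Γ.suc) :
    ∃ Γ' : GSeq E, Γ'.ant = F ∧ Γ'.suc = Γ.suc := by
  refine ⟨⟨F, Γ.suc, Γ.functional, fun e he => ?_, fun e he => ?_⟩, rfl, rfl⟩
  · obtain ⟨⟨_, S⟩, hS, h⟩ := Finset.mem_image.1 (hF e he).1
    exact ⟨S, h ▸ hS⟩
  · obtain ⟨⟨_, S⟩, hS, h⟩ := Finset.mem_image.1 (hF e he).2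
    exact ⟨S, h ▸ hS⟩

theorem GSeq.ant_verts (Γ : GSeq E) {e : Vertex × E × Vertex} (he : e ∈ Γ.ant) :
    e.1 ∈ vertsOf Γ.suc ∧ e.2.2 ∈ vertsOf Γ.suc := by
  obtain ⟨S, hS⟩ := Γ.source_mem e he
  obtain ⟨T, hT⟩ := Γ.target_mem e he
  exact ⟨Finset.mem_image.2 ⟨_, hS, rfl⟩, Finset.mem_image.2 ⟨_, hT, rfl⟩⟩

/-- The list of edge sets starts with the largest, which is the one next to the root of `D`; the
last one ends up at the root. -/
theorem chain_pair (suc Γ l D : Data) :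
    Data.chain suc (.pair Γ l) D = Data.chain suc l (.pair (.pair Γ suc) (.pair D (.atom 0))) := by
  simp [Data.chain, Data.reverse, Data.toList]

theorem CodesDeriv.unary {Γ : GSeq E} {π : Deriv E} {d D : Data} (h : CodesGSeq Γ d)
    (hπ : CodesDeriv π D) : CodesDeriv (.node Γ 1 fun _ => π) (.pair d (.pair D (.atom 0))) :=
  .node (ds := fun _ => D) h fun _ => hπ

/-- Each step that is not stuck removes at least one candidate from the missing ones. With as many
steps as candidates, either the process gets stuck on the way or no candidate is missing at the end.
-/
theorem saturate_stuck (Q : List (ProdPair E)) (g Γ : Data) :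
    (Data.newEdges Q g (Data.saturate Q g Γ).hd).isPair = false := by
  generalize hcs : (Data.candidates E g).toList = cs
  have key : ∀ l : List Data,
      (Data.newEdges Q g (l.foldr (fun _ r => Data.satStep Q g r) (.pair Γ (.atom 0))).hd).isPair
        = false ∨
      (cs.filter fun e => !decide
        (e ∈ (l.foldr (fun _ r => Data.satStep Q g r) (.pair Γ (.atom 0))).hd.toList)).length +
        l.length ≤ cs.length := by
    intro l
    induction l with
    | nil => exact .inr (List.length_filter_le _ _)
    | cons x l ih =>
      rw [List.foldr_cons]
      set r := l.foldr (fun _ r => Data.satStep Q g r) (.pair Γ (.atom 0))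
      cases hn : Data.newEdges Q g r.hd with
      | atom k =>
        left
        have : Data.satStep Q g r = r := by simp [Data.satStep, hn, Data.isPair]
        rw [this, hn]
        rfl
      | pair e es =>
        right
        have hs : Data.satStep Q g r = .pair (.pair e r.hd) r := by
          simp [Data.satStep, hn, Data.isPair]
        have he : e ∈ (Data.newEdges Q g r.hd).toList := by simp [hn, Data.toList]
        simp only [Data.newEdges, Data.filter, Data.toList_ofList, List.mem_filter, hcs] at he
        have ih' := ih.resolve_left (by simp [hn, Data.isPair])
        have hlt : (cs.filter fun y => !decide (y ∈ (Data.pair e r.hd).toList)).length <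
            (cs.filter fun y => !decide (y ∈ r.hd.toList)).length := by
          have : (cs.filter fun y => !decide (y ∈ (Data.pair e r.hd).toList)) =
              (cs.filter fun y => !decide (y ∈ r.hd.toList)).filter
                fun y => !decide (y = e) := by
            rw [List.filter_filter]
            refine List.filter_congr fun y _ => ?_
            simp [Data.toList]
          rw [this, List.length_filter_lt_length_iff_exists]
          refine ⟨e, List.mem_filter.2 ⟨he.1, ?_⟩, by simp⟩
          exact (Bool.and_eq_true _ _ ▸ he.2).1
        rw [hs, Data.hd_pair, List.length_cons]
        omega
  rcases key cs with h | h
  · unfold Data.saturate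
    rwa [hcs]
  · have h0 : (cs.filter fun e => !decide (e ∈ (Data.saturate Q g Γ).hd.toList)) = [] := by
      apply List.eq_nil_of_length_eq_zero
      unfold Data.saturate
      rw [hcs]
      omega
    cases hn : Data.newEdges Q g (Data.saturate Q g Γ).hd with
    | atom => rfl
    | pair e es =>
      have he : e ∈ (Data.newEdges Q g (Data.saturate Q g Γ).hd).toList := by simp [hn, Data.toList]
      simp only [Data.newEdges, Data.filter, Data.toList_ofList, List.mem_filter, hcs] at he
      have := List.mem_filter (p := fun e => !decide (e ∈ (Data.saturate Q g Γ).hd.toList)).2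
        ⟨he.1, (Bool.and_eq_true _ _ ▸ he.2).1⟩
      rw [h0] at this
      simp at this

/-- The stages of the closure process, read from the largest to the smallest, are consecutive Horn
inferences: each adds one derivable edge to the premise. A proof of the closure thus extends to a
proof of the g-sequent from which the process started. -/
theorem saturate_spec {C : Calculus E} {Q : Finset (ProdPair E)}
    (hC : ∀ q ∈ Q, Rule.horn q ∈ C.rules) {Γ : GSeq E} {g d : Data} (h : CodesEdges Γ.ant d)
    (hg : CodesSuc Γ.suc g.tl) :
    ∃ Γ' : GSeq E, Γ'.suc = Γ.suc ∧ Γ.ant ⊆ Γ'.ant ∧ Γ'.Saturated Q ∧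
      CodesEdges Γ'.ant (Data.saturate Q.toList g d).hd ∧
      ∀ π D, IsProof C π → π.concl = Γ' → CodesDeriv π D →
        ∃ π', IsProof C π' ∧ π'.concl = Γ ∧
          CodesDeriv π' (Data.chain g.tl (Data.saturate Q.toList g d).tl D) := by
  have key : ∀ l : List Data, ∃ Γ' : GSeq E, Γ'.suc = Γ.suc ∧ Γ.ant ⊆ Γ'.ant ∧
      CodesEdges Γ'.ant
        (l.foldr (fun _ r => Data.satStep Q.toList g r) (.pair d (.atom 0))).hd ∧
      (l.foldr (fun _ r => Data.satStep Q.toList g r) (.pair d (.atom 0))).isPair ∧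
      ∀ π D, IsProof C π → π.concl = Γ' → CodesDeriv π D →
        ∃ π', IsProof C π' ∧ π'.concl = Γ ∧ CodesDeriv π' (Data.chain g.tl
          (l.foldr (fun _ r => Data.satStep Q.toList g r) (.pair d (.atom 0))).tl D) := by
    intro l
    induction l with
    | nil => exact ⟨Γ, rfl, subset_rfl, h, rfl, fun π D hπ hc hD => ⟨π, hπ, hc, hD⟩⟩
    | cons x l ih =>
      rw [List.foldr_cons]
      set r := l.foldr (fun _ r => Data.satStep Q.toList g r) (.pair d (.atom 0)) with hr
      obtain ⟨Γ', h₁, h₂, h₃, h₄, h₅⟩ := ih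
      cases hn : Data.newEdges Q.toList g r.hd with
      | atom k =>
        have : Data.satStep Q.toList g r = r := by simp [Data.satStep, hn, Data.isPair]
        rw [this]
        exact ⟨Γ', h₁, h₂, h₃, h₄, h₅⟩
      | pair y ys =>
        have hs : Data.satStep Q.toList g r = .pair (.pair y r.hd) r := by
          simp [Data.satStep, hn, Data.isPair]
        have hy : y ∈ (Data.newEdges Q.toList g r.hd).toList := by simp [hn, Data.toList]
        obtain ⟨⟨w, a, u⟩, rfl, he, -, q, hq, rfl, hp⟩ := (mem_newEdges h₃ (h₁ ▸ hg)).1 hy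
        obtain ⟨Γ'', ha, hsuc⟩ := Γ'.exists_ant (insert (w, q.lhs, u) Γ'.ant) (by
          intro e he'
          rcases Finset.mem_insert.1 he' with rfl | he'
          · exact ⟨hp.mem_left, he⟩
          · exact Γ'.ant_verts he')
        rw [hs]
        refine ⟨Γ'', hsuc.trans h₁, ?_, ?_, rfl, fun π D hπ hc hD => ?_⟩
        · rw [ha]
          exact h₂.trans (Finset.subset_insert _ _)
        · rw [ha, Data.hd_pair]
          obtain ⟨l, hl, e⟩ := codesSet_code.1 h₃
          refine codesSet_code.2 ⟨(w, q.lhs, u) :: l, ?_, by rw [e]; rfl⟩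
          rw [Finset.coe_insert, hl]
          ext
          simp
        · rw [Data.tl_pair]
          obtain ⟨r₁, r₂, hr'⟩ : ∃ r₁ r₂, r = .pair r₁ r₂ := by
            cases hr' : r with
            | atom => rw [hr'] at h₄; cases h₄
            | pair r₁ r₂ => exact ⟨_, _, rfl⟩
          rw [hr'] at h₃ h₅ ⊢
          rw [chain_pair]
          -- The g-sequent with the additional edge is the premise of the Horn rule, so the new
          -- inference goes below the given proof and above the earlier part of the chain.
          refine h₅ (.node Γ' 1 fun _ => π) _ (.node Γ' 1 _ (.horn q) (hC q (by simpa using hq))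
            (.horn q _ Γ' ⟨w, u, hp, ?_, ?_⟩) (by simp) fun _ => hπ) rfl (.unary ?_ hD)
          · rw [hc, ha]
            rfl
          · rw [hc, hsuc]
          · exact ⟨_, _, h₃, h₁ ▸ hg, rfl⟩
  obtain ⟨Γ', h₁, h₂, h₃, -, h₅⟩ := key (Data.candidates E g).toList
  refine ⟨Γ', h₁, h₂, fun q hq w u hp => ?_, h₃, h₅⟩
  by_contra hn
  have hmem := (mem_newEdges (Q := Q.toList) h₃ (h₁ ▸ hg)).2
    ⟨(w, q.lhs, u), rfl, hp.mem_right, hn, q, by simpa using hq, rfl, hp⟩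
  have := saturate_stuck Q.toList g d
  unfold Data.saturate at this
  cases hne : Data.newEdges Q.toList g
      ((Data.candidates E g).toList.foldr (fun _ r => Data.satStep Q.toList g r)
        (.pair d (.atom 0))).hd with
  | atom => rw [hne] at hmem; simp [Data.toList] at hmem
  | pair => rw [hne] at this; cases this

end Correctness
end AbsCalc

namespace AbsCalc

/-! ### Translation of proofs between fractured calculi -/

section Equivalence

variable {E : Finset ℕ}

theorem rose_ofList (post ctx cctx : Data → Data) (c : Data) (l : List Data) :
    rose post ctx cctx false c (.ofList l) =
      .ofList (l.map fun d => rose post ctx cctx true (cctx (.pair c d)) d) := by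
  induction l with
  | nil => simp [rose, Data.ofList]
  | cons x l ih => simp [rose, Data.ofList, ih]

theorem CodesDeriv.root {π : Deriv E} {d : Data} (h : CodesDeriv π d) :
    CodesGSeq π.concl d.hd := by
  cases h with
  | node h _ => exact h

/-- Proof trees do not record which rules were applied, so whether a node is skipped has to be
decided from the g-sequents alone. -/
theorem skips_iff {Γ : GSeq E} {n : ℕ} {prems : Fin n → Deriv E} {d : Data} {ds : Fin n → Data}
    (h : CodesGSeq Γ d) (hds : ∀ i, CodesDeriv (prems i) (ds i)) :
    (Data.pair d (.ofList (List.ofFn ds))).skips = true ↔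
      n = 1 ∧ ∀ i, (prems i).concl.suc = Γ.suc := by
  match n with
  | 0 => simp [Data.skips, Data.ofList, Data.isPair]
  | 1 =>
    obtain ⟨d₁, d₂, -, h₂, rfl⟩ := codesGSeq_iff.1 h
    obtain ⟨e₁, e₂, -, k₂, e⟩ := codesGSeq_iff.1 (hds 0).root
    have := CodesSuc.eq_iff h₂ k₂
    rw [eq_comm] at this
    simp [Data.skips, Data.ofList, Data.isPair, this, e]
  | n + 2 => simp [Data.skips, Data.ofList, Data.isPair, List.ofFn_succ]

theorem codes_premCtx {F F' F'' : Finset (Vertex × E × Vertex)} {c x : Data}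
    (h : CodesEdges F c.hd) (h' : CodesEdges F' c.tl) (h'' : CodesEdges F'' x.hd.hd) :
    CodesEdges (F ∪ (F'' \ F')) (Data.premCtx (.pair c x)).hd := by
  have := CodesSet.append h (CodesSet.filter h'' (· ∉ F') (fun e => !decide (e ∈ c.tl.toList)) (by
    rintro e - _ rfl
    simp [h'.mem]))
  unfold CodesEdges
  convert this using 1
  · ext
    simp
  · rfl

/-- The induction runs over the source proof while the target conclusion `Γ'` is prescribed from
below. It needs the same prefixed sequents as the source and a covering of the source edges by
derivable paths. The context holds the edges of the target; its second component, the edges of the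
source conclusion, matters only for passing to the premises. -/
theorem translate_spec {A : Calculus E} (hA : A.IsImplicit) {P Q : Finset (ProdPair E)}
    (hP : A.gram.Fracturable P) (hQ : A.gram.Fracturable Q) {π : Deriv E}
    (h : IsProof (A.g P) π) {d : Data} (hd : CodesDeriv π d) {c : Data} {Γ' : GSeq E}
    (hs : Γ'.suc = π.concl.suc) (hc : CodesEdges Γ'.ant c.hd)
    (hcov : π.concl.Covers A.gram Γ') :
    ∃ π', IsProof (A.g Q) π' ∧ π'.concl = Γ' ∧ CodesDeriv π'
      (rose (Data.transNode Q.toList) (Data.transCtx Q.toList) Data.premCtx true c d) := by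
  induction h generalizing d c Γ' with
  | node Γ n prems r hr happ hn hprems ih =>
    simp only [Deriv.concl] at hs hcov
    cases hd with
    | @node _ _ _ d ds hG hds =>
    have hskip := skips_iff hG hds
    obtain ⟨d₁, d₂, h₁, h₂, rfl⟩ := codesGSeq_iff.1 hG
    cases hsk : (Data.pair (.pair d₁ d₂) (.ofList (List.ofFn ds))).skips
    · rw [hsk] at hskip
      -- A Horn inference leaves the prefixed sequents unchanged and would have been skipped, so
      -- this rule comes from `A` by fracturing.
      obtain ⟨r, hrA, rfl⟩ : ∃ r₀ ∈ A.rules, r₀.fracture (ESystem.ofPairs P) = r := by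
        rcases hr with hr | ⟨q, -, rfl⟩
        · exact hr
        · cases happ with
          | horn _ _ _ h =>
            obtain ⟨_, _, -, -, h⟩ := h
            exact absurd (hskip.2 ⟨rfl, fun i => by rwa [Subsingleton.elim i 0]⟩) (by simp)
      obtain ⟨Γs, k₁, k₂, k₃, k₄, k₅⟩ := saturate_spec (C := A.g Q) (Q := Q) (g := .pair d₁ d₂)
        (fun q hq => (Calculus.horn_mem_g hA.1).2 hq) hc (hs ▸ h₂)
      have hsuc : Γs.suc = Γ.suc := k₁.trans hs
      have hcov' : Γ.Covers A.gram Γs := hcov.trans_subset k₂ (by rw [k₁])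
      -- A target premise consists of the saturated target edges and of the edges that the source
      -- premise has beyond its conclusion; the latter can only come from an expansion.
      have hex : ∀ i, ∃ Γi : GSeq E, Γi.ant = Γs.ant ∪ ((prems i).concl.ant \ Γ.ant) ∧
          Γi.suc = (prems i).concl.suc := fun i => by
        refine (prems i).concl.exists_ant _ fun e he => ?_
        rcases Finset.mem_union.1 he with he | he
        · have := Γs.ant_verts he
          rw [hsuc] at this
          exact ⟨(happ.mono i).2 this.1, (happ.mono i).2 this.2⟩
        · exact (prems i).concl.ant_verts (Finset.mem_sdiff.1 he).1
      choose Γi ha hsi using hex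
      -- Old edges are covered by the invariant, new ones by themselves.
      have hcovi : ∀ i, (prems i).concl.Covers A.gram (Γi i) := fun i => by
        refine ⟨by rw [hsi], fun e he => ?_⟩
        by_cases he' : e ∈ Γ.ant
        · refine (hcov'.trans_subset (ha i ▸ Finset.subset_union_left) ?_).2 e he'
          rw [hsuc, hsi]
          exact (happ.mono i).2
        · refine ⟨_, .refl, GSeq.path_singleton (x := (e.2.1, false)) (?_ : e ∈ (Γi i).ant)⟩
          rw [ha]
          exact Finset.mem_union_right _ (Finset.mem_sdiff.2 ⟨he, he'⟩)
      have hi := fun i => ih i (hds i) (hsi i) (c := Data.premCtx (.pair (.pair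
        (Data.saturate Q.toList (.pair d₁ d₂) c.hd).hd d₁) (ds i))) (by
          obtain ⟨e₁, e₂, he, -, e⟩ := codesGSeq_iff.1 (hds i).root
          rw [ha]
          exact codes_premCtx k₄ h₁ (by rw [e]; exact he)) (hcovi i)
      choose πi l₁ l₂ l₃ using hi
      -- From right to left: enlarge G \ P to G, move along the covering, and discard the
      -- productions of Q by saturation.
      have hL : ∀ L ∈ r.labels, ∀ w u, Γ.Reaches w (L.fracture (ESystem.ofPairs P)) u →
          Γs.Reaches w (L.fracture (ESystem.ofPairs Q)) u := fun L hL w u hp => by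
        have hg := hA.label_gram hrA hL
        simp only [EdgeLabel.fracture, hg] at hp ⊢
        exact k₃.reaches hQ (hcov'.reaches (hp.mono_gram Finset.sdiff_subset))
      have hinit : n = 0 → (r.fracture (ESystem.ofPairs Q)).IsInitial := fun h => by
        have := hn h
        revert this
        cases r <;> exact id
      obtain ⟨π', m₁, m₂, m₃⟩ := k₅ (.node Γs n πi) _
        (.node Γs n πi (r.fracture (ESystem.ofPairs Q)) (.inl ⟨r, hrA, rfl⟩)
          (Rule.App.transfer (hA.1 r hrA) happ hsuc (fun i => by rw [l₂, hsi])
            (fun i => by rw [l₂, ha]) hL) hinit l₁) rfl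
        (.node (ds := fun i => rose _ _ _ true _ (ds i)) ⟨_, _, k₄, hsuc ▸ h₂, rfl⟩ l₃)
      refine ⟨π', m₁, m₂, ?_⟩
      convert m₃ using 1
      simp only [rose, Data.transNode, Data.transCtx, Data.hd_pair, Data.tl_pair, hsk, cond_false,
        rose_ofList, List.map_ofFn]
      rfl
    · obtain ⟨rfl, hsuc⟩ := hskip.1 hsk
      -- The node is skipped: the target stays the same and covers the premise, so the translation
      -- of the only premise is the translation of the node.
      obtain ⟨e₁, e₂, he, -, e⟩ := codesGSeq_iff.1 (hds 0).root
      have hcov' := happ.covers (hsuc 0) (G := A.gram) (by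
        rintro q rfl
        have := hP.1 ((Calculus.horn_mem_g hA.1).1 hr)
        exact this.1) hcov
      -- The second component of the context is the edge set of the premise itself, so
      -- `Data.premCtx` adds no edge to the target.
      obtain ⟨π', l₁, l₂, l₃⟩ := ih 0 (hds 0) (Γ' := Γ')
        (c := Data.premCtx (.pair (.pair c.hd (ds 0).hd.hd) (ds 0))) (hs.trans (hsuc 0).symm) (by
          have := codes_premCtx (c := .pair c.hd (ds 0).hd.hd) (x := ds 0) hc
            (F' := (prems 0).concl.ant) (by rw [e]; exact he) (by rw [e]; exact he)
          rwa [Finset.sdiff_self, Finset.union_empty] at this) hcov'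
      refine ⟨π', l₁, l₂, ?_⟩
      convert l₃ using 1
      simp only [rose, Data.transNode, Data.transCtx, Data.hd_pair, Data.tl_pair, hsk, cond_true,
        rose_ofList, List.map_ofFn]
      rfl

theorem exists_codesGSeq (Γ : GSeq E) : ∃ d, CodesGSeq Γ d := by
  exact ⟨_, codesGSeq_iff.2 ⟨_, .ofList (Γ.suc.toList.map fun q => .pair (.atom q.1) (.atom q.2)),
    codesSet_code.2 ⟨Γ.ant.toList, by ext; simp, rfl⟩,
    ⟨Γ.suc.toList.map fun q => (q, .pair (.atom q.1) (.atom q.2)), by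
      simp only [List.mem_map, codesPair_nat]
      rintro _ ⟨q, -, rfl⟩
      rfl, by ext ⟨w, S⟩; simp, by simp [Function.comp_def]⟩, rfl⟩⟩

theorem exists_codesDeriv (π : Deriv E) : ∃ d, CodesDeriv π d := by
  induction π with
  | node Γ n prems ih =>
    choose ds hds using ih
    obtain ⟨d, hd⟩ := exists_codesGSeq Γ
    exact ⟨_, .node hd hds⟩

/-- At the root the target is the source conclusion, which covers itself. -/
theorem exists_proof_g {A : Calculus E} (hA : A.IsImplicit) {P Q : Finset (ProdPair E)}
    (hP : A.gram.Fracturable P) (hQ : A.gram.Fracturable Q) {π : Deriv E} {d : Data}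
    (h : IsProof (A.g P) π) (hd : CodesDeriv π d) :
    ∃ π', IsProof (A.g Q) π' ∧ π'.concl = π.concl ∧ CodesDeriv π' (Data.translate Q.toList d) := by
  obtain ⟨d₁, d₂, h₁, -, e⟩ := codesGSeq_iff.1 hd.root
  refine translate_spec hA hP hQ h hd rfl ?_ (GSeq.covers_of_subset subset_rfl subset_rfl)
  rw [e]
  exact h₁

theorem pTimeTranslatable_g {A : Calculus E} (hA : A.IsImplicit) {P Q : Finset (ProdPair E)}
    (hP : A.gram.Fracturable P) (hQ : A.gram.Fracturable Q) :
    PTimeTranslatable (A.g P) (A.g Q) := by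
  obtain ⟨M, p, h⟩ := (PolyTime.translate Q.toList).runs
  refine ⟨M, p, fun π d hπ hd => ?_⟩
  obtain ⟨π', h₁, h₂, h₃⟩ := exists_proof_g hA hP hQ hπ hd
  obtain ⟨t, h₄, h₅⟩ := h d
  exact ⟨π', _, t, h₁, h₂, h₃, h₄, h₅⟩

theorem polyEquiv_g {A : Calculus E} (hA : A.IsImplicit) {P Q : Finset (ProdPair E)}
    (hP : A.gram.Fracturable P) (hQ : A.gram.Fracturable Q) : PolyEquiv (A.g P) (A.g Q) := by
  have key : ∀ {P Q : Finset (ProdPair E)}, A.gram.Fracturable P → A.gram.Fracturable Q →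
      ∀ G : GSeq E, (∃ π, IsProof (A.g P) π ∧ π.concl = G) →
        ∃ π, IsProof (A.g Q) π ∧ π.concl = G := by
    rintro P Q hP hQ _ ⟨π, hπ, rfl⟩
    obtain ⟨d, hd⟩ := exists_codesDeriv π
    obtain ⟨π', h₁, h₂, -⟩ := exists_proof_g hA hP hQ hπ hd
    exact ⟨π', h₁, h₂⟩
  exact ⟨fun G => ⟨key hP hQ G, key hQ hP G⟩, pTimeTranslatable_g hA hP hQ,
    pTimeTranslatable_g hA hQ hP⟩

end Equivalence
end AbsCalc

/-! ### The theorem on downward spaces -/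

open AbsCalc

theorem mainTheorem2 :
    (∀ E : Finset ℕ, E.Nonempty → ∀ A : Calculus E, A.IsImplicit →
      ExplicateReturns A (downSpace A) ∧
      (∀ B ∈ (downSpace A).carrier, ∀ C ∈ (downSpace A).carrier, PolyEquiv B C) ∧
      (∃! bot, (downSpace A).IsBot bot) ∧
      (∀ bot, (downSpace A).IsBot bot →
        ∀ B ∈ (downSpace A).carrier, B.IsExplicit ↔ B = bot)) ∧
    (∃ (M : Program) (p : Polynomial ℕ), ∀ E : Finset ℕ, E.Nonempty →
      ∀ A : Calculus E, A.IsImplicit → ∀ (nm : Naming) (d : Data), Names nm A →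
        CodesCalculus nm A d →
        ∃ (d' : Data) (t : ℕ), Runs M d d' t ∧ t ≤ 2 ^ p.eval d.size ∧
          CodesSpace nm (downSpace A) d') ∧
    (∃ (M : Program) (p : Polynomial ℕ), ∀ E : Finset ℕ, E.Nonempty →
      ∀ A : Calculus E, A.IsImplicit → ∀ (nm : Naming) (d : Data), Names nm A →
        CodesCalculus nm A d →
        ∀ bot, (downSpace A).IsBot bot →
          ∃ (d' : Data) (t : ℕ), Runs M d d' t ∧ t ≤ p.eval d.size ∧
            CodesCalculus nm bot d') := by

  refine ⟨fun E _ A hA => ⟨explicate_returns hA.1, fun B hB C hC => ?_,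
    ⟨_, (isBot_iff hA.1).2 rfl, fun B hB => (isBot_iff hA.1).1 hB⟩, fun bot hbot B hB => ?_⟩, ?_, ?_⟩
  · obtain ⟨P, hP, rfl⟩ := (inDown_iff hA.1).1 hB
    obtain ⟨Q, hQ, rfl⟩ := (inDown_iff hA.1).1 hC
    exact polyEquiv_g hA hP hQ
  · obtain ⟨P, hP, rfl⟩ := (inDown_iff hA.1).1 hB
    rw [(isBot_iff hA.1).1 hbot]
    exact isExplicit_g_iff hA hP
  -- The program is chosen before the edge types and the calculus: both are read from the input, and
  -- the production pairs are extracted from the labels.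
  · obtain ⟨M, p, h⟩ := expTime_sublists (f := Data.allPairs)
      (g := fun z => Data.downSpace z.hd z.tl) (by fun_prop) (by fun_prop)
    refine ⟨M, p, fun E _ A hA nm d _ hd => ?_⟩
    obtain ⟨t, h₁, h₂⟩ := h d
    exact ⟨_, t, h₁, h₂, hd.downSpace hA.1⟩
  -- The bottom is reached by a single fracturing by all production pairs, so no search through the
  -- space is needed.
  · obtain ⟨M, p, h⟩ := PolyTime.runs (f := fun d => Data.g d d.allPairs) (by fun_prop)
    refine ⟨M, p, fun E _ A hA nm d _ hd bot hbot => ?_⟩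
    obtain ⟨t, h₁, h₂⟩ := h d
    rw [(isBot_iff hA.1).1 hbot]
    exact ⟨_, t, h₁, h₂, hd.g (hd.allPairs hA.1)⟩
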